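/- **Setting.** Let $\mathcal A$ be a Hopf algebra over $\mathbb C$ with antipode $S$. A Hopf bimodule over $\mathcal A$ is an $\mathcal A$-bimodule $\Gamma$ with commuting left and right coactions $\Delta_L,\Delta_R$ satisfying $\Delta_L(a\rho b)=\Delta(a)\Delta_L(\rho)\Delta(b)$ and $\Delta_R(a\rho b)=\Delta(a)\Delta_R(\rho)\Delta(b)$. For Hopf bimodules $M,N$ let $\sigma\colon M\otimes_{\mathcal A}N\to N\otimes_{\mathcal A}M$ be the braiding, i.e. the homomorphism of Hopf bimodules with $\sigma(\alpha\otimes\beta)=\beta_{(0)}\otimes S(\beta_{(1)})\,\alpha\,\beta_{(2)}$ for left-coinvariant $\alpha$. On $\Gamma^{\otimes k}$ (tensor powers over $\mathcal A$) put $A_k^\pm=\sum_{\pi\in S_k}\mathrm{sgn}(\pi)\,\sigma^{\pm1}_\pi$ and $B_{i,j}^\pm=\sum_{\pi^{-1}\in C_{i,j}}\mathrm{sgn}(\pi)\,\sigma^{\pm1}_\pi$, where $\sigma^{\pm1}_\pi=\sigma^{\pm1}_{i_1}\cdots\sigma^{\pm1}_{i_r}$ for a reduced expression $\pi=s_{i_1}\cdots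 s_{i_r}$ and $C_{i,j}\subseteq S_{i+j}$ is the set of permutations increasing on $\{1,\dots,i\}$ and on $\{i+1,\dots,i+j\}$. The exterior powers are $\Gamma^{\wedge k}=\Gamma^{\otimes k}/\ker A_k^+$. Let $(\Gamma_+,\Gamma_-)$ be a pair of bicovariant first order differential calculi over $\mathcal A$ whose spaces of left-coinvariant elements are finite dimensional, and let $g\colon \Gamma_+\otimes_{\mathcal A}\Gamma_-\oplus\Gamma_-\otimes_{\mathcal A}\Gamma_+\to\mathcal A$ be a bicovariant $\sigma$-metric: a homomorphism of $\mathcal A$-bimodules which is non-degenerate, satisfies $g\circ\sigma=g$, $g_{12}\sigma_{23}\sigma_{12}=g_{23}$ and $g_{23}\sigma_{12}\sigma_{23}=g_{12}$, and $\Delta\circ g=(\mathrm{id}\otimes g)\Delta_L=(g\otimes\mathrm{id})\Delta_R$. Extend $g$ to $\tilde g$ on $\Gamma_\tau^{\otimes k}\otimes_{\mathcal A}\Gamma_{-\tau}^{\otimes l}$ by $\tilde g(\xi,a)=\xi a$, $\tilde g(a,\zeta)=a\zeta$, $\tilde g(\xi\otimes\rho,\eta\otimes\zeta)=\tilde g(\xi\,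 g(\rho,\eta),\zeta)$, and let $\langle\cdot,\cdot\rangle^\pm\colon\Gamma_\tau^{\wedge k}\times\Gamma_{-\tau}^{\wedge l}\to\Gamma_{\tau'}^{\wedge|k-l|}$ ($\tau'=\tau$ if $k\ge l$, $\tau'=-\tau$ if $k<l$) be induced by $\tilde g(B^\pm_{k-l,l}\xi,A^\pm_l\zeta)$ for $k\ge l$ and by $\tilde g(A^\pm_k\xi,B^\pm_{k,l-k}\zeta)$ for $k\le l$. For matrix corepresentations $u,v$ of $\mathcal A$, with spaces of matrix elements $\mathcal C(u),\mathcal C(v)$, let $\Gamma^{\wedge k}(u,v)=\{\rho\in\Gamma^{\wedge k}\mid(\mathrm{id}\otimes\Delta_R)\Delta_L\rho\in\mathcal C(u)\otimes\Gamma^{\wedge k}\otimes\mathcal C(v)\}$, and let $u^c=(S(u_{ji}))_{ij}$ be the contragredient corepresentation. **Proposition.** Suppose that $\mathcal A$ is cosemisimple (the sum of its simple subcoalgebras). Then $\mathcal A$ has a unique Haar functional $h$ (a linear functional with $h(1)=1$ and $a_{(1)}h(a_{(2)})=h(a)1=h(a_{(1)})a_{(2)}$ for all $a$). Let $u,v$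 be irreducible corepresentations of $\mathcal A$, $\tau\in\{+,-\}$, and $k\ge0$. (i) For both signs $\pm$ the bilinear map $h\circ\langle\cdot,\cdot\rangle^\pm\colon\Gamma_\tau^{\wedge k}(u,v)\times\Gamma_{-\tau}^{\wedge k}(u^c,v^c)\to\mathbb C$ is non-degenerate in both arguments. (ii) Suppose moreover that the calculus $\Gamma_\tau$ is inner with a (left- and right-) coinvariant one-form $\omega_0^\tau\in\Gamma_\tau$, that is, $\mathrm d_\tau a=\omega_0^\tau a-a\,\omega_0^\tau$ for $a\in\mathcal A$, and let $\mathrm d_\tau\rho=\omega_0^\tau\wedge\rho-(-1)^k\rho\wedge\omega_0^\tau$ for $\rho\in\Gamma_\tau^{\wedge k}$ and $\partial^\pm_{-\tau}\zeta=\langle\zeta,\omega_0^\tau\rangle^\pm+(-1)^{k+1}\langle\omega_0^\tau,\zeta\rangle^\pm$ for $\zeta\in\Gamma_{-\tau}^{\wedge k+1}$. Then $\mathrm d_\tau$ maps $\Gamma_\tau^{\wedge k}(u,v)$ into $\Gamma_\tau^{\wedge k+1}(u,v)$, $\partial^\pm_{-\tau}$ maps $\Gamma_{-\tau}^{\wedge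 k+1}(u^c,v^c)$ into $\Gamma_{-\tau}^{\wedge k}(u^c,v^c)$, and these restricted operators are dual to each other: $$h\langle\mathrm d_\tau\rho,\zeta\rangle^\pm=h\langle\rho,\partial^\pm_{-\tau}\zeta\rangle^\pm\qquad\text{for all }\rho\in\Gamma_\tau^{\wedge k}(u,v),\ \zeta\in\Gamma_{-\tau}^{\wedge k+1}(u^c,v^c).$$ -/

import Mathlib

open scoped TensorProduct

universe u

set_option linter.unusedSimpArgs false

noncomputable section

namespace QuantumForms

/-! ## Hopf bimodules -/

/-- A Hopf bimodule (bicovariant bimodule) over the complex Hopf algebra `A`: an `A`-bimodule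
(`lsmul a m` is `a · m`, `rsmul a m` is `m · a`) with a left coaction `dl` and a right coaction
`dr` which make it an `A`-bicomodule and satisfy `dl (a m b) = Δ a · dl m · Δ b`,
`dr (a m b) = Δ a · dr m · Δ b`. -/
structure HopfBimodule (A : Type u) [Ring A] [HopfAlgebra ℂ A] where
  carrier : Type u
  [addCommGroup : AddCommGroup carrier]
  [module : Module ℂ carrier]
  lsmul : A →ₗ[ℂ] carrier →ₗ[ℂ] carrier
  rsmul : A →ₗ[ℂ] carrier →ₗ[ℂ] carrier
  one_lsmul : ∀ m, lsmul 1 m = m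
  mul_lsmul : ∀ a b m, lsmul (a * b) m = lsmul a (lsmul b m)
  one_rsmul : ∀ m, rsmul 1 m = m
  mul_rsmul : ∀ a b m, rsmul (a * b) m = rsmul b (rsmul a m)
  lsmul_rsmul : ∀ a b m, lsmul a (rsmul b m) = rsmul b (lsmul a m)
  dl : carrier →ₗ[ℂ] A ⊗[ℂ] carrier
  dr : carrier →ₗ[ℂ] carrier ⊗[ℂ] A
  coassoc_left : ∀ m, TensorProduct.assoc ℂ A A carrier
    ((Coalgebra.comul (R := ℂ) (A := A)).rTensor carrier (dl m)) = dl.lTensor A (dl m)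
  counit_left : ∀ m, TensorProduct.lid ℂ carrier
    ((Coalgebra.counit (R := ℂ) (A := A)).rTensor carrier (dl m)) = m
  coassoc_right : ∀ m, TensorProduct.assoc ℂ carrier A A (dr.rTensor A (dr m)) =
    (Coalgebra.comul (R := ℂ) (A := A)).lTensor carrier (dr m)
  counit_right : ∀ m, TensorProduct.rid ℂ carrier
    ((Coalgebra.counit (R := ℂ) (A := A)).lTensor carrier (dr m)) = m
  bicomodule : ∀ m, TensorProduct.assoc ℂ A carrier A (dl.rTensor A (dr m)) =
    dr.lTensor A (dl m)
  dl_lsmul : ∀ a m, dl (lsmul a m) =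
    TensorProduct.map₂ (LinearMap.mul ℂ A) lsmul (Coalgebra.comul (R := ℂ) a) (dl m)
  dl_rsmul : ∀ a m, dl (rsmul a m) =
    TensorProduct.map₂ (LinearMap.mul ℂ A).flip rsmul (Coalgebra.comul (R := ℂ) a) (dl m)
  dr_lsmul : ∀ a m, dr (lsmul a m) =
    TensorProduct.map₂ lsmul (LinearMap.mul ℂ A) (Coalgebra.comul (R := ℂ) a) (dr m)
  dr_rsmul : ∀ a m, dr (rsmul a m) =
    TensorProduct.map₂ rsmul (LinearMap.mul ℂ A).flip (Coalgebra.comul (R := ℂ) a) (dr m)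

attribute [instance] HopfBimodule.addCommGroup HopfBimodule.module

instance {A : Type u} [Ring A] [HopfAlgebra ℂ A] : CoeSort (HopfBimodule A) (Type u) :=
  ⟨HopfBimodule.carrier⟩

variable {A : Type u} [Ring A] [HopfAlgebra ℂ A]

/-- Homomorphisms of `A`-bimodules. -/
structure Hom (M N : HopfBimodule A) extends M.carrier →ₗ[ℂ] N.carrier where
  map_lsmul : ∀ a m, toFun (M.lsmul a m) = N.lsmul a (toFun m)
  map_rsmul : ∀ a m, toFun (M.rsmul a m) = N.rsmul a (toFun m)

namespace Hom

variable {M N P : HopfBimodule A}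

theorem lin_lsmul (f : Hom M N) (a : A) (m : M) :
    f.toLinearMap (M.lsmul a m) = N.lsmul a (f.toLinearMap m) := f.map_lsmul a m

theorem lin_rsmul (f : Hom M N) (a : A) (m : M) :
    f.toLinearMap (M.rsmul a m) = N.rsmul a (f.toLinearMap m) := f.map_rsmul a m

def id (M : HopfBimodule A) : Hom M M where
  toLinearMap := LinearMap.id
  map_lsmul _ _ := rfl
  map_rsmul _ _ := rfl

/-- `f.andThen k` is the composite `k ∘ f`. -/
def andThen (f : Hom M N) (k : Hom N P) : Hom M P where
  toLinearMap := k.toLinearMap ∘ₗ f.toLinearMap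
  map_lsmul a m := by
    change k.toLinearMap (f.toLinearMap _) = P.lsmul a (k.toLinearMap (f.toLinearMap m))
    rw [f.lin_lsmul, k.lin_lsmul]
  map_rsmul a m := by
    change k.toLinearMap (f.toLinearMap _) = P.rsmul a (k.toLinearMap (f.toLinearMap m))
    rw [f.lin_rsmul, k.lin_rsmul]

end Hom

/-- The Hopf algebra `A` as a Hopf bimodule over itself. -/
def unit (A : Type u) [Ring A] [HopfAlgebra ℂ A] : HopfBimodule A where
  carrier := A
  lsmul := LinearMap.mul ℂ A
  rsmul := (LinearMap.mul ℂ A).flip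
  one_lsmul m := by simp
  mul_lsmul a b m := by simp [mul_assoc]
  one_rsmul m := by simp
  mul_rsmul a b m := by simp [mul_assoc]
  lsmul_rsmul a b m := by simp [mul_assoc]
  dl := Coalgebra.comul
  dr := Coalgebra.comul
  coassoc_left m := Coalgebra.coassoc_apply m
  counit_left m := by simp
  coassoc_right m := Coalgebra.coassoc_apply m
  counit_right m := by simp
  bicomodule m := Coalgebra.coassoc_apply m
  dl_lsmul a m := by
    simp only [LinearMap.mul_apply', Bialgebra.comul_mul]
    generalize Coalgebra.comul (R := ℂ) a = x
    generalize Coalgebra.comul (R := ℂ) m = y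
    induction x with
    | zero => simp
    | add x x' hx hx' => simp [add_mul, hx, hx']
    | tmul a b =>
      induction y with
      | zero => simp
      | add y y' hy hy' => simp [mul_add, hy, hy']
      | tmul c d => simp
  dl_rsmul a m := by
    simp only [LinearMap.flip_apply, LinearMap.mul_apply', Bialgebra.comul_mul]
    generalize Coalgebra.comul (R := ℂ) a = x
    generalize Coalgebra.comul (R := ℂ) m = y
    induction x with
    | zero => simp
    | add x x' hx hx' => simp [mul_add, hx, hx']
    | tmul a b =>
      induction y with
      | zero => simp
      | add y y' hy hy' => simp [add_mul, hy, hy']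
      | tmul c d => simp
  dr_lsmul a m := by
    simp only [LinearMap.mul_apply', Bialgebra.comul_mul]
    generalize Coalgebra.comul (R := ℂ) a = x
    generalize Coalgebra.comul (R := ℂ) m = y
    induction x with
    | zero => simp
    | add x x' hx hx' => simp [add_mul, hx, hx']
    | tmul a b =>
      induction y with
      | zero => simp
      | add y y' hy hy' => simp [mul_add, hy, hy']
      | tmul c d => simp
  dr_rsmul a m := by
    simp only [LinearMap.flip_apply, LinearMap.mul_apply', Bialgebra.comul_mul]
    generalize Coalgebra.comul (R := ℂ) a = x
    generalize Coalgebra.comul (R := ℂ) m = y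
    induction x with
    | zero => simp
    | add x x' hx hx' => simp [mul_add, hx, hx']
    | tmul a b =>
      induction y with
      | zero => simp
      | add y y' hy hy' => simp [add_mul, hy, hy']
      | tmul c d => simp

/-! ## The tensor product over `A` -/

/-- The subspace of `M ⊗ N` spanned by all `m a ⊗ n - m ⊗ a n`. -/
def balanced (M N : HopfBimodule A) : Submodule ℂ (M ⊗[ℂ] N) :=
  Submodule.span ℂ {x | ∃ (m : M) (a : A) (n : N), x = M.rsmul a m ⊗ₜ[ℂ] n - m ⊗ₜ[ℂ] N.lsmul a n}

/-- The underlying vector space of `M ⊗_A N`. -/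
abbrev TensorCarrier (M N : HopfBimodule A) : Type u := (M ⊗[ℂ] N) ⧸ balanced M N

/-- `tmk m n` is the element `m ⊗_A n` of `M ⊗_A N`. -/
def tmk (M N : HopfBimodule A) : M →ₗ[ℂ] N →ₗ[ℂ] TensorCarrier M N :=
  (TensorProduct.mk ℂ M N).compr₂ (balanced M N).mkQ

section TensorBasics

variable {M N : HopfBimodule A}

theorem tmk_rsmul (m : M) (a : A) (n : N) :
    tmk M N (M.rsmul a m) n = tmk M N m (N.lsmul a n) := by
  refine (Submodule.Quotient.eq _).2 (Submodule.subset_span ⟨m, a, n, rfl⟩)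

variable {V : Type*} [AddCommGroup V] [Module ℂ V]

/-- A bilinear map which is balanced over `A` induces a linear map on `M ⊗_A N`. -/
def tlift (f : M →ₗ[ℂ] N →ₗ[ℂ] V) (hf : ∀ m a n, f (M.rsmul a m) n = f m (N.lsmul a n)) :
    TensorCarrier M N →ₗ[ℂ] V :=
  (balanced M N).liftQ (TensorProduct.lift f) (by
    refine Submodule.span_le.2 ?_
    rintro _ ⟨m, a, n, rfl⟩
    simp [hf])

@[simp] theorem tlift_tmk (f : M →ₗ[ℂ] N →ₗ[ℂ] V) (hf) (m : M) (n : N) :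
    tlift f hf (tmk M N m n) = f m n := by
  exact (Submodule.liftQ_apply _ _ _).trans (TensorProduct.lift.tmul _ _)

theorem tmk_induction {p : TensorCarrier M N → Prop} (h0 : p 0)
    (ht : ∀ m n, p (tmk M N m n)) (ha : ∀ x y, p x → p y → p (x + y)) (x) : p x := by
  obtain ⟨y, rfl⟩ := (balanced M N).mkQ_surjective x
  induction y with
  | zero => simpa using h0
  | tmul m n => exact ht m n
  | add y y' hy hy' => simpa using ha _ _ hy hy'

theorem tmk_ext {f k : TensorCarrier M N →ₗ[ℂ] V}
    (h : ∀ m n, f (tmk M N m n) = k (tmk M N m n)) : f = k := by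
  ext x
  exact h _ _

end TensorBasics

section TensorStructure

variable (M N : HopfBimodule A)

/-- The left action `a (m ⊗_A n) = a m ⊗_A n`. -/
def tensorLsmul : A →ₗ[ℂ] TensorCarrier M N →ₗ[ℂ] TensorCarrier M N where
  toFun a := tlift (tmk M N ∘ₗ M.lsmul a) (by
    intro m b n; simp [M.lsmul_rsmul, tmk_rsmul])
  map_add' a b := tmk_ext (by simp)
  map_smul' a b := tmk_ext (by simp)

@[simp] theorem tensorLsmul_tmk (a : A) (m : M) (n : N) :
    tensorLsmul M N a (tmk M N m n) = tmk M N (M.lsmul a m) n := by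
  simp [tensorLsmul]

/-- The right action `(m ⊗_A n) a = m ⊗_A n a`. -/
def tensorRsmul : A →ₗ[ℂ] TensorCarrier M N →ₗ[ℂ] TensorCarrier M N where
  toFun a := tlift ((tmk M N).compl₂ (N.rsmul a)) (by
    intro m b n; simp [← N.lsmul_rsmul, tmk_rsmul])
  map_add' a b := tmk_ext (by simp)
  map_smul' a b := tmk_ext (by simp)

@[simp] theorem tensorRsmul_tmk (a : A) (m : M) (n : N) :
    tensorRsmul M N a (tmk M N m n) = tmk M N m (N.rsmul a n) := by
  simp [tensorRsmul]

/-- The map `(a ⊗ m, b ⊗ n) ↦ a b ⊗ (m ⊗_A n)`. -/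
def codiagL : (A ⊗[ℂ] M) →ₗ[ℂ] (A ⊗[ℂ] N) →ₗ[ℂ] A ⊗[ℂ] TensorCarrier M N :=
  TensorProduct.map₂ (LinearMap.mul ℂ A) (tmk M N)

/-- The map `(m ⊗ a, n ⊗ b) ↦ (m ⊗_A n) ⊗ a b`. -/
def codiagR : (M ⊗[ℂ] A) →ₗ[ℂ] (N ⊗[ℂ] A) →ₗ[ℂ] TensorCarrier M N ⊗[ℂ] A :=
  TensorProduct.map₂ (tmk M N) (LinearMap.mul ℂ A)

@[simp] theorem codiagL_tmul (a b : A) (m : M) (n : N) :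
    codiagL M N (a ⊗ₜ m) (b ⊗ₜ n) = (a * b) ⊗ₜ tmk M N m n := by
  simp [codiagL]

@[simp] theorem codiagR_tmul (a b : A) (m : M) (n : N) :
    codiagR M N (m ⊗ₜ a) (n ⊗ₜ b) = tmk M N m n ⊗ₜ (a * b) := by
  simp [codiagR]

/-- The left coaction `m ⊗_A n ↦ m₍₋₁₎ n₍₋₁₎ ⊗ (m₍₀₎ ⊗_A n₍₀₎)`. -/
def tensorDl : TensorCarrier M N →ₗ[ℂ] A ⊗[ℂ] TensorCarrier M N :=
  tlift ((codiagL M N).compl₁₂ M.dl N.dl) (by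
    intro m a n
    simp only [LinearMap.compl₁₂_apply, M.dl_rsmul, N.dl_lsmul]
    generalize Coalgebra.comul (R := ℂ) a = x
    generalize M.dl m = y
    generalize N.dl n = z
    induction x with
    | zero => simp
    | add x x' hx hx' => simp [hx, hx']
    | tmul a b =>
      induction y with
      | zero => simp
      | add y y' hy hy' => simp only [map_add, LinearMap.add_apply, hy, hy']
      | tmul c d =>
        induction z with
        | zero => simp
        | add z z' hz hz' => simp only [map_add, hz, hz']
        | tmul e f => simp [tmk_rsmul, mul_assoc])

@[simp] theorem tensorDl_tmk (m : M) (n : N) :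
    tensorDl M N (tmk M N m n) = codiagL M N (M.dl m) (N.dl n) := by
  simp [tensorDl]

/-- The right coaction `m ⊗_A n ↦ (m₍₀₎ ⊗_A n₍₀₎) ⊗ m₍₁₎ n₍₁₎`. -/
def tensorDr : TensorCarrier M N →ₗ[ℂ] TensorCarrier M N ⊗[ℂ] A :=
  tlift ((codiagR M N).compl₁₂ M.dr N.dr) (by
    intro m a n
    simp only [LinearMap.compl₁₂_apply, M.dr_rsmul, N.dr_lsmul]
    generalize Coalgebra.comul (R := ℂ) a = x
    generalize M.dr m = y
    generalize N.dr n = z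
    induction x with
    | zero => simp
    | add x x' hx hx' => simp [hx, hx']
    | tmul a b =>
      induction y with
      | zero => simp
      | add y y' hy hy' => simp only [map_add, LinearMap.add_apply, hy, hy']
      | tmul c d =>
        induction z with
        | zero => simp
        | add z z' hz hz' => simp only [map_add, hz, hz']
        | tmul e f => simp [tmk_rsmul, mul_assoc])

@[simp] theorem tensorDr_tmk (m : M) (n : N) :
    tensorDr M N (tmk M N m n) = codiagR M N (M.dr m) (N.dr n) := by
  simp [tensorDr]

theorem tensor_coassoc_left (x : TensorCarrier M N) :
    TensorProduct.assoc ℂ A A (TensorCarrier M N)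
      ((Coalgebra.comul (R := ℂ) (A := A)).rTensor _ (tensorDl M N x)) =
    (tensorDl M N).lTensor A (tensorDl M N x) := by
  have h1 : ∀ y z, (tensorDl M N).lTensor A (codiagL M N y z) =
      TensorProduct.map₂ (LinearMap.mul ℂ A) (codiagL M N) (M.dl.lTensor A y)
        (N.dl.lTensor A z) := by
    intro y z
    induction y with
    | zero => simp
    | add y y' hy hy' => simp only [map_add, LinearMap.add_apply, hy, hy']
    | tmul c d =>
      induction z with
      | zero => simp
      | add z z' hz hz' => simp only [map_add, hz, hz']
      | tmul e f =>
        simp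
  have h2 : ∀ y z, TensorProduct.assoc ℂ A A (TensorCarrier M N)
      ((Coalgebra.comul (R := ℂ) (A := A)).rTensor _ (codiagL M N y z)) =
      TensorProduct.map₂ (LinearMap.mul ℂ A) (codiagL M N)
        (TensorProduct.assoc ℂ A A M ((Coalgebra.comul (R := ℂ) (A := A)).rTensor _ y))
        (TensorProduct.assoc ℂ A A N ((Coalgebra.comul (R := ℂ) (A := A)).rTensor _ z)) := by
    intro y z
    induction y with
    | zero => simp
    | add y y' hy hy' => simp only [map_add, LinearMap.add_apply, hy, hy']
    | tmul c d =>
      induction z with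
      | zero => simp
      | add z z' hz hz' => simp only [map_add, hz, hz']
      | tmul e f =>
        simp only [codiagL_tmul, LinearMap.rTensor_tmul, Bialgebra.comul_mul]
        generalize Coalgebra.comul (R := ℂ) c = p
        generalize Coalgebra.comul (R := ℂ) e = q
        induction p with
        | zero => simp
        | add p p' hp hp' => simp only [map_add, LinearMap.add_apply, TensorProduct.add_tmul,
            TensorProduct.tmul_add, add_mul, hp, hp']
        | tmul g k =>
          induction q with
          | zero => simp
          | add q q' hq hq' => simp only [map_add, LinearMap.add_apply, TensorProduct.add_tmul,
              TensorProduct.tmul_add, mul_add, hq, hq']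
          | tmul r s => simp [mul_assoc]

  induction x using tmk_induction with
  | h0 => simp
  | ha x y hx hy => simp only [map_add, hx, hy]
  | ht m n => rw [tensorDl_tmk, h1, h2, M.coassoc_left, N.coassoc_left]

theorem tensor_coassoc_right (x : TensorCarrier M N) :
    TensorProduct.assoc ℂ (TensorCarrier M N) A A
      ((tensorDr M N).rTensor A (tensorDr M N x)) =
    (Coalgebra.comul (R := ℂ) (A := A)).lTensor _ (tensorDr M N x) := by
  have h1 : ∀ y z, TensorProduct.assoc ℂ (TensorCarrier M N) A A
      ((tensorDr M N).rTensor A (codiagR M N y z)) =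
      TensorProduct.map₂ (tmk M N) (TensorProduct.map₂ (LinearMap.mul ℂ A) (LinearMap.mul ℂ A))
        (TensorProduct.assoc ℂ M A A (M.dr.rTensor A y))
        (TensorProduct.assoc ℂ N A A (N.dr.rTensor A z)) := by
    intro y z
    induction y with
    | zero => simp
    | add y y' hy hy' => simp only [map_add, LinearMap.add_apply, hy, hy']
    | tmul c d =>
      induction z with
      | zero => simp
      | add z z' hz hz' => simp only [map_add, hz, hz']
      | tmul e f =>
        simp only [codiagR_tmul, LinearMap.rTensor_tmul, tensorDr_tmk]
        generalize M.dr c = p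
        generalize N.dr e = q
        induction p with
        | zero => simp
        | add p p' hp hp' => simp only [map_add, LinearMap.add_apply, TensorProduct.add_tmul,
            TensorProduct.tmul_add, add_mul, hp, hp']
        | tmul g k =>
          induction q with
          | zero => simp
          | add q q' hq hq' => simp only [map_add, LinearMap.add_apply, TensorProduct.add_tmul,
              TensorProduct.tmul_add, mul_add, hq, hq']
          | tmul r s => simp [mul_assoc]

  have h2 : ∀ y z, (Coalgebra.comul (R := ℂ) (A := A)).lTensor _ (codiagR M N y z) =
      TensorProduct.map₂ (tmk M N) (TensorProduct.map₂ (LinearMap.mul ℂ A) (LinearMap.mul ℂ A))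
        ((Coalgebra.comul (R := ℂ) (A := A)).lTensor _ y)
        ((Coalgebra.comul (R := ℂ) (A := A)).lTensor _ z) := by
    intro y z
    induction y with
    | zero => simp
    | add y y' hy hy' => simp only [map_add, LinearMap.add_apply, hy, hy']
    | tmul c d =>
      induction z with
      | zero => simp
      | add z z' hz hz' => simp only [map_add, hz, hz']
      | tmul e f =>
        simp only [codiagR_tmul, LinearMap.lTensor_tmul, Bialgebra.comul_mul]
        generalize Coalgebra.comul (R := ℂ) d = p
        generalize Coalgebra.comul (R := ℂ) f = q
        induction p with
        | zero => simp
        | add p p' hp hp' => simp only [map_add, LinearMap.add_apply, TensorProduct.add_tmul,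
            TensorProduct.tmul_add, add_mul, hp, hp']
        | tmul g k =>
          induction q with
          | zero => simp
          | add q q' hq hq' => simp only [map_add, LinearMap.add_apply, TensorProduct.add_tmul,
              TensorProduct.tmul_add, mul_add, hq, hq']
          | tmul r s => simp [mul_assoc]

  induction x using tmk_induction with
  | h0 => simp
  | ha x y hx hy => simp only [map_add, hx, hy]
  | ht m n => rw [tensorDr_tmk, h1, h2, M.coassoc_right, N.coassoc_right]

theorem tensor_bicomodule (x : TensorCarrier M N) :
    TensorProduct.assoc ℂ A (TensorCarrier M N) A
      ((tensorDl M N).rTensor A (tensorDr M N x)) =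
    (tensorDr M N).lTensor A (tensorDl M N x) := by
  have h1 : ∀ y z, TensorProduct.assoc ℂ A (TensorCarrier M N) A
      ((tensorDl M N).rTensor A (codiagR M N y z)) =
      TensorProduct.map₂ (LinearMap.mul ℂ A) (codiagR M N)
        (TensorProduct.assoc ℂ A M A (M.dl.rTensor A y))
        (TensorProduct.assoc ℂ A N A (N.dl.rTensor A z)) := by
    intro y z
    induction y with
    | zero => simp
    | add y y' hy hy' => simp only [map_add, LinearMap.add_apply, hy, hy']
    | tmul c d =>
      induction z with
      | zero => simp
      | add z z' hz hz' => simp only [map_add, hz, hz']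
      | tmul e f =>
        simp only [codiagR_tmul, LinearMap.rTensor_tmul, tensorDl_tmk]
        generalize M.dl c = p
        generalize N.dl e = q
        induction p with
        | zero => simp
        | add p p' hp hp' => simp only [map_add, LinearMap.add_apply, TensorProduct.add_tmul,
            TensorProduct.tmul_add, add_mul, hp, hp']
        | tmul g k =>
          induction q with
          | zero => simp
          | add q q' hq hq' => simp only [map_add, LinearMap.add_apply, TensorProduct.add_tmul,
              TensorProduct.tmul_add, mul_add, hq, hq']
          | tmul r s => simp [mul_assoc]

  have h2 : ∀ y z, (tensorDr M N).lTensor A (codiagL M N y z) =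
      TensorProduct.map₂ (LinearMap.mul ℂ A) (codiagR M N) (M.dr.lTensor A y)
        (N.dr.lTensor A z) := by
    intro y z
    induction y with
    | zero => simp
    | add y y' hy hy' => simp only [map_add, LinearMap.add_apply, hy, hy']
    | tmul c d =>
      induction z with
      | zero => simp
      | add z z' hz hz' => simp only [map_add, hz, hz']
      | tmul e f =>
        simp
  induction x using tmk_induction with
  | h0 => simp
  | ha x y hx hy => simp only [map_add, hx, hy]
  | ht m n => rw [tensorDl_tmk, tensorDr_tmk, h1, h2, M.bicomodule, N.bicomodule]

theorem tensor_counit_left (x : TensorCarrier M N) :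
    TensorProduct.lid ℂ (TensorCarrier M N)
      ((Coalgebra.counit (R := ℂ) (A := A)).rTensor _ (tensorDl M N x)) = x := by
  have h1 : ∀ y z, TensorProduct.lid ℂ (TensorCarrier M N)
      ((Coalgebra.counit (R := ℂ) (A := A)).rTensor _ (codiagL M N y z)) =
      tmk M N (TensorProduct.lid ℂ M ((Coalgebra.counit (R := ℂ) (A := A)).rTensor _ y))
        (TensorProduct.lid ℂ N ((Coalgebra.counit (R := ℂ) (A := A)).rTensor _ z)) := by
    intro y z
    induction y with
    | zero => simp
    | add y y' hy hy' => simp only [map_add, LinearMap.add_apply, hy, hy']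
    | tmul c d =>
      induction z with
      | zero => simp
      | add z z' hz hz' => simp only [map_add, hz, hz']
      | tmul e f =>
        simp [smul_smul, mul_comm]
  induction x using tmk_induction with
  | h0 => simp
  | ha x y hx hy => simp only [map_add, hx, hy]
  | ht m n => rw [tensorDl_tmk, h1, M.counit_left, N.counit_left]

theorem tensor_counit_right (x : TensorCarrier M N) :
    TensorProduct.rid ℂ (TensorCarrier M N)
      ((Coalgebra.counit (R := ℂ) (A := A)).lTensor _ (tensorDr M N x)) = x := by
  have h1 : ∀ y z, TensorProduct.rid ℂ (TensorCarrier M N)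
      ((Coalgebra.counit (R := ℂ) (A := A)).lTensor _ (codiagR M N y z)) =
      tmk M N (TensorProduct.rid ℂ M ((Coalgebra.counit (R := ℂ) (A := A)).lTensor _ y))
        (TensorProduct.rid ℂ N ((Coalgebra.counit (R := ℂ) (A := A)).lTensor _ z)) := by
    intro y z
    induction y with
    | zero => simp
    | add y y' hy hy' => simp only [map_add, LinearMap.add_apply, hy, hy']
    | tmul c d =>
      induction z with
      | zero => simp
      | add z z' hz hz' => simp only [map_add, hz, hz']
      | tmul e f =>
        simp [smul_smul, mul_comm]
  induction x using tmk_induction with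
  | h0 => simp
  | ha x y hx hy => simp only [map_add, hx, hy]
  | ht m n => rw [tensorDr_tmk, h1, M.counit_right, N.counit_right]

theorem tensor_dl_lsmul (a : A) (x : TensorCarrier M N) :
    tensorDl M N (tensorLsmul M N a x) = TensorProduct.map₂ (LinearMap.mul ℂ A) (tensorLsmul M N)
      (Coalgebra.comul (R := ℂ) a) (tensorDl M N x) := by
  induction x using tmk_induction with
  | h0 => simp
  | ha x y hx hy => simp only [map_add, hx, hy]
  | ht m n =>
    simp only [tensorLsmul_tmk, tensorDl_tmk, M.dl_lsmul]
    generalize Coalgebra.comul (R := ℂ) a = x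
    generalize M.dl m = y
    generalize N.dl n = z
    induction x with
    | zero => simp
    | add x x' hx hx' => simp only [map_add, LinearMap.add_apply, hx, hx']
    | tmul a b =>
      induction y with
      | zero => simp
      | add y y' hy hy' => simp only [map_add, LinearMap.add_apply, hy, hy']
      | tmul c d =>
        induction z with
        | zero => simp
        | add z z' hz hz' => simp only [map_add, hz, hz']
        | tmul e f => simp [mul_assoc]

theorem tensor_dl_rsmul (a : A) (x : TensorCarrier M N) :
    tensorDl M N (tensorRsmul M N a x) = TensorProduct.map₂ (LinearMap.mul ℂ A).flip (tensorRsmul M N)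
      (Coalgebra.comul (R := ℂ) a) (tensorDl M N x) := by
  induction x using tmk_induction with
  | h0 => simp
  | ha x y hx hy => simp only [map_add, hx, hy]
  | ht m n =>
    simp only [tensorRsmul_tmk, tensorDl_tmk, N.dl_rsmul]
    generalize Coalgebra.comul (R := ℂ) a = x
    generalize M.dl m = y
    generalize N.dl n = z
    induction x with
    | zero => simp
    | add x x' hx hx' => simp only [map_add, LinearMap.add_apply, hx, hx']
    | tmul a b =>
      induction y with
      | zero => simp
      | add y y' hy hy' => simp only [map_add, LinearMap.add_apply, hy, hy']
      | tmul c d =>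
        induction z with
        | zero => simp
        | add z z' hz hz' => simp only [map_add, hz, hz']
        | tmul e f => simp [mul_assoc]

theorem tensor_dr_lsmul (a : A) (x : TensorCarrier M N) :
    tensorDr M N (tensorLsmul M N a x) = TensorProduct.map₂ (tensorLsmul M N) (LinearMap.mul ℂ A)
      (Coalgebra.comul (R := ℂ) a) (tensorDr M N x) := by
  induction x using tmk_induction with
  | h0 => simp
  | ha x y hx hy => simp only [map_add, hx, hy]
  | ht m n =>
    simp only [tensorLsmul_tmk, tensorDr_tmk, M.dr_lsmul]
    generalize Coalgebra.comul (R := ℂ) a = x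
    generalize M.dr m = y
    generalize N.dr n = z
    induction x with
    | zero => simp
    | add x x' hx hx' => simp only [map_add, LinearMap.add_apply, hx, hx']
    | tmul a b =>
      induction y with
      | zero => simp
      | add y y' hy hy' => simp only [map_add, LinearMap.add_apply, hy, hy']
      | tmul c d =>
        induction z with
        | zero => simp
        | add z z' hz hz' => simp only [map_add, hz, hz']
        | tmul e f => simp [mul_assoc]

theorem tensor_dr_rsmul (a : A) (x : TensorCarrier M N) :
    tensorDr M N (tensorRsmul M N a x) = TensorProduct.map₂ (tensorRsmul M N) (LinearMap.mul ℂ A).flip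
      (Coalgebra.comul (R := ℂ) a) (tensorDr M N x) := by
  induction x using tmk_induction with
  | h0 => simp
  | ha x y hx hy => simp only [map_add, hx, hy]
  | ht m n =>
    simp only [tensorRsmul_tmk, tensorDr_tmk, N.dr_rsmul]
    generalize Coalgebra.comul (R := ℂ) a = x
    generalize M.dr m = y
    generalize N.dr n = z
    induction x with
    | zero => simp
    | add x x' hx hx' => simp only [map_add, LinearMap.add_apply, hx, hx']
    | tmul a b =>
      induction y with
      | zero => simp
      | add y y' hy hy' => simp only [map_add, LinearMap.add_apply, hy, hy']
      | tmul c d =>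
        induction z with
        | zero => simp
        | add z z' hz hz' => simp only [map_add, hz, hz']
        | tmul e f => simp [mul_assoc]

end TensorStructure

/-- The tensor product `M ⊗_A N` of Hopf bimodules. -/
def tensor (M N : HopfBimodule A) : HopfBimodule A where
  carrier := TensorCarrier M N
  lsmul := tensorLsmul M N
  rsmul := tensorRsmul M N
  one_lsmul x := by
    induction x using tmk_induction with
    | h0 => simp
    | ha x y hx hy => simp only [map_add, hx, hy]
    | ht m n => simp [M.one_lsmul]
  mul_lsmul a b x := by
    induction x using tmk_induction with
    | h0 => simp
    | ha x y hx hy => simp only [map_add, hx, hy]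
    | ht m n => simp [M.mul_lsmul]
  one_rsmul x := by
    induction x using tmk_induction with
    | h0 => simp
    | ha x y hx hy => simp only [map_add, hx, hy]
    | ht m n => simp [N.one_rsmul]
  mul_rsmul a b x := by
    induction x using tmk_induction with
    | h0 => simp
    | ha x y hx hy => simp only [map_add, hx, hy]
    | ht m n => simp [N.mul_rsmul]
  lsmul_rsmul a b x := by
    induction x using tmk_induction with
    | h0 => simp
    | ha x y hx hy => simp only [map_add, hx, hy]
    | ht m n => simp
  dl := tensorDl M N
  dr := tensorDr M N
  coassoc_left := tensor_coassoc_left M N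
  counit_left := tensor_counit_left M N
  coassoc_right := tensor_coassoc_right M N
  counit_right := tensor_counit_right M N
  bicomodule := tensor_bicomodule M N
  dl_lsmul := tensor_dl_lsmul M N
  dl_rsmul := tensor_dl_rsmul M N
  dr_lsmul := tensor_dr_lsmul M N
  dr_rsmul := tensor_dr_rsmul M N


section TensorInterface

variable {M N : HopfBimodule A} {V : Type*} [AddCommGroup V] [Module ℂ V]

/-- `tm M N m n` is the element `m ⊗_A n` of the Hopf bimodule `M ⊗_A N`. -/
def tm (M N : HopfBimodule A) : M →ₗ[ℂ] N →ₗ[ℂ] (tensor M N).carrier := tmk M N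

theorem tm_rsmul (m : M) (a : A) (n : N) :
    tm M N (M.rsmul a m) n = tm M N m (N.lsmul a n) := tmk_rsmul m a n

@[simp] theorem lsmul_tm (a : A) (m : M) (n : N) :
    (tensor M N).lsmul a (tm M N m n) = tm M N (M.lsmul a m) n := tensorLsmul_tmk M N a m n

@[simp] theorem rsmul_tm (a : A) (m : M) (n : N) :
    (tensor M N).rsmul a (tm M N m n) = tm M N m (N.rsmul a n) := tensorRsmul_tmk M N a m n

theorem tm_induction {p : (tensor M N).carrier → Prop} (h0 : p 0)
    (ht : ∀ m n, p (tm M N m n)) (ha : ∀ x y, p x → p y → p (x + y)) (x) : p x :=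
  tmk_induction h0 ht ha x

/-- A bilinear map which is balanced over `A` induces a linear map on `M ⊗_A N`. -/
def tensorLift (f : M →ₗ[ℂ] N →ₗ[ℂ] V) (hf : ∀ m a n, f (M.rsmul a m) n = f m (N.lsmul a n)) :
    (tensor M N).carrier →ₗ[ℂ] V := tlift f hf

@[simp] theorem tensorLift_tm (f : M →ₗ[ℂ] N →ₗ[ℂ] V) (hf) (m : M) (n : N) :
    tensorLift f hf (tm M N m n) = f m n := tlift_tmk f hf m n

theorem tm_ext {f k : (tensor M N).carrier →ₗ[ℂ] V}
    (h : ∀ m n, f (tm M N m n) = k (tm M N m n)) : f = k := tmk_ext h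

end TensorInterface

namespace Hom

variable {M N P Q : HopfBimodule A}

/-- The bimodule homomorphism on `M ⊗_A N` induced by a balanced bilinear map which is left
linear in the first and right linear in the second variable. -/
def lift (f : M →ₗ[ℂ] N →ₗ[ℂ] P.carrier)
    (hf : ∀ m a n, f (M.rsmul a m) n = f m (N.lsmul a n))
    (hl : ∀ a m n, f (M.lsmul a m) n = P.lsmul a (f m n))
    (hr : ∀ a m n, f m (N.rsmul a n) = P.rsmul a (f m n)) : Hom (tensor M N) P where
  toLinearMap := tensorLift f hf
  map_lsmul a x := by
    change tensorLift f hf _ = P.lsmul a (tensorLift f hf x)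
    induction x using tm_induction with
    | h0 => simp
    | ha x y hx hy => simp only [map_add, hx, hy]
    | ht m n => simp [hl]
  map_rsmul a x := by
    change tensorLift f hf _ = P.rsmul a (tensorLift f hf x)
    induction x using tm_induction with
    | h0 => simp
    | ha x y hx hy => simp only [map_add, hx, hy]
    | ht m n => simp [hr]

@[simp] theorem lift_tm (f : M →ₗ[ℂ] N →ₗ[ℂ] P.carrier) (hf hl hr) (m : M) (n : N) :
    (lift f hf hl hr).toLinearMap (tm M N m n) = f m n := tensorLift_tm f hf m n

/-- `f ⊗_A k`. -/
def map (f : Hom M P) (k : Hom N Q) : Hom (tensor M N) (tensor P Q) :=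
  lift ((tm P Q).compl₁₂ f.toLinearMap k.toLinearMap)
    (by intro m a n; simp [f.lin_rsmul, k.lin_lsmul, tm_rsmul])
    (by intro a m n; simp [f.lin_lsmul])
    (by intro a m n; simp [k.lin_rsmul])

/-- `(M ⊗_A N) ⊗_A P → M ⊗_A (N ⊗_A P)`, `(m ⊗ n) ⊗ p ↦ m ⊗ (n ⊗ p)`. -/
def assoc (M N P : HopfBimodule A) : Hom (tensor (tensor M N) P) (tensor M (tensor N P)) :=
  lift
    (tensorLift
      (LinearMap.mk₂ ℂ (fun m n => (tm M (tensor N P) m) ∘ₗ (tm N P n))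
        (by intros; ext; simp) (by intros; ext; simp) (by intros; ext; simp)
        (by intros; ext; simp))
      (by intro m a n; ext p; simp [tm_rsmul, ← lsmul_tm]))
    (by
      intro x a p
      induction x using tm_induction with
      | h0 => simp
      | ha x y hx hy => simp only [map_add, LinearMap.add_apply, hx, hy]
      | ht m n => simp [tm_rsmul])
    (by
      intro a x p
      induction x using tm_induction with
      | h0 => simp
      | ha x y hx hy => simp only [map_add, LinearMap.add_apply, hx, hy]
      | ht m n => simp)
    (by
      intro a x p
      induction x using tm_induction with
      | h0 => simp
      | ha x y hx hy => simp only [map_add, LinearMap.add_apply, hx, hy]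
      | ht m n => simp)

/-- `M ⊗_A (N ⊗_A P) → (M ⊗_A N) ⊗_A P`, `m ⊗ (n ⊗ p) ↦ (m ⊗ n) ⊗ p`. -/
def assocInv (M N P : HopfBimodule A) : Hom (tensor M (tensor N P)) (tensor (tensor M N) P) :=
  lift
    { toFun := fun m => tensorLift (tm (tensor M N) P ∘ₗ tm M N m)
        (by intro n a p; simp [← tm_rsmul])
      map_add' := fun m m' => tm_ext (by simp)
      map_smul' := fun c m => tm_ext (by simp) }
    (by
      intro m a x
      induction x using tm_induction with
      | h0 => simp
      | ha x y hx hy => simp only [map_add, hx, hy]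
      | ht n p => simp [tm_rsmul])
    (by
      intro a m x
      induction x using tm_induction with
      | h0 => simp
      | ha x y hx hy => simp only [map_add, hx, hy]
      | ht n p => simp)
    (by
      intro a m x
      induction x using tm_induction with
      | h0 => simp
      | ha x y hx hy => simp only [map_add, hx, hy]
      | ht n p => simp)

/-- `A ⊗_A M → M`, `a ⊗ m ↦ a m`. -/
def lunit (M : HopfBimodule A) : Hom (tensor (unit A) M) M :=
  lift (M := unit A) M.lsmul (fun a b m => M.mul_lsmul a b m) (fun a b m => M.mul_lsmul a b m)
    (fun a b m => M.lsmul_rsmul b a m)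

/-- `M ⊗_A A → M`, `m ⊗ a ↦ m a`. -/
def runit (M : HopfBimodule A) : Hom (tensor M (unit A)) M :=
  lift (N := unit A) M.rsmul.flip (fun m a b => (M.mul_rsmul a b m).symm)
    (fun a m b => (M.lsmul_rsmul a b m).symm)
    (fun a m b => M.mul_rsmul b a m)

/-- `M → A ⊗_A M`, `m ↦ 1 ⊗ m`. -/
def lunitInv (M : HopfBimodule A) : Hom M (tensor (unit A) M) where
  toLinearMap := tm (unit A) M (1 : A)
  map_lsmul a m := by
    have h1 : (unit A).rsmul a (1 : A) = (unit A).lsmul a (1 : A) :=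
      (one_mul a).trans (mul_one a).symm
    exact ((tm_rsmul (M := unit A) (1 : A) a m).symm.trans (by rw [h1])).trans
      (lsmul_tm (M := unit A) a (1 : A) m).symm
  map_rsmul a m := (rsmul_tm (M := unit A) a (1 : A) m).symm

end Hom

/-! ## The braiding -/

namespace HopfBimodule

/-- The map `b ⊗ c ↦ (m ↦ S b · m · c)`. -/
def adjAux (M : HopfBimodule A) : A ⊗[ℂ] A →ₗ[ℂ] M →ₗ[ℂ] M :=
  TensorProduct.lift (LinearMap.mk₂ ℂ
    (fun b c => M.lsmul (HopfAlgebra.antipode ℂ b) ∘ₗ M.rsmul c)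
    (by intros; ext; simp) (by intros; ext; simp) (by intros; ext; simp) (by intros; ext; simp))

@[simp] theorem adjAux_tmul (M : HopfBimodule A) (b c : A) (m : M) :
    M.adjAux (b ⊗ₜ c) m = M.lsmul (HopfAlgebra.antipode ℂ b) (M.rsmul c m) := by
  simp [adjAux]

/-- The right adjoint action `m ◁ a = S a₍₁₎ · m · a₍₂₎`; `M.adj a m` is `m ◁ a`. -/
def adj (M : HopfBimodule A) : A →ₗ[ℂ] M →ₗ[ℂ] M := M.adjAux ∘ₗ Coalgebra.comul

/-- The projection `m ↦ S m₍₋₁₎ · m₍₀₎` onto the left-coinvariant elements. -/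
def proj (M : HopfBimodule A) : M →ₗ[ℂ] M :=
  TensorProduct.lift (M.lsmul ∘ₗ HopfAlgebra.antipode ℂ) ∘ₗ M.dl

theorem adj_mul (M : HopfBimodule A) (a b : A) (m : M) :
    M.adj (a * b) m = M.adj b (M.adj a m) := by
  simp only [adj, LinearMap.comp_apply, Bialgebra.comul_mul]
  generalize Coalgebra.comul (R := ℂ) a = x
  generalize Coalgebra.comul (R := ℂ) b = y
  induction x with
  | zero => simp
  | add x x' hx hx' => simp only [add_mul, map_add, LinearMap.add_apply, hx, hx']
  | tmul p q =>
    induction y with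
    | zero => simp
    | add y y' hy hy' => simp only [mul_add, map_add, LinearMap.add_apply, hy, hy']
    | tmul r t =>
      simp [HopfAlgebra.antipode_mul_antidistrib, M.mul_lsmul, M.mul_rsmul, M.lsmul_rsmul]

theorem lsmul_algebraMap (M : HopfBimodule A) (c : ℂ) (m : M) :
    M.lsmul (algebraMap ℂ A c) m = c • m := by
  rw [Algebra.algebraMap_eq_smul_one, map_smul, LinearMap.smul_apply, M.one_lsmul]

/-- `a₍₁₎ · (m ◁ a₍₂₎) = m · a`. -/
theorem lift_adj_comul (M : HopfBimodule A) (a : A) (m : M) :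
    TensorProduct.lift (M.lsmul.compl₂ (M.adj.flip m)) (Coalgebra.comul (R := ℂ) a) =
      M.rsmul a m := by
  have h1 : ∀ y : A ⊗[ℂ] A, TensorProduct.lift (M.lsmul.compl₂ (M.adj.flip m)) y =
      TensorProduct.lift (M.lsmul.compl₂ (M.adjAux.flip m))
        ((Coalgebra.comul (R := ℂ) (A := A)).lTensor A y) := by
    intro y
    induction y with
    | zero => simp
    | add y y' hy hy' => simp only [map_add, hy, hy']
    | tmul p q => simp [adj]
  have h2 : ∀ y : A ⊗[ℂ] A, TensorProduct.lift (M.lsmul.compl₂ (M.adjAux.flip m))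
      (TensorProduct.assoc ℂ A A A ((Coalgebra.comul (R := ℂ) (A := A)).rTensor A y)) =
      M.rsmul (TensorProduct.lid ℂ A ((Coalgebra.counit (R := ℂ) (A := A)).rTensor A y)) m := by
    intro y
    induction y with
    | zero => simp
    | add y y' hy hy' => simp only [map_add, LinearMap.add_apply, hy, hy']
    | tmul p q =>
      have h3 : ∀ x : A ⊗[ℂ] A, TensorProduct.lift (M.lsmul.compl₂ (M.adjAux.flip m))
          (TensorProduct.assoc ℂ A A A (x ⊗ₜ q)) =
          M.lsmul (LinearMap.mul' ℂ A ((HopfAlgebra.antipode ℂ).lTensor A x)) (M.rsmul q m) := by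
        intro x
        induction x with
        | zero => simp
        | add x x' hx hx' =>
          simp only [map_add, LinearMap.add_apply, TensorProduct.add_tmul, hx, hx']
        | tmul r t => simp [M.mul_lsmul]
      rw [LinearMap.rTensor_tmul, h3, HopfAlgebra.mul_antipode_lTensor_comul_apply,
        lsmul_algebraMap]
      simp
  rw [h1, ← Coalgebra.coassoc_apply, h2]
  simp

theorem proj_rsmul (M : HopfBimodule A) (a : A) (m : M) :
    M.proj (M.rsmul a m) = M.adj a (M.proj m) := by
  simp only [adj, proj, LinearMap.comp_apply, M.dl_rsmul]
  generalize Coalgebra.comul (R := ℂ) a = x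
  generalize M.dl m = y
  induction x with
  | zero => simp
  | add x x' hx hx' => simp only [map_add, LinearMap.add_apply, hx, hx']
  | tmul p q =>
    induction y with
    | zero => simp
    | add y y' hy hy' => simp only [map_add, LinearMap.add_apply, hy, hy']
    | tmul r t =>
      simp [HopfAlgebra.antipode_mul_antidistrib, M.mul_lsmul, M.lsmul_rsmul]

theorem proj_lsmul (M : HopfBimodule A) (a : A) (m : M) :
    M.proj (M.lsmul a m) = Coalgebra.counit (R := ℂ) a • M.proj m := by
  simp only [proj, LinearMap.comp_apply, M.dl_lsmul]
  generalize M.dl m = y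
  induction y with
  | zero => simp
  | add y y' hy hy' => simp only [map_add, smul_add, hy, hy']
  | tmul r t =>
    have h : ∀ x : A ⊗[ℂ] A, TensorProduct.lift (M.lsmul ∘ₗ HopfAlgebra.antipode ℂ)
        (TensorProduct.map₂ (LinearMap.mul ℂ A) M.lsmul x (r ⊗ₜ t)) =
        M.lsmul (HopfAlgebra.antipode ℂ r)
          (M.lsmul (LinearMap.mul' ℂ A ((HopfAlgebra.antipode ℂ).rTensor A x)) t) := by
      intro x
      induction x with
      | zero => simp
      | add x x' hx hx' => simp only [map_add, LinearMap.add_apply, hx, hx']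
      | tmul p q => simp [HopfAlgebra.antipode_mul_antidistrib, M.mul_lsmul]
    rw [h, HopfAlgebra.mul_antipode_rTensor_comul_apply, lsmul_algebraMap]
    simp

/-- `m ↦ m₍₋₁₎ ⊗ P m₍₀₎`, with `P` the projection onto the left-coinvariant elements. -/
def split (M : HopfBimodule A) : M →ₗ[ℂ] A ⊗[ℂ] M := M.proj.lTensor A ∘ₗ M.dl

theorem split_rsmul (M : HopfBimodule A) (a : A) (m : M) :
    M.split (M.rsmul a m) = TensorProduct.map₂ (LinearMap.mul ℂ A).flip M.adj
      (Coalgebra.comul (R := ℂ) a) (M.split m) := by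
  simp only [split, LinearMap.comp_apply, M.dl_rsmul]
  generalize Coalgebra.comul (R := ℂ) a = x
  generalize M.dl m = y
  induction x with
  | zero => simp
  | add x x' hx hx' => simp only [map_add, LinearMap.add_apply, hx, hx']
  | tmul p q =>
    induction y with
    | zero => simp
    | add y y' hy hy' => simp only [map_add, hy, hy']
    | tmul r t => simp [proj_rsmul]

theorem split_lsmul (M : HopfBimodule A) (a : A) (m : M) :
    M.split (M.lsmul a m) = (LinearMap.mul ℂ A a).rTensor M (M.split m) := by
  simp only [split, LinearMap.comp_apply, M.dl_lsmul]
  generalize M.dl m = y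
  induction y with
  | zero => simp
  | add y y' hy hy' => simp only [map_add, hy, hy']
  | tmul r t =>
    have h : ∀ x : A ⊗[ℂ] A, M.proj.lTensor A
        (TensorProduct.map₂ (LinearMap.mul ℂ A) M.lsmul x (r ⊗ₜ t)) =
        (TensorProduct.rid ℂ A ((Coalgebra.counit (R := ℂ) (A := A)).lTensor A x) * r) ⊗ₜ
          M.proj t := by
      intro x
      induction x with
      | zero => simp
      | add x x' hx hx' =>
        simp only [map_add, LinearMap.add_apply, add_mul, TensorProduct.add_tmul, hx, hx']
      | tmul p q => simp [proj_lsmul, TensorProduct.smul_tmul']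
    rw [h]
    simp

section Braiding

variable (M N : HopfBimodule A)

/-- `n ⊗ b ↦ (x ↦ n ⊗_A (x ◁ b))`. -/
def braidCore : N ⊗[ℂ] A →ₗ[ℂ] M →ₗ[ℂ] (tensor N M).carrier :=
  TensorProduct.lift (LinearMap.mk₂ ℂ (fun n b => tm N M n ∘ₗ M.adj b)
    (by intros; ext; simp) (by intros; ext; simp) (by intros; ext; simp) (by intros; ext; simp))

@[simp] theorem braidCore_tmul (n : N) (b : A) (x : M) :
    braidCore M N (n ⊗ₜ b) x = tm N M n (M.adj b x) := by
  simp [braidCore]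

/-- `(c ⊗ x, n ⊗ b) ↦ c · (n ⊗_A (x ◁ b))`. -/
def braidAux : A ⊗[ℂ] M →ₗ[ℂ] N ⊗[ℂ] A →ₗ[ℂ] (tensor N M).carrier :=
  TensorProduct.lift (LinearMap.mk₂ ℂ
    (fun c x => (tensor N M).lsmul c ∘ₗ (braidCore M N).flip x)
    (by intros; apply LinearMap.ext; simp) (by intros; apply LinearMap.ext; simp)
    (by intros; apply LinearMap.ext; simp) (by intros; apply LinearMap.ext; simp))

@[simp] theorem braidAux_tmul (c : A) (x : M) (y : N ⊗[ℂ] A) :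
    braidAux M N (c ⊗ₜ x) y = (tensor N M).lsmul c (braidCore M N y x) := by
  simp [braidAux]

/-- The braiding `σ : M ⊗_A N → N ⊗_A M`,
`σ (m ⊗ n) = m₍₋₁₎ n₍₀₎ ⊗ (P m₍₀₎ ◁ n₍₁₎)` with `P m = S m₍₋₁₎ · m₍₀₎`. It is the bimodule
homomorphism with `σ (α ⊗ β) = β₍₀₎ ⊗ (α ◁ β₍₁₎)` for left-coinvariant `α`. -/
def braiding : Hom (tensor M N) (tensor N M) :=
  Hom.lift ((braidAux M N).compl₁₂ M.split N.dr)
    (by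
      intro m a n
      simp only [LinearMap.compl₁₂_apply, split_rsmul, N.dr_lsmul]
      generalize Coalgebra.comul (R := ℂ) a = x
      generalize M.split m = y
      generalize N.dr n = z
      induction x with
      | zero => simp
      | add x x' hx hx' => simp only [map_add, LinearMap.add_apply, hx, hx']
      | tmul p q =>
        induction y with
        | zero => simp
        | add y y' hy hy' => simp only [map_add, LinearMap.add_apply, hy, hy']
        | tmul c t =>
          induction z with
          | zero => simp
          | add z z' hz hz' => simp only [map_add, LinearMap.add_apply, hz, hz']
          | tmul e f => simp [adj_mul, N.mul_lsmul])
    (by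
      intro a m n
      simp only [LinearMap.compl₁₂_apply, split_lsmul]
      generalize M.split m = y
      induction y with
      | zero => simp
      | add y y' hy hy' => simp only [map_add, LinearMap.add_apply, hy, hy']
      | tmul c t => simp [(tensor N M).mul_lsmul])
    (by
      intro a m n
      simp only [LinearMap.compl₁₂_apply, N.dr_rsmul]
      generalize M.split m = y
      generalize N.dr n = z
      induction y with
      | zero => simp
      | add y y' hy hy' => simp only [map_add, LinearMap.add_apply, hy, hy']
      | tmul c t =>
        induction z with
        | zero => simp
        | add z z' hz hz' => simp only [map_add, LinearMap.add_apply, hz, hz']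
        | tmul e f =>
          have h : ∀ x : A ⊗[ℂ] A, braidAux M N (c ⊗ₜ t)
              (TensorProduct.map₂ N.rsmul (LinearMap.mul ℂ A).flip x (e ⊗ₜ f)) =
              (tensor N M).lsmul c (tm N M e
                (TensorProduct.lift (M.lsmul.compl₂ (M.adj.flip (M.adj f t))) x)) := by
            intro x
            induction x with
            | zero => simp
            | add x x' hx hx' => simp only [map_add, LinearMap.add_apply, hx, hx']
            | tmul p q => simp [adj_mul, ← tm_rsmul, N.lsmul_rsmul]
          rw [h, lift_adj_comul]
          simp)

/-- The subspace of left-coinvariant elements. -/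
def leftCoinv : Submodule ℂ M :=
  LinearMap.ker (M.dl - TensorProduct.mk ℂ A M 1)

/-- The subspace of right-coinvariant elements. -/
def rightCoinv : Submodule ℂ M :=
  LinearMap.ker (M.dr - (TensorProduct.mk ℂ M A).flip 1)

theorem mem_leftCoinv (m : M) : m ∈ leftCoinv M ↔ M.dl m = 1 ⊗ₜ m := by
  simp [leftCoinv, sub_eq_zero]

/-- The characteristic formula `σ (α ⊗ β) = β₍₀₎ ⊗ (α ◁ β₍₁₎)` for left-coinvariant `α`. -/
theorem braiding_of_leftCoinv (m : M) (hm : m ∈ leftCoinv M) (n : N) :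
    (braiding M N).toLinearMap (tm M N m n) = braidCore M N (N.dr n) m := by
  rw [mem_leftCoinv] at hm
  have hp : M.proj m = m := by simp [proj, hm, M.one_lsmul]
  have hs : M.split m = 1 ⊗ₜ m := by simp [split, hm, hp]
  simp [braiding, hs, (tensor N M).one_lsmul]

end Braiding

end HopfBimodule

/-! ## Tensor powers, antisymmetrisers, exterior powers -/

/-- The two signs. They serve both for the two calculi and for the two braidings `σ`, `σ⁻¹`. -/
inductive Sgn
  | plus
  | minus

/-- The tensor power `Γ^{⊗ k}` over `A`. -/
def tpow (Γ : HopfBimodule A) : ℕ → HopfBimodule A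
  | 0 => unit A
  | k + 1 => tensor (tpow Γ k) Γ

/-- The identification of two tensor powers of equal degree. -/
def tcast (Γ : HopfBimodule A) {k l : ℕ} (h : k = l) : Hom (tpow Γ k) (tpow Γ l) :=
  h ▸ Hom.id (tpow Γ k)

/-- The multiplication `Γ^{⊗ k} ⊗_A Γ^{⊗ l} → Γ^{⊗ n}`, `n = k + l`, of the tensor algebra. -/
def tmulHom (Γ : HopfBimodule A) :
    (l k n : ℕ) → n = k + l → Hom (tensor (tpow Γ k) (tpow Γ l)) (tpow Γ n)
  | 0, k, _, h => (Hom.runit (tpow Γ k)).andThen (tcast Γ h.symm)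
  | _ + 1, _, 0, h => absurd h (by omega)
  | l + 1, k, n + 1, h =>
    (Hom.assocInv (tpow Γ k) (tpow Γ l) Γ).andThen
      (Hom.map (tmulHom Γ l k n (by omega)) (Hom.id Γ))

/-- The braiding acting in the neighbouring tensor factors number `i` and `i + 1` of `Γ^{⊗ k}`,
where the factors are numbered from `0` to `k - 1`. -/
def sigmaAt (Γ : HopfBimodule A) : (k : ℕ) → ℕ → Hom (tpow Γ k) (tpow Γ k)
  | 0, _ => Hom.id _
  | 1, _ => Hom.id _
  | k + 2, i =>
    if i = k then
      ((Hom.assoc (tpow Γ k) Γ Γ).andThen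
        (Hom.map (Hom.id (tpow Γ k)) (HopfBimodule.braiding Γ Γ))).andThen
        (Hom.assocInv (tpow Γ k) Γ Γ)
    else Hom.map (sigmaAt Γ (k + 1) i) (Hom.id Γ)

/-- `σ_i` for the sign `+` and its inverse for the sign `-`, as an element of the endomorphism
ring of the vector space `Γ^{⊗ k}`. -/
def sigmaPM (Γ : HopfBimodule A) (k : ℕ) (ε : Sgn) (i : Fin (k - 1)) :
    Module.End ℂ (tpow Γ k) :=
  match ε with
  | .plus => (sigmaAt Γ k i).toLinearMap
  | .minus => Ring.inverse ((sigmaAt Γ k i).toLinearMap : Module.End ℂ (tpow Γ k))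

/-- The simple transposition exchanging `i` and `i + 1`. -/
def simpleTransposition (k : ℕ) (i : Fin (k - 1)) : Equiv.Perm (Fin k) :=
  Equiv.swap ⟨i, by omega⟩ ⟨i + 1, by omega⟩

/-- The word `w` is a reduced expression of the permutation `π`. -/
def IsReduced {k : ℕ} (π : Equiv.Perm (Fin k)) (w : List (Fin (k - 1))) : Prop :=
  (w.map (simpleTransposition k)).prod = π ∧
    ∀ w' : List (Fin (k - 1)), (w'.map (simpleTransposition k)).prod = π → w.length ≤ w'.length

/-- Every permutation has a reduced expression. -/
theorem exists_isReduced {k : ℕ} (π : Equiv.Perm (Fin k)) : ∃ w, IsReduced π w := by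
  have h : ∃ w : List (Fin (k - 1)), (w.map (simpleTransposition k)).prod = π := by
    cases k with
    | zero => exact ⟨[], Subsingleton.elim _ _⟩
    | succ n =>
      have hπ : π ∈ Submonoid.closure
          (Set.range fun i : Fin n => Equiv.swap i.castSucc i.succ) := by
        rw [Equiv.Perm.mclosure_swap_castSucc_succ]
        trivial
      induction hπ using Submonoid.closure_induction with
      | mem x hx =>
        obtain ⟨i, rfl⟩ := hx
        exact ⟨[i], by simp [simpleTransposition, Fin.castSucc, Fin.succ]; rfl⟩
      | one => exact ⟨[], by simp⟩
      | mul x y _ _ hx hy =>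
        obtain ⟨v, rfl⟩ := hx
        obtain ⟨w, rfl⟩ := hy
        exact ⟨v ++ w, by simp⟩
  classical
  obtain ⟨w, hw, hm⟩ := WellFounded.has_min (measure (List.length (α := Fin (k - 1)))).wf
    {w | (w.map (simpleTransposition k)).prod = π} h
  exact ⟨w, hw, fun w' hw' => not_lt.1 (hm w' hw')⟩

/-- A reduced expression of `π`. -/
def reducedWord {k : ℕ} (π : Equiv.Perm (Fin k)) : List (Fin (k - 1)) :=
  (exists_isReduced π).choose

/-- `σ_π = σ_{i₁} ⋯ σ_{iᵣ}` for a reduced expression `π = s_{i₁} ⋯ s_{iᵣ}`; by the braid equation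
it does not depend on the reduced expression. -/
def sigmaPerm (Γ : HopfBimodule A) (k : ℕ) (ε : Sgn) (π : Equiv.Perm (Fin k)) :
    Module.End ℂ (tpow Γ k) :=
  ((reducedWord π).map (sigmaPM Γ k ε)).prod

/-- `sgn π • σ_π`. -/
def signedSigma (Γ : HopfBimodule A) (k : ℕ) (ε : Sgn) (π : Equiv.Perm (Fin k)) :
    Module.End ℂ (tpow Γ k) :=
  (((Equiv.Perm.sign π : ℤˣ) : ℤ) : ℂ) • sigmaPerm Γ k ε π

/-- The antisymmetriser `A_k^±`. -/
def antisym (Γ : HopfBimodule A) (k : ℕ) (ε : Sgn) : Module.End ℂ (tpow Γ k) :=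
  ∑ π : Equiv.Perm (Fin k), signedSigma Γ k ε π

/-- The shuffle permutations `C_{i,k-i}`: increasing on the first `i` and on the other places. -/
def IsShuffle (i : ℕ) {k : ℕ} (π : Equiv.Perm (Fin k)) : Prop :=
  (∀ a b : Fin k, a < b → (b : ℕ) < i → π a < π b) ∧
    ∀ a b : Fin k, a < b → i ≤ (a : ℕ) → π a < π b

open Classical in
/-- The endomorphism `B_{i,k-i}^±` of `Γ^{⊗ k}`. -/
def shuffleSum (Γ : HopfBimodule A) (i k : ℕ) (ε : Sgn) : Module.End ℂ (tpow Γ k) :=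
  ∑ π : Equiv.Perm (Fin k) with IsShuffle i π⁻¹, signedSigma Γ k ε π

/-- The exterior power `Γ^{∧ k} = Γ^{⊗ k} / ker A_k`. -/
abbrev ExtPow (Γ : HopfBimodule A) (k : ℕ) : Type u :=
  (tpow Γ k) ⧸ LinearMap.ker (antisym Γ k .plus)

/-- The projection `Γ^{⊗ k} → Γ^{∧ k}`. -/
def toExt (Γ : HopfBimodule A) (k : ℕ) : tpow Γ k →ₗ[ℂ] ExtPow Γ k :=
  Submodule.mkQ _

section Descend

variable {V W X : Type*} [AddCommGroup V] [AddCommGroup W] [AddCommGroup X]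
  [Module ℂ V] [Module ℂ W] [Module ℂ X]

open Classical in
/-- The linear map on `V / p` induced by a linear map `f` on `V` which vanishes on `p`
(and `0` for an `f` which does not). All maps to which it is applied below do vanish on `p` as soon
as the antipode of `A` is bijective and, for the contractions, `g` belongs to a `σ`-metric. -/
def descend (p : Submodule ℂ V) (f : V →ₗ[ℂ] X) : (V ⧸ p) →ₗ[ℂ] X :=
  if h : p ≤ LinearMap.ker f then p.liftQ f h else 0

/-- The bilinear map on `V / p × W / q` induced by a bilinear map on `V × W`. -/
def descend₂ (p : Submodule ℂ V) (q : Submodule ℂ W) (f : V →ₗ[ℂ] W →ₗ[ℂ] X) :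
    (V ⧸ p) →ₗ[ℂ] (W ⧸ q) →ₗ[ℂ] X :=
  descend p (descend q f.flip).flip

end Descend

section Exterior

variable (Γ : HopfBimodule A)

/-- The left coaction on `Γ^{∧ k}`. -/
def extDl (k : ℕ) : ExtPow Γ k →ₗ[ℂ] A ⊗[ℂ] ExtPow Γ k :=
  descend _ ((toExt Γ k).lTensor A ∘ₗ (tpow Γ k).dl)

/-- The right coaction on `Γ^{∧ k}`. -/
def extDr (k : ℕ) : ExtPow Γ k →ₗ[ℂ] ExtPow Γ k ⊗[ℂ] A :=
  descend _ ((toExt Γ k).rTensor A ∘ₗ (tpow Γ k).dr)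

/-- The two-sided coaction `Γ^{∧ k} → A ⊗ Γ^{∧ k} ⊗ A`. -/
def extDlr (k : ℕ) : ExtPow Γ k →ₗ[ℂ] A ⊗[ℂ] (ExtPow Γ k ⊗[ℂ] A) :=
  (extDr Γ k).lTensor A ∘ₗ extDl Γ k

/-- The exterior product `Γ^{∧ k} × Γ^{∧ l} → Γ^{∧ n}`, `n = k + l`. -/
def wedge (k l n : ℕ) (h : n = k + l) : ExtPow Γ k →ₗ[ℂ] ExtPow Γ l →ₗ[ℂ] ExtPow Γ n :=
  descend₂ _ _
    ((tm (tpow Γ k) (tpow Γ l)).compr₂ (toExt Γ n ∘ₗ (tmulHom Γ l k n h).toLinearMap))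

/-- The element of `Γ^{∧ 1}` given by an element of `Γ`. -/
def oneForm : Γ →ₗ[ℂ] ExtPow Γ 1 :=
  toExt Γ 1 ∘ₗ (Hom.lunitInv Γ).toLinearMap

/-- The identification of `Γ^{∧ 0}` with `A`. -/
def extZero : ExtPow Γ 0 →ₗ[ℂ] A :=
  descend _ (LinearMap.id : A →ₗ[ℂ] A)

/-- The inner differential `ρ ↦ ω ∧ ρ - (-1)^k ρ ∧ ω` on `Γ^{∧ k}`. -/
def innerD (ω : Γ) (k : ℕ) : ExtPow Γ k →ₗ[ℂ] ExtPow Γ (k + 1) :=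
  wedge Γ 1 k (k + 1) (Nat.add_comm k 1) (oneForm Γ ω) -
    (-1 : ℂ) ^ k • (wedge Γ k 1 (k + 1) rfl).flip (oneForm Γ ω)

end Exterior

/-! ## Contractions -/

section Contraction

variable {Γ Λ : HopfBimodule A} (g : Hom (tensor Γ Λ) (unit A))

/-- `Γ ⊗_A Λ^{⊗ n+1} → Λ^{⊗ n}`, `ρ ⊗ (η ⊗ ζ) ↦ g(ρ, η) ζ` for `η ∈ Λ`, `ζ ∈ Λ^{⊗ n}`. -/
def peel : (n : ℕ) → Hom (tensor Γ (tpow Λ (n + 1))) (tpow Λ n)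
  | 0 => (Hom.map (Hom.id Γ) (Hom.lunit Λ)).andThen g
  | n + 1 => (Hom.assocInv Γ (tpow Λ (n + 1)) Λ).andThen (Hom.map (peel n) (Hom.id Λ))

/-- The extension `g̃ : Γ^{⊗ k} ⊗_A Λ^{⊗ l} → Γ^{⊗ m}`, `k = m + l`, of `g`:
`g̃(ξ, a) = ξ a`, `g̃(ξ ⊗ ρ, η ⊗ ζ) = g̃(ξ g(ρ, η), ζ)`. -/
def gtildeL : (l k m : ℕ) → k = m + l → Hom (tensor (tpow Γ k) (tpow Λ l)) (tpow Γ m)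
  | 0, k, _, h => (Hom.runit (tpow Γ k)).andThen (tcast Γ h)
  | _ + 1, 0, _, h => absurd h (by omega)
  | l + 1, k + 1, m, h =>
    ((Hom.assoc (tpow Γ k) Γ (tpow Λ (l + 1))).andThen
      (Hom.map (Hom.id (tpow Γ k)) (peel g l))).andThen (gtildeL l k m (by omega))

/-- The extension `g̃ : Γ^{⊗ k} ⊗_A Λ^{⊗ l} → Λ^{⊗ m}`, `l = m + k`, of `g`:
`g̃(a, ζ) = a ζ`, `g̃(ξ ⊗ ρ, η ⊗ ζ) = g̃(ξ g(ρ, η), ζ)`. -/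
def gtildeR : (k l m : ℕ) → l = m + k → Hom (tensor (tpow Γ k) (tpow Λ l)) (tpow Λ m)
  | 0, l, _, h => (Hom.lunit (tpow Λ l)).andThen (tcast Λ h)
  | _ + 1, 0, _, h => absurd h (by omega)
  | k + 1, l + 1, m, h =>
    ((Hom.assoc (tpow Γ k) Γ (tpow Λ (l + 1))).andThen
      (Hom.map (Hom.id (tpow Γ k)) (peel g l))).andThen (gtildeR k l m (by omega))

/-- The contraction `⟨ξ, ζ⟩^± = g̃(B_{k-l,l}^± ξ, A_l^± ζ)`,
`Γ^{∧ k} × Λ^{∧ l} → Γ^{∧ m}`, for `k = m + l`. -/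
def contractL (ε : Sgn) (k l m : ℕ) (h : k = m + l) :
    ExtPow Γ k →ₗ[ℂ] ExtPow Λ l →ₗ[ℂ] ExtPow Γ m :=
  descend₂ _ _
    (((tm (tpow Γ k) (tpow Λ l)).compr₂ (toExt Γ m ∘ₗ (gtildeL g l k m h).toLinearMap)).compl₁₂
      (shuffleSum Γ m k ε) (antisym Λ l ε))

/-- The contraction `⟨ξ, ζ⟩^± = g̃(A_k^± ξ, B_{k,l-k}^± ζ)`,
`Γ^{∧ k} × Λ^{∧ l} → Λ^{∧ m}`, for `l = m + k`. -/
def contractR (ε : Sgn) (k l m : ℕ) (h : l = m + k) :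
    ExtPow Γ k →ₗ[ℂ] ExtPow Λ l →ₗ[ℂ] ExtPow Λ m :=
  descend₂ _ _
    (((tm (tpow Γ k) (tpow Λ l)).compr₂ (toExt Λ m ∘ₗ (gtildeR g k l m h).toLinearMap)).compl₁₂
      (antisym Γ k ε) (shuffleSum Λ k l ε))

/-- The contraction `⟨·,·⟩^± : Γ^{∧ k} × Λ^{∧ k} → A` in equal degrees. -/
def pairing (ε : Sgn) (k : ℕ) : ExtPow Γ k →ₗ[ℂ] ExtPow Λ k →ₗ[ℂ] A :=
  (contractL g ε k k 0 (Nat.zero_add k).symm).compr₂ (extZero Γ)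

/-- The codifferential `ρ ↦ ⟨ρ, ω⟩^± + (-1)^k ⟨ω, ρ⟩^±` on `Γ^{∧ k}` for `k > 0`, where `ω ∈ Λ`,
and `g`, `g'` are the metric on `Γ ⊗_A Λ` and on `Λ ⊗_A Γ`. (The codifferential is `0` on `Γ^{∧ 0}`;
the degree is written as `k + 1` here.) -/
def codiff (g' : Hom (tensor Λ Γ) (unit A)) (ε : Sgn) (ω : Λ) (k : ℕ) :
    ExtPow Γ (k + 1) →ₗ[ℂ] ExtPow Γ k :=
  (contractL g ε (k + 1) 1 k rfl).flip (oneForm Λ ω) +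
    (-1 : ℂ) ^ (k + 1) • contractR g' ε 1 (k + 1) k rfl (oneForm Λ ω)

end Contraction

/-! ## Metrics and differential calculi -/

section Metric

variable {X Y : HopfBimodule A}

/-- `g_{12}` on `(X ⊗_A Y) ⊗_A Λ`. -/
def g12 (g : Hom (tensor X Y) (unit A)) (Λ : HopfBimodule A) : Hom (tensor (tensor X Y) Λ) Λ :=
  (Hom.map g (Hom.id Λ)).andThen (Hom.lunit Λ)

/-- `g_{23}` on `Λ ⊗_A (X ⊗_A Y)`. -/
def g23 (g : Hom (tensor X Y) (unit A)) (Λ : HopfBimodule A) : Hom (tensor Λ (tensor X Y)) Λ :=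
  (Hom.map (Hom.id Λ) g).andThen (Hom.runit Λ)

/-- `σ_{23} σ_{12}` on `Λ ⊗_A (X ⊗_A Y)`. -/
def sigma23sigma12 (Λ X Y : HopfBimodule A) :
    Hom (tensor Λ (tensor X Y)) (tensor (tensor X Y) Λ) :=
  ((((Hom.assocInv Λ X Y).andThen (Hom.map (HopfBimodule.braiding Λ X) (Hom.id Y))).andThen
    (Hom.assoc X Λ Y)).andThen (Hom.map (Hom.id X) (HopfBimodule.braiding Λ Y))).andThen
    (Hom.assocInv X Y Λ)

/-- `σ_{12} σ_{23}` on `(X ⊗_A Y) ⊗_A Λ`. -/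
def sigma12sigma23 (X Y Λ : HopfBimodule A) :
    Hom (tensor (tensor X Y) Λ) (tensor Λ (tensor X Y)) :=
  ((((Hom.assoc X Y Λ).andThen (Hom.map (Hom.id X) (HopfBimodule.braiding Y Λ))).andThen
    (Hom.assocInv X Λ Y)).andThen (Hom.map (HopfBimodule.braiding X Λ) (Hom.id Y))).andThen
    (Hom.assoc Λ X Y)

end Metric

/-- A homomorphism to the Hopf bimodule `A` as a linear map to `A`. -/
def Hom.toA {M : HopfBimodule A} (f : Hom M (unit A)) : M →ₗ[ℂ] A := f.toLinearMap

/-- A bicovariant `σ`-metric of the pair `(Γ₊, Γ₋)` of Hopf bimodules: a homomorphism of bimodules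
`Γ₊ ⊗_A Γ₋ ⊕ Γ₋ ⊗_A Γ₊ → A`, given by its two components `g`, which is non-degenerate,
`σ`-symmetric, compatible with the braiding and bicovariant. -/
structure SigmaMetric (Γ : Sgn → HopfBimodule A) where
  g : ∀ {τ τ' : Sgn}, τ ≠ τ' → Hom (tensor (Γ τ) (Γ τ')) (unit A)
  nondegenerate_left : ∀ {τ τ' : Sgn} (h : τ ≠ τ') (ξ : Γ τ),
    (∀ ζ : Γ τ', (g h).toA (tm _ _ ξ ζ) = 0) → ξ = 0
  nondegenerate_right : ∀ {τ τ' : Sgn} (h : τ ≠ τ') (ζ : Γ τ'),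
    (∀ ξ : Γ τ, (g h).toA (tm _ _ ξ ζ) = 0) → ζ = 0
  sigma_symm : ∀ {τ τ' : Sgn} (h : τ ≠ τ') (x : tensor (Γ τ) (Γ τ')),
    (g h.symm).toA ((HopfBimodule.braiding (Γ τ) (Γ τ')).toLinearMap x) =
      (g h).toA x
  braid_left : ∀ {τ τ' : Sgn} (h : τ ≠ τ') (κ : Sgn) (x : tensor (Γ κ) (tensor (Γ τ) (Γ τ'))),
    (g12 (g h) (Γ κ)).toLinearMap ((sigma23sigma12 (Γ κ) (Γ τ) (Γ τ')).toLinearMap x) =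
      (g23 (g h) (Γ κ)).toLinearMap x
  braid_right : ∀ {τ τ' : Sgn} (h : τ ≠ τ') (κ : Sgn) (x : tensor (tensor (Γ τ) (Γ τ')) (Γ κ)),
    (g23 (g h) (Γ κ)).toLinearMap ((sigma12sigma23 (Γ τ) (Γ τ') (Γ κ)).toLinearMap x) =
      (g12 (g h) (Γ κ)).toLinearMap x
  covariant_left : ∀ {τ τ' : Sgn} (h : τ ≠ τ') (x : tensor (Γ τ) (Γ τ')),
    Coalgebra.comul (R := ℂ) (A := A) ((g h).toA x) =
      (g h).toA.lTensor A ((tensor (Γ τ) (Γ τ')).dl x)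
  covariant_right : ∀ {τ τ' : Sgn} (h : τ ≠ τ') (x : tensor (Γ τ) (Γ τ')),
    Coalgebra.comul (R := ℂ) (A := A) ((g h).toA x) =
      (g h).toA.rTensor A ((tensor (Γ τ) (Γ τ')).dr x)

/-- A bicovariant first order differential calculus over `A`. -/
structure BicovariantFODC (A : Type u) [Ring A] [HopfAlgebra ℂ A] extends HopfBimodule A where
  d : A →ₗ[ℂ] carrier
  leibniz : ∀ a b, d (a * b) = rsmul b (d a) + lsmul a (d b)
  span_eq_top : Submodule.span ℂ {x | ∃ a b : A, x = lsmul a (d b)} = ⊤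
  dl_d : ∀ a b, dl (lsmul a (d b)) = TensorProduct.map₂ (LinearMap.mul ℂ A) lsmul
    (Coalgebra.comul (R := ℂ) a) (d.lTensor A (Coalgebra.comul (R := ℂ) b))
  dr_d : ∀ a b, dr (lsmul a (d b)) = TensorProduct.map₂ lsmul (LinearMap.mul ℂ A)
    (Coalgebra.comul (R := ℂ) a) (d.rTensor A (Coalgebra.comul (R := ℂ) b))

/-- The calculus is inner with the coinvariant one-form `ω`: `d a = ω a - a ω`. -/
def BicovariantFODC.IsInner (Γ : BicovariantFODC A) (ω : Γ.carrier) : Prop :=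
  ω ∈ Γ.toHopfBimodule.leftCoinv ∧ ω ∈ Γ.toHopfBimodule.rightCoinv ∧
    ∀ a, Γ.d a = Γ.rsmul a ω - Γ.lsmul a ω

/-! ## Cosemisimple Hopf algebras -/

/-- The subspace `C` is a subcoalgebra. -/
def IsSubcoalgebra (C : Submodule ℂ A) : Prop :=
  ∀ c ∈ C, Coalgebra.comul (R := ℂ) c ∈ LinearMap.range (TensorProduct.mapIncl C C)

/-- A simple subcoalgebra: it is nonzero, and `0` and itself are its only subcoalgebras. -/
def IsSimpleSubcoalgebra (C : Submodule ℂ A) : Prop :=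
  IsSubcoalgebra C ∧ C ≠ ⊥ ∧ ∀ D ≤ C, IsSubcoalgebra D → D = ⊥ ∨ D = C

/-- `A` is cosemisimple: it is the sum of its simple subcoalgebras. -/
def IsCosemisimple (A : Type u) [Ring A] [HopfAlgebra ℂ A] : Prop :=
  sSup {C : Submodule ℂ A | IsSimpleSubcoalgebra C} = ⊤

/-- `h` is the Haar functional: `h 1 = 1` and `h` is left and right invariant,
`a₍₁₎ h(a₍₂₎) = h(a) 1 = h(a₍₁₎) a₍₂₎`. -/
def IsHaarFunctional (h : A →ₗ[ℂ] ℂ) : Prop :=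
  h 1 = 1 ∧
    (∀ a, TensorProduct.rid ℂ A (h.lTensor A (Coalgebra.comul (R := ℂ) a)) = h a • (1 : A)) ∧
    ∀ a, TensorProduct.lid ℂ A (h.rTensor A (Coalgebra.comul (R := ℂ) a)) = h a • (1 : A)

/-- The matrix `u` with entries in `A` is a corepresentation of `A`. -/
def IsCorep {n : ℕ} (u : Matrix (Fin n) (Fin n) A) : Prop :=
  (∀ i j, Coalgebra.comul (R := ℂ) (u i j) = ∑ k, u i k ⊗ₜ[ℂ] u k j) ∧
    ∀ i j, Coalgebra.counit (R := ℂ) (u i j) = if i = j then 1 else 0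

/-- The coaction `ℂⁿ → ℂⁿ ⊗ A`, `e_j ↦ ∑ᵢ e_i ⊗ u_{ij}`, of a corepresentation. -/
def corepCoaction {n : ℕ} (u : Matrix (Fin n) (Fin n) A) :
    (Fin n → ℂ) →ₗ[ℂ] (Fin n → ℂ) ⊗[ℂ] A :=
  ∑ i, ∑ j, TensorProduct.mk ℂ (Fin n → ℂ) A (Pi.single i 1) ∘ₗ
    LinearMap.toSpanSingleton ℂ A (u i j) ∘ₗ LinearMap.proj j

/-- The corepresentation `u` is irreducible: its space is nonzero and has no invariant subspaces
except for `0` and itself. -/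
def IsIrreducibleCorep {n : ℕ} (u : Matrix (Fin n) (Fin n) A) : Prop :=
  IsCorep u ∧ 0 < n ∧ ∀ W : Submodule ℂ (Fin n → ℂ),
    (∀ w ∈ W, corepCoaction u w ∈ LinearMap.range (W.subtype.rTensor A)) → W = ⊥ ∨ W = ⊤

/-- The contragredient `(uᶜ)_{ij} = S(u_{ji})`. -/
def contragredient {n : ℕ} (u : Matrix (Fin n) (Fin n) A) : Matrix (Fin n) (Fin n) A :=
  fun i j => HopfAlgebra.antipode ℂ (u j i)

/-- The coalgebra `C(u)` of matrix elements. -/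
def matrixElements {n : ℕ} (u : Matrix (Fin n) (Fin n) A) : Submodule ℂ A :=
  Submodule.span ℂ {x | ∃ i j, x = u i j}

/-- `Γ^{∧ k}(u, v)`: all forms `ρ` with `Δ_{LR} ρ ∈ C(u) ⊗ Γ^{∧ k} ⊗ C(v)`. -/
def isotypic (Γ : HopfBimodule A) (k : ℕ) {m n : ℕ} (u : Matrix (Fin m) (Fin m) A)
    (v : Matrix (Fin n) (Fin n) A) : Submodule ℂ (ExtPow Γ k) :=
  (LinearMap.range (TensorProduct.map (matrixElements u).subtype
    ((matrixElements v).subtype.lTensor (ExtPow Γ k)))).comap (extDlr Γ k)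

end QuantumForms

end

open QuantumForms

/-! The Haar functional comes from semisimplicity. Subcoalgebras of `A` are the submodules for the
operators `a ↦ φ(a₍₁₎) a₍₂₎` and `a ↦ a₍₁₎ φ(a₍₂₎)`, so cosemisimplicity gives every subcoalgebra
`C` a complementary subcoalgebra. The counit cut off to `C` along that complement is a support
functional of `C`: its hit actions project `A` onto `C`. For `C = ℂ 1` this functional is the Haar
functional `h`. Invariance gives `h(a₍₁₎ b) a₍₂₎ = h(a b₍₁₎) S(b₍₂₎)` and its mirror image
(`lhit_mul`, `rhit_mul`). From these follow the faithfulness of `h`, the bijectivity of `S`, and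
`S²(C) = C` for finite-dimensional subcoalgebras `C`.

A basis of the left-coinvariant elements makes each calculus a free module (`Frame`). In such a
basis the braiding is an explicit matrix expression; it is bijective because `S` is, it commutes
with the coactions, and it satisfies the braid equation. By Matsumoto's theorem `σ_π` is then
independent of the reduced word, and the signs are absorbed by using the generators `-σ_i`. Minimal
coset representatives give the factorisation of `A_{k+1}` into an antisymmetriser on `k`
neighbouring factors times a shuffle sum. The longest permutation relates `A_k^+` to `A_k^-` by an
invertible factor, so that both have the same kernel.

The braid conditions on `g` say that `σ_i` on one side of the contraction is adjoint to `σ` at the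
mirrored position on the other side. Hence `A_k` is self-adjoint (`bracket_antisym`) and the pairing
of classes is `⟨x, z⟩ = g̃(x, A_k z)` (`pairing_toExt`). The form `g̃` is non-degenerate because `g`
has dual bases of coinvariant elements, and faithfulness of `h` makes `h ∘ ⟨·,·⟩` non-degenerate on
the full exterior powers. Part (i) follows because `h ∘ ⟨·,·⟩` is invariant: the action of a
functional on one argument moves to the other argument through the antipode. Support functionals
project onto `Γ^{∧ k}(u, v)` and `Γ^{∧ k}(uᶜ, vᶜ)`, and these projections correspond under that
adjunction. The right coaction needs `S²(C(v)) = C(v)`.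

For part (ii), a biinvariant `ω` makes the differential and the codifferential commute with the
coactions, which preserves the isotypic components. Applying `A_k` to the codifferential of `z`
contracts `A_{k+1} z` with `ω` at its two ends, by the two factorisations of `A_{k+1}`. The
contraction at the beginning is adjoint to `ρ ↦ ρ ⊗ ω` by definition of `g̃`. The one at the end is
adjoint to `ρ ↦ ω ⊗ ρ` after applying `h`, because `h g(ω, x) = h g(x, ω)` (`metric_symm`). -/

noncomputable section

namespace QuantumForms

/-! ## Slices of tensors and stable subspaces -/

section Slices

variable {V W X : Type*} [AddCommGroup V] [Module ℂ V] [AddCommGroup W] [Module ℂ W]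
  [AddCommGroup X] [Module ℂ X]

/-- The slice `v ⊗ w ↦ φ v • w`. -/
def lslice (φ : V →ₗ[ℂ] ℂ) : V ⊗[ℂ] W →ₗ[ℂ] W :=
  (TensorProduct.lid ℂ W).toLinearMap ∘ₗ φ.rTensor W

/-- The slice `v ⊗ w ↦ φ w • v`. -/
def rslice (φ : W →ₗ[ℂ] ℂ) : V ⊗[ℂ] W →ₗ[ℂ] V :=
  (TensorProduct.rid ℂ V).toLinearMap ∘ₗ φ.lTensor V

@[simp] theorem lslice_tmul (φ : V →ₗ[ℂ] ℂ) (v : V) (w : W) :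
    lslice φ (v ⊗ₜ[ℂ] w) = φ v • w := by simp [lslice]

@[simp] theorem rslice_tmul (φ : W →ₗ[ℂ] ℂ) (v : V) (w : W) :
    rslice φ (v ⊗ₜ[ℂ] w) = φ w • v := by simp [rslice]

/-- The coordinate functionals of a basis of the first factor already separate tensors. -/
theorem eq_of_lslice_eq {x y : V ⊗[ℂ] W} (h : ∀ φ : V →ₗ[ℂ] ℂ, lslice φ x = lslice φ y) :
    x = y := by
  classical
  let b := Module.Basis.ofVectorSpace ℂ V
  apply (TensorProduct.equivFinsuppOfBasisLeft b).injective
  ext i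
  simpa [TensorProduct.equivFinsuppOfBasisLeft_apply, lslice] using h (b.coord i)

theorem eq_of_rslice_eq {x y : V ⊗[ℂ] W} (h : ∀ φ : W →ₗ[ℂ] ℂ, rslice φ x = rslice φ y) :
    x = y := by
  classical
  let b := Module.Basis.ofVectorSpace ℂ W
  apply (TensorProduct.equivFinsuppOfBasisRight b).injective
  ext i
  simpa [TensorProduct.equivFinsuppOfBasisRight_apply, rslice] using h (b.coord i)

theorem lslice_lTensor (φ : V →ₗ[ℂ] ℂ) (f : W →ₗ[ℂ] X) (x : V ⊗[ℂ] W) :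
    lslice φ (f.lTensor V x) = f (lslice φ x) := by
  induction x with
  | zero => simp
  | add x y hx hy => simp only [map_add, hx, hy]
  | tmul v w => simp

theorem rslice_rTensor (φ : W →ₗ[ℂ] ℂ) (f : V →ₗ[ℂ] X) (x : V ⊗[ℂ] W) :
    rslice φ (f.rTensor W x) = f (rslice φ x) := by
  induction x with
  | zero => simp
  | add x y hx hy => simp only [map_add, hx, hy]
  | tmul v w => simp

theorem lslice_rTensor (φ : X →ₗ[ℂ] ℂ) (f : V →ₗ[ℂ] X) (x : V ⊗[ℂ] W) :
    lslice φ (f.rTensor W x) = lslice (φ ∘ₗ f) x := by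
  induction x with
  | zero => simp
  | add x y hx hy => simp only [map_add, hx, hy]
  | tmul v w => simp

theorem rslice_lTensor (φ : X →ₗ[ℂ] ℂ) (f : W →ₗ[ℂ] X) (x : V ⊗[ℂ] W) :
    rslice φ (f.lTensor V x) = rslice (φ ∘ₗ f) x := by
  induction x with
  | zero => simp
  | add x y hx hy => simp only [map_add, hx, hy]
  | tmul v w => simp

/-- Used on one leg of a tensor: if all slices along the other leg lie in `C`, then `p` on that leg
fixes the tensor, so the leg may be taken in `C`. -/
theorem exists_linearProjection (C : Submodule ℂ V) :
    ∃ p : V →ₗ[ℂ] V, (∀ x, p x ∈ C) ∧ ∀ x ∈ C, p x = x := by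
  obtain ⟨p, hp⟩ := C.exists_isCompl
  refine ⟨C.subtype ∘ₗ C.projectionOnto p hp, fun x => by simp, fun x hx => ?_⟩
  simpa using congrArg Subtype.val (Submodule.projectionOnto_apply_left hp ⟨x, hx⟩)

theorem exists_functional_ne_zero (C : Submodule ℂ V) {x : V} (hx : x ∉ C) :
    ∃ f : V →ₗ[ℂ] ℂ, f x ≠ 0 ∧ ∀ c ∈ C, f c = 0 := by
  obtain ⟨f, hf, hC⟩ := Submodule.exists_le_ker_of_notMem hx
  exact ⟨f, hf, fun c hc => hC hc⟩

end Slices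

variable {A : Type u} [Ring A] [HopfAlgebra ℂ A]

local notation "ε" => Coalgebra.counit (R := ℂ) (A := A)
local notation "Δ" => Coalgebra.comul (R := ℂ) (A := A)
local notation "𝓢" => HopfAlgebra.antipode ℂ (A := A)

/-- `a ↦ φ(a₍₁₎) a₍₂₎`. -/
def lhit (φ : A →ₗ[ℂ] ℂ) : A →ₗ[ℂ] A := lslice φ ∘ₗ Δ

/-- `a ↦ a₍₁₎ φ(a₍₂₎)`. -/
def rhit (φ : A →ₗ[ℂ] ℂ) : A →ₗ[ℂ] A := rslice φ ∘ₗ Δ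

@[simp] theorem lhit_counit (a : A) : lhit ε a = a := by simp [lhit, lslice]

@[simp] theorem rhit_counit (a : A) : rhit ε a = a := by simp [rhit, rslice]

/-- Counitality. It is mostly used backwards: to prove `φ a = 0` it suffices to show that the hit of
`φ` on `a` is killed by the counit. -/
theorem counit_lhit (φ : A →ₗ[ℂ] ℂ) (a : A) : ε (lhit φ a) = φ a := by
  have h : ∀ x : A ⊗[ℂ] A, ε (lslice φ x) = φ (rslice ε x) := by
    intro x
    induction x with
    | zero => simp
    | add x y hx hy => simp only [map_add, hx, hy]
    | tmul v w => simp [mul_comm]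
  exact (h _).trans (congrArg φ (rhit_counit a))

theorem counit_rhit (φ : A →ₗ[ℂ] ℂ) (a : A) : ε (rhit φ a) = φ a := by
  have h : ∀ x : A ⊗[ℂ] A, ε (rslice φ x) = φ (lslice ε x) := by
    intro x
    induction x with
    | zero => simp
    | add x y hx hy => simp only [map_add, hx, hy]
    | tmul v w => simp [mul_comm]
  exact (h _).trans (congrArg φ (lhit_counit a))

/-- `C` is stable under `a ↦ φ(a₍₁₎) a₍₂₎` and `a ↦ a₍₁₎ φ(a₍₂₎)`. -/
def Stable (C : Submodule ℂ A) : Prop :=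
  ∀ c ∈ C, ∀ φ : A →ₗ[ℂ] ℂ, lhit φ c ∈ C ∧ rhit φ c ∈ C

/-- If all slices of `Δ c` lie in `C`, a linear projection onto `C` fixes each leg of `Δ c`, hence
so does its tensor square, whose values lie in `C ⊗ C`. Stability is a condition about operators on
`A`, which opens the way to module theory. -/
theorem stable_iff (C : Submodule ℂ A) : Stable C ↔ IsSubcoalgebra C := by
  constructor
  · intro h c hc
    obtain ⟨p, hp, hp'⟩ := exists_linearProjection C
    have h1 : p.lTensor A (Δ c) = Δ c := by
      refine eq_of_lslice_eq fun φ => ?_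
      rw [lslice_lTensor]
      exact hp' _ (h c hc φ).1
    have h2 : p.rTensor A (Δ c) = Δ c := by
      refine eq_of_rslice_eq fun φ => ?_
      rw [rslice_rTensor]
      exact hp' _ (h c hc φ).2
    have h3 : TensorProduct.map p p (Δ c) = Δ c := by
      conv_rhs => rw [← h1, ← h2]
      generalize Δ c = x
      induction x with
      | zero => simp
      | add x y hx hy => simp only [map_add, hx, hy]
      | tmul v w => simp
    rw [← h3]
    have : p = C.subtype ∘ₗ p.codRestrict C hp := by ext; rfl
    rw [this, TensorProduct.map_comp]
    exact ⟨_, rfl⟩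
  · intro h c hc φ
    obtain ⟨y, hy⟩ := h c hc
    have h1 : ∀ z : C ⊗[ℂ] C, lslice φ (TensorProduct.mapIncl C C z) ∈ C ∧
        rslice φ (TensorProduct.mapIncl C C z) ∈ C := by
      intro z
      induction z with
      | zero => simp
      | add x y hx hy => exact ⟨by simpa using C.add_mem hx.1 hy.1, by simpa using C.add_mem hx.2 hy.2⟩
      | tmul v w => simp [TensorProduct.mapIncl, C.smul_mem]
    simp only [lhit, rhit, LinearMap.comp_apply, ← hy]
    exact h1 y

/-! ### Coefficient matrices -/

/-- Every element of `A` is a linear combination of matrix elements of a corepresentation. -/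
theorem exists_isCorep (a : A) : ∃ (n : ℕ) (u : Matrix (Fin n) (Fin n) A),
    IsCorep u ∧ a ∈ matrixElements u := by
  classical
  -- The space of all `φ(a₍₁₎) a₍₂₎`. It is finite dimensional because `Δ a` is a finite sum, it
  -- contains `a` (take the counit for `φ`), and it is stable under every `lhit`.
  let W : Submodule ℂ A := LinearMap.range
    ((LinearMap.mk₂ ℂ (fun (φ : A →ₗ[ℂ] ℂ) (x : A ⊗[ℂ] A) => lslice φ x)
      (by intro φ ψ x; induction x with
          | zero => simp
          | add x y hx hy => simp only [map_add, hx, hy]; abel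
          | tmul v w => simp [add_smul])
      (by intro c φ x; induction x with
          | zero => simp
          | add x y hx hy => simp only [map_add, hx, hy, smul_add]
          | tmul v w => simp [mul_smul])
      (by simp) (by simp)).flip (Δ a))
  have hW : ∀ x, x ∈ W ↔ ∃ φ, lhit φ a = x := fun x => Iff.rfl
  have hfin : FiniteDimensional ℂ W := by
    obtain ⟨s, hs⟩ := TensorProduct.exists_finset (R := ℂ) (Δ a)
    refine Submodule.finiteDimensional_of_le (S₂ := Submodule.span ℂ (s.image Prod.snd : Finset A)) ?_
    rintro _ ⟨φ, rfl⟩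
    change lslice φ (Δ a) ∈ _
    rw [hs, map_sum]
    refine Submodule.sum_mem _ fun i hi => ?_
    rw [lslice_tmul]
    exact Submodule.smul_mem _ _ (Submodule.subset_span (by
      simp only [Finset.coe_image, Set.mem_image, Finset.mem_coe]; exact ⟨i, hi, rfl⟩))
  have hst : ∀ w ∈ W, ∀ ψ, lhit ψ w ∈ W := by
    rintro w hw ψ
    obtain ⟨φ, rfl⟩ := (hW w).1 hw
    -- Two successive hits by `φ` and `ψ` are one hit by the convolution product of `φ` and `ψ`.
    refine (hW _).2 ⟨LinearMap.mul' ℂ ℂ ∘ₗ TensorProduct.map φ ψ ∘ₗ Δ, ?_⟩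
    have h1 : ∀ x : A ⊗[ℂ] A, lslice ψ (Δ (lslice φ x)) =
        lslice ψ (lslice φ ((Δ).lTensor A x)) := by
      intro x; rw [lslice_lTensor]
    simp only [lhit, LinearMap.comp_apply]
    rw [h1, ← Coalgebra.coassoc_apply]
    generalize Δ a = x
    induction x with
    | zero => simp
    | add x y hx hy => simp only [map_add, hx, hy]
    | tmul v w =>
      rw [LinearMap.rTensor_tmul, lslice_tmul]
      simp only [LinearMap.comp_apply]
      generalize Δ v = y
      induction y with
      | zero => simp
      | add x y hx hy => simp only [map_add, add_smul, TensorProduct.add_tmul, hx, hy]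
      | tmul p q => simp [mul_smul]
  let b := Module.finBasis ℂ W
  obtain ⟨p, hp, hp'⟩ := exists_linearProjection W
  let om : Fin (Module.finrank ℂ W) → A →ₗ[ℂ] ℂ := fun i => b.coord i ∘ₗ p.codRestrict W hp
  have hom : ∀ i j, om i (b j) = if i = j then 1 else 0 := by
    intro i j
    have : p.codRestrict W hp (b j) = b j := Subtype.ext (hp' _ (b j).2)
    simp [om, this, Finsupp.single_apply, eq_comm]
  have hsum : ∀ w ∈ W, w = ∑ i, om i w • (b i : A) := by
    intro w hw
    have h1 := congrArg Subtype.val (b.sum_repr ⟨w, hw⟩)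
    have : p.codRestrict W hp w = ⟨w, hw⟩ := Subtype.ext (hp' _ hw)
    simp only [om, LinearMap.comp_apply, this]
    rw [Submodule.coe_sum] at h1
    exact h1.symm
  -- The coefficients in `Δ b_j = ∑ᵢ v_{ji} ⊗ b_i`. Coassociativity makes `v` a corepresentation,
  -- and counitality writes each `b_j` through the entries of its row.
  let v : Matrix (Fin (Module.finrank ℂ W)) (Fin (Module.finrank ℂ W)) A :=
    fun j i => rhit (om i) (b j)
  have hΔ : ∀ w ∈ W, Δ w = ∑ i, rhit (om i) w ⊗ₜ[ℂ] (b i : A) := by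
    intro w hw
    refine eq_of_lslice_eq fun φ => ?_
    have h1 := hsum _ (hst w hw φ)
    change lhit φ w = _
    rw [h1, map_sum]
    refine Finset.sum_congr rfl fun i _ => ?_
    rw [lslice_tmul]
    congr 1
    change om i (lslice φ (Δ w)) = φ (rslice (om i) (Δ w))
    generalize Δ w = x
    induction x with
    | zero => simp
    | add x y hx hy => simp only [map_add, hx, hy]
    | tmul p q => simp [mul_comm]
  refine ⟨_, v, ⟨fun j i => ?_, fun j i => ?_⟩, ?_⟩
  · have h1 := Coalgebra.coassoc_apply (R := ℂ) (b j : A)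
    have h2 := congrArg (fun z => rslice (om i) ((TensorProduct.assoc ℂ A A A).symm z)) h1
    simp only [LinearEquiv.symm_apply_apply, rslice_rTensor] at h2
    change Δ (rhit (om i) (b j)) = _ at h2
    change Δ (rhit (om i) (b j)) = _
    rw [h2, hΔ _ (b j).2]
    simp only [map_sum, LinearMap.lTensor_tmul, hΔ _ (b _).2, TensorProduct.tmul_sum,
      TensorProduct.assoc_symm_tmul, rslice_tmul, hom]
    refine Finset.sum_congr rfl fun k _ => ?_
    have h3 : ∀ l, om i (b l) • (v j k ⊗ₜ[ℂ] v k l) =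
      if i = l then (v j k ⊗ₜ[ℂ] v k l) else 0 := by
      intro l; rw [hom]; split_ifs <;> simp
    simp only [ite_smul, one_smul, zero_smul]
    rw [Finset.sum_ite_eq]
    simp [v]
  · change ε (rhit _ _) = _
    rw [counit_rhit, hom]
    simp [eq_comm]
  · have ha : a ∈ W := (hW a).2 ⟨ε, lhit_counit a⟩
    rw [hsum a ha]
    refine Submodule.sum_mem _ fun j _ => Submodule.smul_mem _ _ ?_
    have h1 : rhit ε (b j : A) = _ := congrArg (rslice ε) (hΔ _ (b j).2)
    rw [rhit_counit] at h1
    rw [h1, map_sum]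
    refine Submodule.sum_mem _ fun i _ => ?_
    rw [rslice_tmul]
    exact Submodule.smul_mem _ _ (Submodule.subset_span ⟨j, i, rfl⟩)

/-- Hopf algebra identities may be checked on matrix elements. There the coproduct is a finite
matrix product and `S(v)` is the inverse matrix of `v`, so iterated coproducts become finite sums
over indices. -/
theorem corep_induction {p : A → Prop} (a : A) (h0 : p 0) (ha : ∀ x y, p x → p y → p (x + y))
    (hs : ∀ (c : ℂ) x, p x → p (c • x))
    (hu : ∀ (n : ℕ) (u : Matrix (Fin n) (Fin n) A), IsCorep u → ∀ i j, p (u i j)) : p a := by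
  obtain ⟨n, u, hc, hm⟩ := exists_isCorep a
  induction hm using Submodule.span_induction with
  | mem x hx => obtain ⟨i, j, rfl⟩ := hx; exact hu n u hc i j
  | zero => exact h0
  | add x y _ _ hx hy => exact ha _ _ hx hy
  | smul c x _ hx => exact hs _ _ hx

/-- Two linear maps on `A` which agree on matrix elements of corepresentations are equal. -/
theorem corep_ext {V : Type*} [AddCommGroup V] [Module ℂ V] {f k : A →ₗ[ℂ] V}
    (hu : ∀ (n : ℕ) (u : Matrix (Fin n) (Fin n) A), IsCorep u → ∀ i j, f (u i j) = k (u i j)) :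
    f = k := by
  ext a
  refine corep_induction (p := fun a => f a = k a) a (by simp) ?_ ?_ hu
  · intro x y hx hy; simp [hx, hy]
  · intro c x hx; simp [hx]

namespace IsCorep

variable {n : ℕ} {v : Matrix (Fin n) (Fin n) A}

theorem comul (hv : IsCorep v) (i j : Fin n) : Δ (v i j) = ∑ k, v i k ⊗ₜ[ℂ] v k j := hv.1 i j

theorem counit (hv : IsCorep v) (i j : Fin n) : ε (v i j) = if i = j then 1 else 0 := hv.2 i j

theorem sum_antipode_mul (hv : IsCorep v) (i j : Fin n) :
    ∑ k, 𝓢 (v i k) * v k j = if i = j then 1 else 0 := by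
  have h := HopfAlgebra.mul_antipode_rTensor_comul_apply (R := ℂ) (v i j)
  rw [hv.comul, hv.counit] at h
  simp only [map_sum, LinearMap.rTensor_tmul, LinearMap.mul'_apply] at h
  rw [h]; split_ifs <;> simp

theorem sum_mul_antipode (hv : IsCorep v) (i j : Fin n) :
    ∑ k, v i k * 𝓢 (v k j) = if i = j then 1 else 0 := by
  have h := HopfAlgebra.mul_antipode_lTensor_comul_apply (R := ℂ) (v i j)
  rw [hv.comul, hv.counit] at h
  simp only [map_sum, LinearMap.lTensor_tmul, LinearMap.mul'_apply] at h
  rw [h]; split_ifs <;> simp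

/-- Both sides are inverse to the matrix `Δ(v_{ij})` over `A ⊗ A`: the left one because `Δ` is
multiplicative, the right one by cancelling `v S(v)` in each leg. A left inverse equals a right
inverse. -/
theorem comul_antipode (hv : IsCorep v) (i j : Fin n) :
    Δ (𝓢 (v i j)) = ∑ k, 𝓢 (v k j) ⊗ₜ[ℂ] 𝓢 (v i k) := by
  let U : Matrix (Fin n) (Fin n) (A ⊗[ℂ] A) := Matrix.of fun i j => Δ (v i j)
  let L : Matrix (Fin n) (Fin n) (A ⊗[ℂ] A) := Matrix.of fun i j => Δ (𝓢 (v i j))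
  let R : Matrix (Fin n) (Fin n) (A ⊗[ℂ] A) :=
    Matrix.of fun i j => ∑ k, 𝓢 (v k j) ⊗ₜ[ℂ] 𝓢 (v i k)
  have h1 : L * U = 1 := by
    ext i j
    rw [Matrix.mul_apply]
    change ∑ k, Δ (𝓢 (v i k)) * Δ (v k j) = _
    simp only [← Bialgebra.comul_mul, ← map_sum, hv.sum_antipode_mul, Matrix.one_apply]
    split_ifs <;> simp
  have h2 : U * R = 1 := by
    ext i j
    rw [Matrix.mul_apply]
    change ∑ k, Δ (v i k) * ∑ l, 𝓢 (v l j) ⊗ₜ[ℂ] 𝓢 (v k l) = _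
    simp only [hv.comul, Finset.sum_mul_sum, Algebra.TensorProduct.tmul_mul_tmul]
    have : ∀ p q : Fin n, ∑ k, (v i p * 𝓢 (v q j)) ⊗ₜ[ℂ] (v p k * 𝓢 (v k q)) =
        if p = q then (v i p * 𝓢 (v p j)) ⊗ₜ[ℂ] (1 : A) else 0 := by
      intro p q
      rw [← TensorProduct.tmul_sum, hv.sum_mul_antipode]
      split_ifs with h
      · subst h; rfl
      · simp
    calc _ = ∑ p, ∑ q, ∑ k, (v i p * 𝓢 (v q j)) ⊗ₜ[ℂ] (v p k * 𝓢 (v k q)) := by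
          rw [Finset.sum_comm]
          refine Finset.sum_congr rfl fun p _ => ?_
          rw [Finset.sum_comm]
      _ = _ := by
          simp only [this, Finset.sum_ite_eq, Finset.mem_univ, if_true]
          rw [← TensorProduct.sum_tmul, hv.sum_mul_antipode, Matrix.one_apply]
          split_ifs <;> simp [Algebra.TensorProduct.one_def]
  have h3 : L = R := left_inv_eq_right_inv h1 h2
  exact congrFun (congrFun h3 i) j

theorem contragredient (hv : IsCorep v) : IsCorep (contragredient v) :=
  ⟨fun i j => by simp [QuantumForms.contragredient, hv.comul_antipode],
    fun i j => by simp [QuantumForms.contragredient, hv.counit, eq_comm]⟩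

theorem stable_matrixElements (hv : IsCorep v) : Stable (matrixElements v) := by
  intro c hc φ
  induction hc using Submodule.span_induction with
  | zero => simp
  | add x y _ _ hx hy =>
    simp only [map_add]
    exact ⟨add_mem hx.1 hy.1, add_mem hx.2 hy.2⟩
  | smul c x _ hx =>
    simp only [map_smul]
    exact ⟨Submodule.smul_mem _ _ hx.1, Submodule.smul_mem _ _ hx.2⟩
  | mem x hx =>
    obtain ⟨i, j, rfl⟩ := hx
    have h : ∀ i j, v i j ∈ matrixElements v := fun i j => Submodule.subset_span ⟨i, j, rfl⟩
    simp only [lhit, rhit, LinearMap.comp_apply, hv.comul, map_sum, lslice_tmul, rslice_tmul]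
    exact ⟨Submodule.sum_mem _ fun k _ => Submodule.smul_mem _ _ (h _ _),
      Submodule.sum_mem _ fun k _ => Submodule.smul_mem _ _ (h _ _)⟩

theorem matrixElements_contragredient :
    matrixElements (QuantumForms.contragredient v) = (matrixElements v).map 𝓢 := by
  rw [matrixElements, matrixElements, Submodule.map_span]
  congr 1
  ext x
  constructor
  · rintro ⟨i, j, rfl⟩; exact ⟨_, ⟨j, i, rfl⟩, rfl⟩
  · rintro ⟨_, ⟨i, j, rfl⟩, rfl⟩; exact ⟨j, i, rfl⟩

instance : FiniteDimensional ℂ (matrixElements v) := by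
  have : {x | ∃ i j, x = v i j} = Set.range (fun p : Fin n × Fin n => v p.1 p.2) := by
    ext x; simp [eq_comm]
  rw [matrixElements, this]
  exact FiniteDimensional.span_of_finite ℂ (Set.finite_range _)

end IsCorep

/-! ### Complements of subcoalgebras -/

/-- The algebra of operators on `A` generated by the left and right hit actions. -/
def hitAlgebra (A : Type u) [Ring A] [HopfAlgebra ℂ A] : Subalgebra ℂ (Module.End ℂ A) :=
  Algebra.adjoin ℂ (Set.range lhit ∪ Set.range rhit)

theorem Stable.hitAlgebra_apply_mem {C : Submodule ℂ A} (hC : Stable C) {f : Module.End ℂ A}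
    (hf : f ∈ hitAlgebra A) : ∀ c ∈ C, f c ∈ C := by
  induction hf using Algebra.adjoin_induction with
  | mem x hx =>
    rintro c hc
    rcases hx with ⟨φ, rfl⟩ | ⟨φ, rfl⟩
    · exact (hC c hc φ).1
    · exact (hC c hc φ).2
  | algebraMap r => intro c hc; simpa [Module.algebraMap_end_apply] using C.smul_mem r hc
  | add x y _ _ hx hy => intro c hc; exact add_mem (hx c hc) (hy c hc)
  | mul x y _ _ hx hy => intro c hc; exact hx _ (hy _ hc)

/-- A stable subspace as a submodule over the hit algebra. -/
def Stable.toSubmodule {C : Submodule ℂ A} (hC : Stable C) : Submodule (hitAlgebra A) A where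
  carrier := C
  add_mem' := C.add_mem
  zero_mem' := C.zero_mem
  smul_mem' f c hc := hC.hitAlgebra_apply_mem f.2 c hc

theorem stable_restrictScalars (P : Submodule (hitAlgebra A) A) :
    Stable (P.restrictScalars ℂ) := by
  intro c hc φ
  exact ⟨P.smul_mem ⟨lhit φ, Algebra.subset_adjoin (Or.inl ⟨φ, rfl⟩)⟩ hc,
    P.smul_mem ⟨rhit φ, Algebra.subset_adjoin (Or.inr ⟨φ, rfl⟩)⟩ hc⟩

/-- Subcoalgebras are the submodules over `hitAlgebra A`, and simple subcoalgebras are atoms in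
their lattice. Cosemisimplicity says that the atoms have supremum `⊤`, and a module lattice with
this property is complemented. -/
theorem exists_isCompl_stable (hA : IsCosemisimple A) {C : Submodule ℂ A} (hC : Stable C) :
    ∃ K, Stable K ∧ IsCompl C K := by
  have h : sSup {P : Submodule (hitAlgebra A) A | IsAtom P} = ⊤ := by
    rw [eq_top_iff]
    have h1 : (⊤ : Submodule ℂ A) ≤
        (sSup {P : Submodule (hitAlgebra A) A | IsAtom P}).restrictScalars ℂ := by
      rw [← hA]
      refine sSup_le fun D hD => ?_
      have hs : Stable D := (stable_iff D).2 hD.1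
      have hat : IsAtom hs.toSubmodule := by
        refine ⟨fun h0 => hD.2.1 ?_, fun P hP => ?_⟩
        · rw [eq_bot_iff]
          intro x hx
          have : x ∈ hs.toSubmodule := hx
          rw [h0] at this
          simpa using this
        · have hle : P.restrictScalars ℂ ≤ D := fun x hx => hP.le hx
          rcases hD.2.2 _ hle ((stable_iff _).1 (stable_restrictScalars P)) with h2 | h2
          · rw [eq_bot_iff]
            intro x hx
            have : x ∈ P.restrictScalars ℂ := hx
            rw [h2] at this
            simpa using this
          · exfalso
            refine hP.not_ge fun x hx => ?_
            have : x ∈ P.restrictScalars ℂ := by rw [h2]; exact hx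
            exact this
      intro x hx
      exact (le_sSup (a := hs.toSubmodule) hat : _ ≤ _) hx
    intro x _
    exact h1 trivial
  have hm : IsModularLattice (Submodule (hitAlgebra A) A) :=
    Submodule.instIsModularLattice (R := hitAlgebra A) (M := A)
  have := complementedLattice_of_sSup_atoms_eq_top h
  obtain ⟨K, hK⟩ := exists_isCompl hC.toSubmodule
  refine ⟨K.restrictScalars ℂ, stable_restrictScalars K, ?_⟩
  rw [isCompl_iff, disjoint_iff, codisjoint_iff] at hK ⊢
  refine ⟨?_, ?_⟩
  · rw [eq_bot_iff]
    rintro x ⟨h1, h2⟩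
    have : x ∈ hC.toSubmodule ⊓ K := ⟨h1, h2⟩
    rw [hK.1] at this
    simpa using this
  · rw [eq_top_iff]
    intro x _
    have : x ∈ hC.toSubmodule ⊔ K := by rw [hK.2]; trivial
    obtain ⟨y, hy, z, hz, rfl⟩ := Submodule.mem_sup.1 this
    exact Submodule.add_mem_sup hy hz

/-- For a subcoalgebra `C` there is a functional `e` which agrees with the counit on `C` and for
which the hit actions of `e` are projections onto `C`. -/
theorem exists_support_functional (hA : IsCosemisimple A) {C : Submodule ℂ A} (hC : Stable C) :
    ∃ e : A →ₗ[ℂ] ℂ, (∀ c ∈ C, e c = ε c) ∧ ∀ a, lhit e a ∈ C ∧ rhit e a ∈ C := by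
  obtain ⟨K, hK, hcompl⟩ := exists_isCompl_stable hA hC
  -- The counit on `C`, extended by zero on the complement `K`. As `Δ K ⊆ K ⊗ K`, both hits by `e`
  -- annihilate `K`, so only the component in the stable subspace `C` survives.
  let e : A →ₗ[ℂ] ℂ := ε ∘ₗ C.subtype ∘ₗ C.projectionOnto K hcompl
  have heC : ∀ c ∈ C, e c = ε c := fun c hc => by
    have := Submodule.projectionOnto_apply_left hcompl ⟨c, hc⟩
    simp only [e, LinearMap.comp_apply]
    rw [this]; rfl
  have heK : ∀ c ∈ K, e c = 0 := fun c hc => by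
    have := (Submodule.projectionOnto_apply_eq_zero_iff hcompl).2 hc
    simp [e, this]
  refine ⟨e, heC, fun a => ?_⟩
  have ha : a ∈ C ⊔ K := by rw [hcompl.sup_eq_top]; trivial
  obtain ⟨c, hc, k, hk, rfl⟩ := Submodule.mem_sup.1 ha
  have hk0 : lhit e k = 0 ∧ rhit e k = 0 := by
    obtain ⟨y, hy⟩ := (stable_iff K).1 hK k hk
    have h1 : ∀ z : K ⊗[ℂ] K, lslice e (TensorProduct.mapIncl K K z) = 0 ∧
        rslice e (TensorProduct.mapIncl K K z) = 0 := by
      intro z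
      induction z with
      | zero => simp
      | add x y hx hy => simp [hx, hy]
      | tmul v w => simp [TensorProduct.mapIncl, heK]
    simp only [lhit, rhit, LinearMap.comp_apply, ← hy]
    exact h1 y
  simp only [map_add, hk0, add_zero]
  exact hC c hc e

theorem stable_one : Stable (Submodule.span ℂ {(1 : A)}) := by
  intro c hc φ
  obtain ⟨r, rfl⟩ := Submodule.mem_span_singleton.1 hc
  have h1 : lhit φ (1 : A) = φ 1 • 1 := by simp [lhit, Algebra.TensorProduct.one_def]
  have h2 : rhit φ (1 : A) = φ 1 • 1 := by simp [rhit, Algebra.TensorProduct.one_def]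
  simp only [map_smul, h1, h2]
  have := Submodule.mem_span_singleton_self (R := ℂ) (1 : A)
  exact ⟨Submodule.smul_mem _ _ (Submodule.smul_mem _ _ this),
    Submodule.smul_mem _ _ (Submodule.smul_mem _ _ this)⟩

/-! ## The Haar functional and the antipode of a cosemisimple Hopf algebra -/

theorem isHaarFunctional_iff (h : A →ₗ[ℂ] ℂ) : IsHaarFunctional h ↔
    h 1 = 1 ∧ (∀ a, rhit h a = h a • (1 : A)) ∧ ∀ a, lhit h a = h a • (1 : A) := Iff.rfl

/-- The support functional of `ℂ 1`: its hits take values in `ℂ 1`, and the counit identifies the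
scalar as the value of the functional. -/
theorem exists_isHaarFunctional (hA : IsCosemisimple A) : ∃ h : A →ₗ[ℂ] ℂ, IsHaarFunctional h := by
  obtain ⟨e, he, hh⟩ := exists_support_functional hA (stable_one (A := A))
  have h1 : ∀ x ∈ Submodule.span ℂ {(1 : A)}, x = ε x • (1 : A) := by
    intro x hx
    obtain ⟨r, rfl⟩ := Submodule.mem_span_singleton.1 hx
    simp
  refine ⟨e, ?_, fun a => ?_, fun a => ?_⟩
  · rw [he _ (Submodule.mem_span_singleton_self _)]; simp
  · have := h1 _ (hh a).2
    rw [counit_rhit] at this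
    exact this
  · have := h1 _ (hh a).1
    rw [counit_lhit] at this
    exact this

/-- Both sides are `(ψ ⊗ φ)(Δ a)`. -/
theorem rslice_lslice_comm (φ ψ : A →ₗ[ℂ] ℂ) (a : A) : φ (lhit ψ a) = ψ (rhit φ a) := by
  simp only [lhit, rhit, LinearMap.comp_apply]
  generalize Δ a = x
  induction x with
  | zero => simp
  | add x y hx hy => simp only [map_add, hx, hy]
  | tmul v w => simp [mul_comm]

namespace IsHaarFunctional

variable {h : A →ₗ[ℂ] ℂ} {n : ℕ} {v : Matrix (Fin n) (Fin n) A}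

/-- Evaluate `(k ⊗ h)(Δ a)` by the left invariance of one functional and by the right invariance of
the other. -/
theorem ext (hh : IsHaarFunctional h) {k : A →ₗ[ℂ] ℂ} (hk : IsHaarFunctional k) : h = k := by
  ext a
  have h1 := rslice_lslice_comm h k a
  rw [((isHaarFunctional_iff k).1 hk).2.2, ((isHaarFunctional_iff h).1 hh).2.1] at h1
  simpa [hh.1, hk.1] using h1.symm

theorem apply_right (hh : IsHaarFunctional h) (x : A) :
    rslice h (Δ x) = h x • (1 : A) := hh.2.1 x

theorem apply_left (hh : IsHaarFunctional h) (x : A) :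
    lslice h (Δ x) = h x • (1 : A) := hh.2.2 x

/-- `h(a₍₁₎ b₍₁₎) a₍₂₎ b₍₂₎ = h(a b)` for matrix elements. -/
theorem sum_left (hh : IsHaarFunctional h) {m : ℕ} {u : Matrix (Fin m) (Fin m) A} (hu : IsCorep u)
    (hv : IsCorep v) (i j : Fin m) (p q : Fin n) :
    ∑ k, ∑ l, h (u i k * v p l) • (u k j * v l q) = h (u i j * v p q) • (1 : A) := by
  rw [← hh.apply_left, Bialgebra.comul_mul, hu.comul, hv.comul]
  simp [Finset.sum_mul_sum]

theorem sum_right (hh : IsHaarFunctional h) {m : ℕ} {u : Matrix (Fin m) (Fin m) A} (hu : IsCorep u)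
    (hv : IsCorep v) (i j : Fin m) (p q : Fin n) :
    ∑ k, ∑ l, h (u k j * v l q) • (u i k * v p l) = h (u i j * v p q) • (1 : A) := by
  rw [← hh.apply_right, Bialgebra.comul_mul, hu.comul, hv.comul]
  simp [Finset.sum_mul_sum]

/-- `h(a₍₁₎ b) a₍₂₎ = h(a b₍₁₎) S(b₍₂₎)`. -/
theorem lhit_mul (hh : IsHaarFunctional h) (a b : A) :
    lhit (h ∘ₗ LinearMap.mulRight ℂ b) a = 𝓢 (lhit (h ∘ₗ LinearMap.mulLeft ℂ a) b) := by
  let F : A →ₗ[ℂ] A →ₗ[ℂ] A := LinearMap.mk₂ ℂ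
    (fun a b => lslice h (TensorProduct.map (LinearMap.mulRight ℂ b) LinearMap.id (Δ a)))
    (by intros; simp) (by intros; simp)
    (by intro a b b'
        generalize Δ a = x
        induction x with
        | zero => simp
        | add x y hx hy => simp only [map_add, hx, hy]; abel
        | tmul v w => simp [mul_add, add_smul])
    (by intro c a b
        generalize Δ a = x
        induction x with
        | zero => simp
        | add x y hx hy => simp only [map_add, hx, hy, smul_add]
        | tmul v w => simp [mul_smul])
  let G : A →ₗ[ℂ] A →ₗ[ℂ] A := LinearMap.mk₂ ℂ
    (fun a b => 𝓢 (lslice h (TensorProduct.map (LinearMap.mulLeft ℂ a) LinearMap.id (Δ b))))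
    (by intro a a' b
        generalize Δ b = x
        induction x with
        | zero => simp
        | add x y hx hy => simp only [map_add, hx, hy]; abel
        | tmul v w => simp [add_mul, add_smul])
    (by intro c a b
        generalize Δ b = x
        induction x with
        | zero => simp
        | add x y hx hy => simp only [map_add, hx, hy, smul_add]
        | tmul v w => simp [mul_smul])
    (by intros; simp) (by intros; simp)
  have hFG : F = G := by
    refine corep_ext fun m u hu i j => corep_ext fun n v hv p q => ?_
    simp only [F, G, LinearMap.mk₂_apply, hu.comul, hv.comul, map_sum, TensorProduct.map_tmul,
      lslice_tmul, LinearMap.mulRight_apply, LinearMap.mulLeft_apply, LinearMap.id_apply, map_smul]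
    -- Invariance is applied to `u_{ij} v_{pl}` and multiplied by `S(v_{lq})` from the right.
    -- Summation over `l` then cancels `v S(v)`.
    have h1 : ∀ l, h (u i j * v p l) • 𝓢 (v l q) =
        ∑ k, ∑ r, h (u i k * v p r) • (u k j * (v r l * 𝓢 (v l q))) := by
      intro l
      have := congrArg (· * 𝓢 (v l q)) (hh.sum_left hu hv i j p l)
      simp only [Finset.sum_mul, smul_mul_assoc, one_mul, mul_assoc] at this
      exact this.symm
    simp only [h1]
    rw [Finset.sum_comm]
    refine Finset.sum_congr rfl fun k _ => ?_
    rw [Finset.sum_comm]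
    simp only [← Finset.smul_sum, ← Finset.mul_sum, hv.sum_mul_antipode, mul_ite, mul_one, mul_zero,
      smul_ite, smul_zero, Finset.sum_ite_eq', Finset.mem_univ, if_true]
  have h2 : ∀ (f : A →ₗ[ℂ] A) (x : A ⊗[ℂ] A), lslice (h ∘ₗ f) x =
      lslice h (TensorProduct.map f LinearMap.id x) := by
    intro f x
    induction x with
    | zero => simp
    | add x y hx hy => simp only [map_add, hx, hy]
    | tmul v w => simp
  simp only [lhit, LinearMap.comp_apply, h2]
  exact LinearMap.congr_fun (LinearMap.congr_fun hFG a) b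

/-- `b₍₁₎ h(a b₍₂₎) = S(a₍₁₎) h(a₍₂₎ b)`. -/
theorem rhit_mul (hh : IsHaarFunctional h) (a b : A) :
    rhit (h ∘ₗ LinearMap.mulLeft ℂ a) b = 𝓢 (rhit (h ∘ₗ LinearMap.mulRight ℂ b) a) := by
  let F : A →ₗ[ℂ] A →ₗ[ℂ] A := LinearMap.mk₂ ℂ
    (fun a b => 𝓢 (rslice h (TensorProduct.map LinearMap.id (LinearMap.mulRight ℂ b) (Δ a))))
    (by intros; simp) (by intros; simp)
    (by intro a b b'
        generalize Δ a = x
        induction x with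
        | zero => simp
        | add x y hx hy => simp only [map_add, hx, hy]; abel
        | tmul v w => simp [mul_add, add_smul])
    (by intro c a b
        generalize Δ a = x
        induction x with
        | zero => simp
        | add x y hx hy => simp only [map_add, hx, hy, smul_add]
        | tmul v w => simp [mul_smul])
  let G : A →ₗ[ℂ] A →ₗ[ℂ] A := LinearMap.mk₂ ℂ
    (fun a b => rslice h (TensorProduct.map LinearMap.id (LinearMap.mulLeft ℂ a) (Δ b)))
    (by intro a a' b
        generalize Δ b = x
        induction x with
        | zero => simp
        | add x y hx hy => simp only [map_add, hx, hy]; abel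
        | tmul v w => simp [add_mul, add_smul])
    (by intro c a b
        generalize Δ b = x
        induction x with
        | zero => simp
        | add x y hx hy => simp only [map_add, hx, hy, smul_add]
        | tmul v w => simp [mul_smul])
    (by intros; simp) (by intros; simp)
  have hFG : G = F := by
    refine corep_ext fun m u hu i j => corep_ext fun n v hv p q => ?_
    simp only [F, G, LinearMap.mk₂_apply, hu.comul, hv.comul, map_sum, TensorProduct.map_tmul,
      rslice_tmul, LinearMap.mulRight_apply, LinearMap.mulLeft_apply, LinearMap.id_apply, map_smul]
    -- The mirrored cancellation: multiplication by `S(u_{il})` from the left and summation over `l`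
    -- remove `S(u) u`.
    have h1 : ∀ l, h (u l j * v p q) • 𝓢 (u i l) =
        ∑ k, ∑ r, h (u k j * v r q) • (𝓢 (u i l) * u l k * v p r) := by
      intro l
      have := congrArg (𝓢 (u i l) * ·) (hh.sum_right hu hv l j p q)
      simp only [Finset.mul_sum, mul_smul_comm, mul_one, ← mul_assoc] at this
      exact this.symm
    simp only [h1]
    calc _ = ∑ k, ∑ r, ∑ l, h (u k j * v r q) • (𝓢 (u i l) * u l k * v p r) := by
          rw [Finset.sum_comm]
          simp only [← Finset.smul_sum, ← Finset.sum_mul, hu.sum_antipode_mul, ite_mul, one_mul,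
            zero_mul, smul_ite, smul_zero, Finset.sum_ite_eq, Finset.mem_univ, if_true]
      _ = _ := by
          rw [Finset.sum_comm]
          simp_rw [Finset.sum_comm (s := (Finset.univ : Finset (Fin n)))]
          rw [Finset.sum_comm]
  have h2 : ∀ (f : A →ₗ[ℂ] A) (x : A ⊗[ℂ] A), rslice (h ∘ₗ f) x =
      rslice h (TensorProduct.map LinearMap.id f x) := by
    intro f x
    induction x with
    | zero => simp
    | add x y hx hy => simp only [map_add, hx, hy]
    | tmul v w => simp
  simp only [rhit, LinearMap.comp_apply, h2]
  exact LinearMap.congr_fun (LinearMap.congr_fun hFG a) b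

/-- The radical `N` is a left ideal, and by `rhit_mul` it satisfies `Δ N ⊆ A ⊗ N`. Hence `ε(n) 1 =
S(n₍₁₎) n₍₂₎` lies in `N`, and `h 1 = 1` forces `ε(n) = 0`. Since `N` is stable under `lhit`, every
functional vanishes on `N`. -/
theorem eq_zero_of_forall_mul_left (hh : IsHaarFunctional h) {b : A} (hb : ∀ a, h (a * b) = 0) :
    b = 0 := by
  let N : Submodule ℂ A :=
    { carrier := {b | ∀ a, h (a * b) = 0}
      add_mem' := fun hx hy a => by simp [mul_add, hx a, hy a]
      zero_mem' := fun a => by simp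
      smul_mem' := fun c x hx a => by simp [hx a] }
  have hN : ∀ n ∈ N, ∀ φ, lhit φ n ∈ N := by
    intro n hn φ a
    have h0 : h ∘ₗ LinearMap.mulRight ℂ n = 0 := LinearMap.ext hn
    have h1 := rslice_lslice_comm (h ∘ₗ LinearMap.mulLeft ℂ a) φ n
    rw [hh.rhit_mul, h0] at h1
    simpa [rhit, rslice] using h1
  obtain ⟨p, hp, hp'⟩ := exists_linearProjection N
  have hε : ∀ n ∈ N, ε n = 0 := by
    intro n hn
    have h1 : p.lTensor A (Δ n) = Δ n := by
      refine eq_of_lslice_eq fun φ => ?_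
      rw [lslice_lTensor]
      exact hp' _ (hN n hn φ)
    have h2 : ∀ x : A ⊗[ℂ] A, LinearMap.mul' ℂ A ((𝓢).rTensor A (p.lTensor A x)) ∈ N := by
      intro x
      induction x with
      | zero => simp
      | add x y hx hy => simpa using N.add_mem hx hy
      | tmul v w =>
        intro a
        simpa [← mul_assoc] using hp w (a * 𝓢 v)
    have h3 := h2 (Δ n)
    rw [h1, HopfAlgebra.mul_antipode_rTensor_comul_apply] at h3
    simpa [Algebra.algebraMap_eq_smul_one, hh.1] using h3 1
  by_contra hne
  obtain ⟨f, hf, -⟩ := exists_functional_ne_zero (⊥ : Submodule ℂ A) (x := b) (by simpa using hne)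
  exact hf (by rw [← counit_lhit]; exact hε _ (hN b hb f))

/-- The mirror image: this radical is a right ideal with `Δ N ⊆ N ⊗ A`, and `n₍₁₎ S(n₍₂₎)` is used
instead. -/
theorem eq_zero_of_forall_mul_right (hh : IsHaarFunctional h) {a : A} (ha : ∀ b, h (a * b) = 0) :
    a = 0 := by
  let N : Submodule ℂ A :=
    { carrier := {a | ∀ b, h (a * b) = 0}
      add_mem' := fun hx hy a => by simp [add_mul, hx a, hy a]
      zero_mem' := fun a => by simp
      smul_mem' := fun c x hx a => by simp [hx a] }
  have hN : ∀ n ∈ N, ∀ φ, rhit φ n ∈ N := by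
    intro n hn φ b
    have h0 : h ∘ₗ LinearMap.mulLeft ℂ n = 0 := LinearMap.ext hn
    have h1 := rslice_lslice_comm φ (h ∘ₗ LinearMap.mulRight ℂ b) n
    rw [hh.lhit_mul, h0] at h1
    simpa [lhit, lslice] using h1.symm
  obtain ⟨p, hp, hp'⟩ := exists_linearProjection N
  have hε : ∀ n ∈ N, ε n = 0 := by
    intro n hn
    have h1 : p.rTensor A (Δ n) = Δ n := by
      refine eq_of_rslice_eq fun φ => ?_
      rw [rslice_rTensor]
      exact hp' _ (hN n hn φ)
    have h2 : ∀ x : A ⊗[ℂ] A, LinearMap.mul' ℂ A ((𝓢).lTensor A (p.rTensor A x)) ∈ N := by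
      intro x
      induction x with
      | zero => simp
      | add x y hx hy => simpa using N.add_mem hx hy
      | tmul v w =>
        intro a
        simpa [mul_assoc] using hp v (𝓢 w * a)
    have h3 := h2 (Δ n)
    rw [h1, HopfAlgebra.mul_antipode_lTensor_comul_apply] at h3
    simpa [Algebra.algebraMap_eq_smul_one, hh.1] using h3 1
  by_contra hne
  obtain ⟨f, hf, -⟩ := exists_functional_ne_zero (⊥ : Submodule ℂ A) (x := a) (by simpa using hne)
  exact hf (by rw [← counit_rhit]; exact hε _ (hN a ha f))

end IsHaarFunctional

/-! ### Bijectivity of the antipode and the action of its square on subcoalgebras -/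

theorem comul_antipode (a : A) :
    Δ (𝓢 a) = TensorProduct.map 𝓢 𝓢 (TensorProduct.comm ℂ A A (Δ a)) := by
  have h : Δ ∘ₗ 𝓢 = TensorProduct.map 𝓢 𝓢 ∘ₗ (TensorProduct.comm ℂ A A).toLinearMap ∘ₗ Δ := by
    refine corep_ext fun n u hu i j => ?_
    simp [hu.comul_antipode, hu.comul]
  exact LinearMap.congr_fun h a

theorem lhit_antipode (φ : A →ₗ[ℂ] ℂ) (a : A) : lhit φ (𝓢 a) = 𝓢 (rhit (φ ∘ₗ 𝓢) a) := by
  simp only [lhit, rhit, LinearMap.comp_apply, comul_antipode]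
  generalize Δ a = x
  induction x with
  | zero => simp
  | add x y hx hy => simp only [map_add, hx, hy]
  | tmul v w => simp

theorem rhit_antipode (φ : A →ₗ[ℂ] ℂ) (a : A) : rhit φ (𝓢 a) = 𝓢 (lhit (φ ∘ₗ 𝓢) a) := by
  simp only [lhit, rhit, LinearMap.comp_apply, comul_antipode]
  generalize Δ a = x
  induction x with
  | zero => simp
  | add x y hx hy => simp only [map_add, hx, hy]
  | tmul v w => simp

theorem Stable.map_antipode {C : Submodule ℂ A} (hC : Stable C) : Stable (C.map 𝓢) := by
  rintro _ ⟨c, hc, rfl⟩ φ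
  rw [lhit_antipode, rhit_antipode]
  exact ⟨⟨_, (hC c hc _).2, rfl⟩, ⟨_, (hC c hc _).1, rfl⟩⟩

namespace IsHaarFunctional

variable {h : A →ₗ[ℂ] ℂ}

/-- `h ∘ S` is again normalised and invariant, with left and right exchanged, so uniqueness of the
Haar functional applies. -/
theorem comp_antipode (hh : IsHaarFunctional h) : h ∘ₗ 𝓢 = h := by
  refine IsHaarFunctional.ext ((isHaarFunctional_iff _).2 ⟨by simp [hh.1], ?_, ?_⟩) hh
  · refine fun a => LinearMap.congr_fun (f := rhit (h ∘ₗ 𝓢))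
      (g := LinearMap.toSpanSingleton ℂ A 1 ∘ₗ h ∘ₗ 𝓢) (corep_ext fun n v hv i j => ?_) a
    have h1 : ∀ p, ∑ k, h (𝓢 (v k j)) • 𝓢 (v p k) = h (𝓢 (v p j)) • (1 : A) := by
      intro p
      rw [← hh.apply_left, hv.comul_antipode]
      simp
    -- Multiplying the invariance of `h` on `S(v_{pj})` by `v_{ip}` turns the matrices `S(v)` on the
    -- left into `v S(v) = 1` and leaves the hit of `h ∘ S` on `v_{ij}` on the right.
    have h2 : ∑ p, v i p * ∑ k, h (𝓢 (v k j)) • 𝓢 (v p k) = ∑ p, h (𝓢 (v p j)) • v i p := by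
      simp [h1]
    simp only [Finset.mul_sum, mul_smul_comm] at h2
    rw [Finset.sum_comm] at h2
    simp only [← Finset.smul_sum, hv.sum_mul_antipode, smul_ite, smul_zero, Finset.sum_ite_eq,
      Finset.mem_univ, if_true] at h2
    simp [rhit, hv.comul, ← h2]
  · refine fun a => LinearMap.congr_fun (f := lhit (h ∘ₗ 𝓢))
      (g := LinearMap.toSpanSingleton ℂ A 1 ∘ₗ h ∘ₗ 𝓢) (corep_ext fun n v hv i j => ?_) a
    have h1 : ∀ p, ∑ k, h (𝓢 (v i k)) • 𝓢 (v k p) = h (𝓢 (v i p)) • (1 : A) := by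
      intro p
      rw [← hh.apply_right, hv.comul_antipode]
      simp
    have h2 : ∑ p, (∑ k, h (𝓢 (v i k)) • 𝓢 (v k p)) * v p j = ∑ p, h (𝓢 (v i p)) • v p j := by
      simp [h1]
    simp only [Finset.sum_mul, smul_mul_assoc] at h2
    rw [Finset.sum_comm] at h2
    simp only [← Finset.smul_sum, hv.sum_antipode_mul, smul_ite, smul_zero, Finset.sum_ite_eq',
      Finset.mem_univ, if_true] at h2
    simp [lhit, hv.comul, ← h2]

/-- By `h ∘ S = h`, the element `h(x a₍₁₎) S(a₍₂₎)` is a slice of `Δ(S a)`. If `S a = 0` then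
`lhit_mul` gives `h(x₍₁₎ a) x₍₂₎ = 0`, so `h(x a) = 0` for all `x`, and `h` is faithful. -/
theorem antipode_injective (hh : IsHaarFunctional h) : Function.Injective (𝓢) := by
  refine (injective_iff_map_eq_zero (𝓢)).2 fun a ha => ?_
  have ha : 𝓢 a = 0 := ha
  refine hh.eq_zero_of_forall_mul_left fun x => ?_
  have h1 := hh.lhit_mul x a
  have h2 : 𝓢 (lhit (h ∘ₗ LinearMap.mulLeft ℂ x) a) =
      rslice (h ∘ₗ LinearMap.mulRight ℂ (𝓢 x)) (Δ (𝓢 a)) := by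
    rw [comul_antipode, lhit, LinearMap.comp_apply]
    generalize Δ a = y
    induction y with
    | zero => simp
    | add x y hx hy => simp only [map_add, hx, hy]
    | tmul v w =>
      simp only [lslice_tmul, LinearMap.comp_apply, LinearMap.mulLeft_apply, map_smul,
        TensorProduct.comm_tmul, TensorProduct.map_tmul, rslice_tmul, LinearMap.mulRight_apply]
      rw [← HopfAlgebra.antipode_mul_antidistrib]
      exact congrArg (· • 𝓢 w) (LinearMap.congr_fun hh.comp_antipode (x * v)).symm
  rw [h2, ha, map_zero, map_zero] at h1
  have h3 := counit_lhit (h ∘ₗ LinearMap.mulRight ℂ a) x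
  rw [h1] at h3
  simpa using h3.symm

/-- Let `f` vanish on the range of `S`. All elements `h(a₍₁₎ b) a₍₂₎` lie in that range by
`lhit_mul`, so `h(a₍₁₎ f(a₍₂₎) b) = 0` for all `b`. Faithfulness yields `a₍₁₎ f(a₍₂₎) = 0`, hence `f
a = 0`. -/
theorem antipode_surjective (hh : IsHaarFunctional h) : Function.Surjective (𝓢) := by
  intro a
  by_contra hne
  obtain ⟨f, hf, hz⟩ := exists_functional_ne_zero (LinearMap.range (𝓢)) (x := a) hne
  refine hf ?_
  have h1 : rhit f a = 0 := by
    refine hh.eq_zero_of_forall_mul_right fun b => ?_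
    have := rslice_lslice_comm f (h ∘ₗ LinearMap.mulRight ℂ b) a
    rw [hh.lhit_mul, hz _ ⟨_, rfl⟩] at this
    exact this.symm
  rw [← counit_rhit, h1, map_zero]

/-- Orthogonality: against `S(C)` only the `C`-component of `a` contributes. By `rhit_mul` and
injectivity of `S`, the element `a₍₁₎ h(a₍₂₎ b)` lies in `C`, where `e` agrees with the counit. -/
theorem mul_eq_lhit_mul (hh : IsHaarFunctional h) {C : Submodule ℂ A} {e : A →ₗ[ℂ] ℂ}
    (he : ∀ c ∈ C, e c = ε c) (hC : Stable C) (a : A) {b : A} (hb : b ∈ C.map 𝓢) :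
    h (a * b) = h (lhit e a * b) := by
  have h1 := (hC.map_antipode b hb (h ∘ₗ LinearMap.mulLeft ℂ a)).2
  rw [hh.rhit_mul] at h1
  obtain ⟨c, hc, hc'⟩ := h1
  rw [hh.antipode_injective hc'] at hc
  have h2 := he _ hc
  rw [counit_rhit] at h2
  rw [← rslice_lslice_comm (h ∘ₗ LinearMap.mulRight ℂ b) e a] at h2
  exact h2.symm

/-- For `b ∈ S(C)` and a functional `f` vanishing on `C`, the element `b₍₁₎ f(S b₍₂₎)` is orthogonal
to all of `A`. By `mul_eq_lhit_mul` it may be tested against elements of `C` only, and there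
`lhit_mul` produces a value of `f` on `C`. -/
theorem map_antipode_antipode_le (hA : IsCosemisimple A) (hh : IsHaarFunctional h)
    {C : Submodule ℂ A} (hC : Stable C) : (C.map 𝓢).map 𝓢 ≤ C := by
  rintro _ ⟨b, hb, rfl⟩
  by_contra hne
  obtain ⟨f, hf, hz⟩ := exists_functional_ne_zero C hne
  obtain ⟨e, he, hh'⟩ := exists_support_functional hA hC
  refine hf ?_
  have hb' := (hC.map_antipode b hb (f ∘ₗ 𝓢)).2
  have h1 : rhit (f ∘ₗ 𝓢) b = 0 := by
    refine hh.eq_zero_of_forall_mul_left fun a => ?_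
    rw [hh.mul_eq_lhit_mul he hC a hb']
    have h2 := rslice_lslice_comm (f ∘ₗ 𝓢) (h ∘ₗ LinearMap.mulLeft ℂ (lhit e a)) b
    simp only [LinearMap.comp_apply, LinearMap.mulLeft_apply] at h2
    rw [← h2, ← hh.lhit_mul]
    exact hz _ (hC _ (hh' a).1 _).1
  have h3 := counit_rhit (f ∘ₗ 𝓢) b
  rw [h1, map_zero] at h3
  exact h3.symm

/-- `S` is injective, so both sides of the inclusion have the same finite dimension. -/
theorem map_antipode_antipode (hA : IsCosemisimple A) (hh : IsHaarFunctional h)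
    {C : Submodule ℂ A} [FiniteDimensional ℂ C] (hC : Stable C) : (C.map 𝓢).map 𝓢 = C := by
  refine Submodule.eq_of_le_of_finrank_eq (hh.map_antipode_antipode_le hA hC) ?_
  exact ((Submodule.equivMapOfInjective _ hh.antipode_injective _).symm.trans
    (Submodule.equivMapOfInjective _ hh.antipode_injective _).symm).finrank_eq

end IsHaarFunctional

/-! ## Left-coinvariant elements -/

/-- Distributing bilinear maps over several coactions produces nested sums in the reverse order;
this lemma and the next restore the order in which an inner sum can be collapsed. -/
theorem sum_reverse₃ {α β γ V : Type*} [Fintype α] [Fintype β] [Fintype γ] [AddCommMonoid V]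
    (f : α → β → γ → V) : ∑ a, ∑ b, ∑ c, f a b c = ∑ c, ∑ b, ∑ a, f a b c := by
  rw [Finset.sum_comm]
  simp_rw [Finset.sum_comm (s := (Finset.univ : Finset α))]
  rw [Finset.sum_comm]

theorem sum_reverse₄ {α β γ δ V : Type*} [Fintype α] [Fintype β] [Fintype γ] [Fintype δ]
    [AddCommMonoid V] (f : α → β → γ → δ → V) :
    ∑ a, ∑ b, ∑ c, ∑ d, f a b c d = ∑ d, ∑ c, ∑ b, ∑ a, f a b c d := by
  simp_rw [sum_reverse₃ (f _)]
  rw [Finset.sum_comm]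
  refine Finset.sum_congr rfl fun d _ => ?_
  exact (sum_reverse₃ _).trans (by
    refine Finset.sum_comm.trans ?_
    rfl)

theorem IsCorep.adj_apply {n : ℕ} {u : Matrix (Fin n) (Fin n) A} (hu : IsCorep u)
    (M : HopfBimodule A) (i j : Fin n) (m : M) :
    M.adj (u i j) m = ∑ k, M.lsmul (𝓢 (u i k)) (M.rsmul (u k j) m) := by
  simp [HopfBimodule.adj, hu.comul]

namespace HopfBimodule

variable (M : HopfBimodule A)

/-- In Sweedler notation the left side is `S(m₍₋₂₎) m₍₋₁₎ ⊗ S(m₍₋₃₎) m₍₀₎`, and the first leg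
cancels. -/
theorem dl_proj (m : M) : M.dl (M.proj m) = 1 ⊗ₜ[ℂ] M.proj m := by
  let T : A ⊗[ℂ] (A ⊗[ℂ] M) →ₗ[ℂ] A ⊗[ℂ] M :=
    TensorProduct.lift (TensorProduct.map₂ (LinearMap.mul ℂ A) M.lsmul ∘ₗ Δ ∘ₗ 𝓢)
  have h1 : ∀ y : A ⊗[ℂ] M, M.dl (TensorProduct.lift (M.lsmul ∘ₗ 𝓢) y) = T (M.dl.lTensor A y) := by
    intro y
    induction y with
    | zero => simp
    | add y y' hy hy' => simp only [map_add, hy, hy']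
    | tmul a m => simp [T, M.dl_lsmul]
  have h2 : ∀ y : A ⊗[ℂ] M, T (TensorProduct.assoc ℂ A A M ((Δ).rTensor M y)) =
      1 ⊗ₜ[ℂ] TensorProduct.lift (M.lsmul ∘ₗ 𝓢) y := by
    intro y
    induction y with
    | zero => simp
    | add y y' hy hy' => simp only [map_add, hy, hy', TensorProduct.tmul_add]
    | tmul a m =>
      have h3 : T ∘ₗ (TensorProduct.assoc ℂ A A M).toLinearMap ∘ₗ
          (TensorProduct.mk ℂ (A ⊗[ℂ] A) M).flip m ∘ₗ Δ =
          TensorProduct.mk ℂ A M 1 ∘ₗ M.lsmul.flip m ∘ₗ 𝓢 := by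
        refine corep_ext fun n u hu i j => ?_
        have h4 : ∀ p, T (u i p ⊗ₜ[ℂ] (u p j ⊗ₜ[ℂ] m)) =
            ∑ q, (𝓢 (u q p) * u p j) ⊗ₜ[ℂ] M.lsmul (𝓢 (u i q)) m := by
          intro p
          simp [T, hu.comul_antipode]
        simp only [LinearMap.comp_apply, hu.comul, map_sum, LinearMap.flip_apply,
          TensorProduct.mk_apply, LinearEquiv.coe_coe, TensorProduct.assoc_tmul,
          TensorProduct.sum_tmul, h4]
        rw [Finset.sum_comm]
        simp only [← TensorProduct.sum_tmul, hu.sum_antipode_mul]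
        rw [Finset.sum_eq_single j]
        · simp
        · intro b _ hb; simp [hb]
        · simp
      simpa using LinearMap.congr_fun h3 a
  change M.dl (TensorProduct.lift (M.lsmul ∘ₗ 𝓢) (M.dl m)) = _
  rw [h1, ← M.coassoc_left, h2]
  rfl

theorem proj_mem (m : M) : M.proj m ∈ M.leftCoinv := (M.mem_leftCoinv _).2 (M.dl_proj m)

theorem proj_of_mem {m : M} (hm : m ∈ M.leftCoinv) : M.proj m = m := by
  rw [mem_leftCoinv] at hm
  simp [proj, hm, M.one_lsmul]

theorem adj_mem {m : M} (hm : m ∈ M.leftCoinv) (a : A) : M.adj a m ∈ M.leftCoinv := by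
  rw [← M.proj_of_mem hm, ← proj_rsmul]
  exact M.proj_mem _

theorem adj_one (m : M) : M.adj 1 m = m := by
  simp [adj, Algebra.TensorProduct.one_def, M.one_lsmul, M.one_rsmul]

/-- `m = m₍₋₁₎ P(m₍₀₎)`. -/
theorem lift_split (m : M) : TensorProduct.lift M.lsmul (M.split m) = m := by
  let T : A ⊗[ℂ] (A ⊗[ℂ] M) →ₗ[ℂ] M :=
    TensorProduct.lift M.lsmul ∘ₗ (TensorProduct.lift (M.lsmul ∘ₗ 𝓢)).lTensor A
  have h2 : ∀ y : A ⊗[ℂ] M, T (TensorProduct.assoc ℂ A A M ((Δ).rTensor M y)) =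
      TensorProduct.lid ℂ M ((ε).rTensor M y) := by
    intro y
    induction y with
    | zero => simp
    | add y y' hy hy' => simp only [map_add, hy, hy']
    | tmul a m =>
      have h3 : T ∘ₗ (TensorProduct.assoc ℂ A A M).toLinearMap ∘ₗ
          (TensorProduct.mk ℂ (A ⊗[ℂ] A) M).flip m ∘ₗ Δ =
          LinearMap.toSpanSingleton ℂ M m ∘ₗ ε := by
        refine corep_ext fun n u hu i j => ?_
        simp only [LinearMap.comp_apply, hu.comul, map_sum, LinearMap.flip_apply,
          TensorProduct.mk_apply, LinearEquiv.coe_coe, TensorProduct.assoc_tmul, T,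
          TensorProduct.lift.tmul, LinearMap.lTensor_tmul, ← M.mul_lsmul]
        rw [← LinearMap.sum_apply, ← map_sum, hu.sum_mul_antipode, hu.counit]
        split_ifs <;> simp [M.one_lsmul]
      simpa using LinearMap.congr_fun h3 a
  have h4 : ∀ y : A ⊗[ℂ] M, T (M.dl.lTensor A y) =
      TensorProduct.lift M.lsmul (M.proj.lTensor A y) := by
    intro y
    induction y with
    | zero => simp
    | add y y' hy hy' => simp only [map_add, hy, hy']
    | tmul a m => simp [T, proj]
  rw [split, LinearMap.comp_apply, ← h4, ← M.coassoc_left, h2, M.counit_left]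

/-- `S(b) m = (m ◁ b₍₁₎) S(b₍₂₎)`. -/
theorem lsmul_antipode (b : A) (m : M) :
    M.lsmul (𝓢 b) m = TensorProduct.lift ((M.rsmul ∘ₗ 𝓢).flip ∘ₗ M.adj.flip m) (Δ b) := by
  have h : M.lsmul.flip m ∘ₗ 𝓢 =
      TensorProduct.lift ((M.rsmul ∘ₗ 𝓢).flip ∘ₗ M.adj.flip m) ∘ₗ Δ := by
    refine corep_ext fun n u hu i j => ?_
    have h1 : ∀ p, M.rsmul (𝓢 (u p j)) (M.adj (u i p) m) =
        ∑ q, M.lsmul (𝓢 (u i q)) (M.rsmul (u q p * 𝓢 (u p j)) m) := by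
      intro p
      simp only [hu.adj_apply, map_sum, ← M.lsmul_rsmul, ← M.mul_rsmul]
    simp only [LinearMap.comp_apply, hu.comul, map_sum, TensorProduct.lift.tmul,
      LinearMap.flip_apply, h1]
    rw [Finset.sum_comm]
    simp only [← map_sum, ← LinearMap.sum_apply, hu.sum_mul_antipode]
    rw [Finset.sum_eq_single j]
    · simp [M.one_rsmul]
    · intro b _ hb; simp [hb]
    · simp
  exact LinearMap.congr_fun h b

/-- `Γ` is generated as a right module by its left-coinvariant elements. -/
theorem span_rsmul_leftCoinv (hS : Function.Surjective (𝓢)) (m : M) :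
    m ∈ Submodule.span ℂ {x | ∃ a, ∃ y ∈ M.leftCoinv, x = M.rsmul a y} := by
  have h1 : ∀ z : A ⊗[ℂ] M, TensorProduct.lift M.lsmul (M.proj.lTensor A z) ∈
      Submodule.span ℂ {x | ∃ a, ∃ y ∈ M.leftCoinv, x = M.rsmul a y} := by
    intro z
    induction z with
    | zero => simp
    | add x y hx hy => simpa using add_mem hx hy
    | tmul a n =>
      -- A coefficient on the left can be moved to the right once it is a value of the antipode, by
      -- `lsmul_antipode`; this is the role of the surjectivity of `S`.
      obtain ⟨b, rfl⟩ := hS a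
      rw [LinearMap.lTensor_tmul, TensorProduct.lift.tmul, lsmul_antipode]
      generalize Δ b = y
      induction y with
      | zero => simp
      | add x y hx hy => simpa using add_mem hx hy
      | tmul p q =>
        exact Submodule.subset_span ⟨_, _, M.adj_mem (M.proj_mem n) p, by simp; rfl⟩
  have := h1 (M.dl m)
  rwa [← LinearMap.comp_apply (M.proj.lTensor A), ← split, lift_split] at this

end HopfBimodule

/-! ### Frames: Hopf bimodules as free modules over coinvariant elements -/

/-- A basis `e` of the left-coinvariant elements of `M` with the coordinates of `M` as a free left
module and the corepresentation `v` on the left-coinvariant elements. -/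
structure Frame (M : HopfBimodule A) where
  n : ℕ
  e : Fin n → M
  coef : Fin n → M →ₗ[ℂ] A
  v : Matrix (Fin n) (Fin n) A
  mem : ∀ i, e i ∈ M.leftCoinv
  sum_coef : ∀ m, ∑ i, M.lsmul (coef i m) (e i) = m
  coef_lsmul : ∀ i a m, coef i (M.lsmul a m) = a * coef i m
  coef_e : ∀ i j, coef i (e j) = if i = j then 1 else 0
  coef_coinv : ∀ i, ∀ m ∈ M.leftCoinv, coef i m = ε (coef i m) • (1 : A)
  corep : IsCorep v
  dr_e : ∀ j, M.dr (e j) = ∑ i, e i ⊗ₜ[ℂ] v i j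

/-- With `κ_i` the coordinates of the projection onto coinvariants, the coefficients of `m` are
`m₍₋₁₎ κ_i(m₍₀₎)`; that they reproduce `m` is `lift_split`. The matrix `v` consists of the
coefficients of the right coaction on the basis. -/
theorem exists_frame (M : HopfBimodule A) [FiniteDimensional ℂ M.leftCoinv] :
    Nonempty (Frame M) := by
  let b := Module.finBasis ℂ M.leftCoinv
  let e : Fin (Module.finrank ℂ M.leftCoinv) → M := fun i => b i
  let κ : Fin (Module.finrank ℂ M.leftCoinv) → M →ₗ[ℂ] ℂ :=
    fun i => b.coord i ∘ₗ M.proj.codRestrict M.leftCoinv M.proj_mem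
  have hproj : ∀ m, M.proj m = ∑ i, κ i m • e i := by
    intro m
    have h1 := congrArg Subtype.val (b.sum_repr ⟨M.proj m, M.proj_mem m⟩)
    rw [Submodule.coe_sum] at h1
    exact h1.symm
  have hκe : ∀ i j, κ i (e j) = if i = j then 1 else 0 := by
    intro i j
    have : M.proj.codRestrict M.leftCoinv M.proj_mem (b j : M) = b j :=
      Subtype.ext (M.proj_of_mem (b j).2)
    simp only [κ, e, LinearMap.comp_apply, this]
    simp [Finsupp.single_apply, eq_comm]
  have hκp : ∀ i, κ i ∘ₗ M.proj = κ i := by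
    intro i
    ext m
    have : M.proj.codRestrict M.leftCoinv M.proj_mem (M.proj m) =
        M.proj.codRestrict M.leftCoinv M.proj_mem m :=
      Subtype.ext (M.proj_of_mem (M.proj_mem m))
    simp only [κ, LinearMap.comp_apply, this]
  have hmem : ∀ i, e i ∈ M.leftCoinv := fun i => (b i).2
  have hdr : ∀ j, M.dr (e j) = ∑ i, e i ⊗ₜ[ℂ] lslice (κ i) (M.dr (e j)) := by
    intro j
    -- The coactions commute, so the right coaction of a left-coinvariant element stays in
    -- coinvariants tensor `A`.
    have h1 : M.proj.rTensor A (M.dr (e j)) = M.dr (e j) := by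
      have h2 : ∀ x : M ⊗[ℂ] A, M.proj.rTensor A x =
          (TensorProduct.lift (M.lsmul ∘ₗ 𝓢)).rTensor A (M.dl.rTensor A x) := by
        intro x
        induction x with
        | zero => simp
        | add x y hx hy => simp only [map_add, hx, hy]
        | tmul m a => simp [HopfBimodule.proj]
      have h3 := (LinearEquiv.eq_symm_apply _).2 (M.bicomodule (e j))
      rw [h2, h3, (M.mem_leftCoinv _).1 (hmem j), LinearMap.lTensor_tmul]
      generalize M.dr (e j) = x
      induction x with
      | zero => simp
      | add x y hx hy => simp only [map_add, TensorProduct.tmul_add, hx, hy]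
      | tmul m a => simp [M.one_lsmul]
    conv_lhs => rw [← h1]
    generalize M.dr (e j) = x
    induction x with
    | zero => simp
    | add x y hx hy => simp only [map_add, TensorProduct.tmul_add, Finset.sum_add_distrib, hx, hy]
    | tmul m a => simp [hproj, TensorProduct.sum_tmul, TensorProduct.smul_tmul]
  refine ⟨{
    n := _
    e := e
    coef := fun i => rslice (κ i) ∘ₗ M.dl
    v := fun i j => lslice (κ i) (M.dr (e j))
    mem := hmem
    sum_coef := fun m => ?_
    coef_lsmul := fun i a m => ?_
    coef_e := fun i j => ?_
    coef_coinv := fun i m hm => ?_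
    corep := ⟨fun i j => ?_, fun i j => ?_⟩
    dr_e := hdr }⟩
  · have h1 : ∀ x : A ⊗[ℂ] M, TensorProduct.lift M.lsmul (M.proj.lTensor A x) =
        ∑ i, M.lsmul (rslice (κ i) x) (e i) := by
      intro x
      induction x with
      | zero => simp
      | add x y hx hy => simp only [map_add, LinearMap.add_apply, Finset.sum_add_distrib, hx, hy]
      | tmul a m => simp [hproj]
    exact (h1 _).symm.trans (M.lift_split m)
  · have h1 : ∀ m, rslice (κ i) (M.dl m) = rslice (κ i) (M.split m) := by
      intro m
      rw [HopfBimodule.split, LinearMap.comp_apply, rslice_lTensor, hκp]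
    simp only [LinearMap.comp_apply, h1, HopfBimodule.split_lsmul, rslice_rTensor]
    rfl
  · simp only [LinearMap.comp_apply, (M.mem_leftCoinv _).1 (hmem j), rslice_tmul, hκe]
    split_ifs <;> simp
  · simp only [LinearMap.comp_apply, (M.mem_leftCoinv _).1 hm, rslice_tmul]
    simp
  · have h1 := M.coassoc_right (e j)
    have h2 := congrArg (lslice (κ i)) h1
    rw [lslice_lTensor] at h2
    rw [← h2]
    conv_lhs => rw [hdr j]
    simp only [map_sum, LinearMap.rTensor_tmul]
    refine Finset.sum_congr rfl fun k _ => ?_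
    generalize M.dr (e k) = x
    induction x with
    | zero => simp
    | add x y hx hy => simp only [map_add, TensorProduct.add_tmul, hx, hy]
    | tmul p q => simp [TensorProduct.smul_tmul']
  · have h1 := congrArg (κ i) (M.counit_right (e j))
    rw [hκe] at h1
    change ε (lslice (κ i) (M.dr (e j))) = _
    rw [← h1]
    generalize M.dr (e j) = x
    induction x with
    | zero => simp
    | add x y hx hy => simp only [map_add, hx, hy]
    | tmul p q => simp [mul_comm]

namespace Frame

variable {M : HopfBimodule A} (F : Frame M)

/-- The factor `S(u_{kq})` stands in front, ready to cancel against an entry of `u` multiplied from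
the left. That cancellation (`sum_adj_inverse`) drives the colinearity of the braiding and the braid
equation. -/
theorem dr_adj_e {n : ℕ} {u : Matrix (Fin n) (Fin n) A} (hu : IsCorep u) (i : Fin F.n)
    (k l : Fin n) : M.dr (M.adj (u k l) (F.e i)) =
      ∑ q, ∑ t, ∑ r, M.adj (u q t) (F.e r) ⊗ₜ[ℂ] (𝓢 (u k q) * (F.v r i * u t l)) := by
  simp only [hu.adj_apply, map_sum, M.dr_lsmul, M.dr_rsmul, hu.comul, hu.comul_antipode, F.dr_e,
    LinearMap.sum_apply, TensorProduct.map₂_apply_tmul, LinearMap.mul_apply', LinearMap.flip_apply,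
    TensorProduct.sum_tmul]
  refine (sum_reverse₄ _).trans ?_
  simp

end Frame

/-! ## Bicomodule maps -/

section HomLemmas

variable {M N P Q : HopfBimodule A}

@[simp] theorem Hom.id_lin (x : M) : (Hom.id M).toLinearMap x = x := rfl

@[simp] theorem Hom.andThen_lin (f : Hom M N) (k : Hom N P) (x : M) :
    (f.andThen k).toLinearMap x = k.toLinearMap (f.toLinearMap x) := rfl

@[simp] theorem Hom.map_tm (f : Hom M P) (k : Hom N Q) (m : M) (n : N) :
    (Hom.map f k).toLinearMap (tm M N m n) = tm P Q (f.toLinearMap m) (k.toLinearMap n) := by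
  simp [Hom.map]

@[simp] theorem Hom.assoc_tm (m : M) (n : N) (p : P) :
    (Hom.assoc M N P).toLinearMap (tm (tensor M N) P (tm M N m n) p) =
      tm M (tensor N P) m (tm N P n p) := by
  simp [Hom.assoc]

@[simp] theorem Hom.assocInv_tm (m : M) (n : N) (p : P) :
    (Hom.assocInv M N P).toLinearMap (tm M (tensor N P) m (tm N P n p)) =
      tm (tensor M N) P (tm M N m n) p := by
  simp [Hom.assocInv]

/-- An element of `A` as an element of the Hopf bimodule `A`. -/
def ofA : A →ₗ[ℂ] (unit A).carrier := (LinearMap.id : A →ₗ[ℂ] A)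

theorem ofA_surjective (x : (unit A).carrier) : ∃ a : A, ofA a = x := ⟨x, rfl⟩

theorem ofA_toA (f : Hom M (unit A)) (x : M) : ofA (f.toA x) = f.toLinearMap x := rfl

theorem dl_ofA (a : A) : (unit A).dl (ofA a) = ofA.lTensor A (Δ a) := by
  have : (ofA (A := A)).lTensor A = LinearMap.id := LinearMap.lTensor_id _ _
  rw [this]; rfl

theorem dr_ofA (a : A) : (unit A).dr (ofA a) = ofA.rTensor A (Δ a) := by
  have : (ofA (A := A)).rTensor A = LinearMap.id := LinearMap.rTensor_id _ _
  rw [this]; rfl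

@[simp] theorem Hom.lunit_tm (a : A) (m : M) :
    (Hom.lunit M).toLinearMap (tm (unit A) M (ofA a) m) = M.lsmul a m :=
  Hom.lift_tm (M := unit A) _ _ _ _ _ _

@[simp] theorem Hom.runit_tm (a : A) (m : M) :
    (Hom.runit M).toLinearMap (tm M (unit A) m (ofA a)) = M.rsmul a m :=
  Hom.lift_tm (N := unit A) _ _ _ _ _ _

/-- The map `(a ⊗ m, b ⊗ n) ↦ a b ⊗ (m ⊗_A n)`. -/
def diagL (M N : HopfBimodule A) : (A ⊗[ℂ] M) →ₗ[ℂ] (A ⊗[ℂ] N) →ₗ[ℂ] A ⊗[ℂ] (tensor M N).carrier :=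
  TensorProduct.map₂ (LinearMap.mul ℂ A) (tm M N)

/-- The map `(m ⊗ a, n ⊗ b) ↦ (m ⊗_A n) ⊗ a b`. -/
def diagR (M N : HopfBimodule A) : (M ⊗[ℂ] A) →ₗ[ℂ] (N ⊗[ℂ] A) →ₗ[ℂ] (tensor M N).carrier ⊗[ℂ] A :=
  TensorProduct.map₂ (tm M N) (LinearMap.mul ℂ A)

@[simp] theorem diagL_tmul (a b : A) (m : M) (n : N) :
    diagL M N (a ⊗ₜ m) (b ⊗ₜ n) = (a * b) ⊗ₜ[ℂ] tm M N m n := by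
  simp [diagL]

@[simp] theorem diagR_tmul (a b : A) (m : M) (n : N) :
    diagR M N (m ⊗ₜ a) (n ⊗ₜ b) = tm M N m n ⊗ₜ[ℂ] (a * b) := by
  simp [diagR]

theorem dl_tm (m : M) (n : N) : (tensor M N).dl (tm M N m n) = diagL M N (M.dl m) (N.dl n) :=
  tensorDl_tmk M N m n

theorem dr_tm (m : M) (n : N) : (tensor M N).dr (tm M N m n) = diagR M N (M.dr m) (N.dr n) :=
  tensorDr_tmk M N m n

end HomLemmas

/-- A linear map commuting with both coactions. -/
def IsBicomoduleMap (M N : HopfBimodule A) (f : M →ₗ[ℂ] N) : Prop :=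
  (∀ x, N.dl (f x) = f.lTensor A (M.dl x)) ∧ ∀ x, N.dr (f x) = f.rTensor A (M.dr x)

namespace IsBicomoduleMap

variable {M N P Q : HopfBimodule A}

theorem comp {f : N →ₗ[ℂ] P} {k : M →ₗ[ℂ] N} (hf : IsBicomoduleMap N P f)
    (hk : IsBicomoduleMap M N k) : IsBicomoduleMap M P (f ∘ₗ k) := by
  refine ⟨fun x => ?_, fun x => ?_⟩
  · rw [LinearMap.comp_apply, hf.1, hk.1, LinearMap.lTensor_comp_apply]
  · rw [LinearMap.comp_apply, hf.2, hk.2, LinearMap.rTensor_comp_apply]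

theorem add {f k : M →ₗ[ℂ] N} (hf : IsBicomoduleMap M N f) (hk : IsBicomoduleMap M N k) :
    IsBicomoduleMap M N (f + k) := by
  refine ⟨fun x => ?_, fun x => ?_⟩
  · simp [hf.1, hk.1, LinearMap.lTensor_add]
  · simp [hf.2, hk.2, LinearMap.rTensor_add]

theorem smul {f : M →ₗ[ℂ] N} (c : ℂ) (hf : IsBicomoduleMap M N f) :
    IsBicomoduleMap M N (c • f) := by
  refine ⟨fun x => ?_, fun x => ?_⟩
  · simp [hf.1, LinearMap.lTensor_smul]
  · simp [hf.2, LinearMap.rTensor_smul]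

theorem id : IsBicomoduleMap M M LinearMap.id := ⟨fun x => by simp, fun x => by simp⟩

theorem inverse {f : M →ₗ[ℂ] N} {k : N →ₗ[ℂ] M} (hf : IsBicomoduleMap M N f)
    (h₁ : f ∘ₗ k = LinearMap.id) (h₂ : k ∘ₗ f = LinearMap.id) : IsBicomoduleMap N M k := by
  refine ⟨fun x => ?_, fun x => ?_⟩
  · have h := congrArg (k.lTensor A) (hf.1 (k x))
    rw [← LinearMap.comp_apply f k, h₁, ← LinearMap.lTensor_comp_apply, h₂] at h
    simpa using h.symm
  · have h := congrArg (k.rTensor A) (hf.2 (k x))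
    rw [← LinearMap.comp_apply f k, h₁, ← LinearMap.rTensor_comp_apply, h₂] at h
    simpa using h.symm

theorem andThen {f : Hom M N} {k : Hom N P} (hf : IsBicomoduleMap M N f.toLinearMap)
    (hk : IsBicomoduleMap N P k.toLinearMap) : IsBicomoduleMap M P (f.andThen k).toLinearMap :=
  hk.comp hf

theorem map {f : Hom M P} {k : Hom N Q} (hf : IsBicomoduleMap M P f.toLinearMap)
    (hk : IsBicomoduleMap N Q k.toLinearMap) :
    IsBicomoduleMap (tensor M N) (tensor P Q) (Hom.map f k).toLinearMap := by
  refine ⟨fun x => ?_, fun x => ?_⟩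
  · induction x using tm_induction with
    | h0 => simp
    | ha x y hx hy => simp only [map_add, hx, hy]
    | ht m n =>
      rw [Hom.map_tm, dl_tm, dl_tm, hf.1, hk.1]
      generalize M.dl m = y
      generalize N.dl n = z
      induction y with
      | zero => simp
      | add y y' hy hy' => simp only [map_add, LinearMap.add_apply, hy, hy']
      | tmul a b =>
        induction z with
        | zero => simp
        | add z z' hz hz' => simp only [map_add, LinearMap.add_apply, hz, hz']
        | tmul c d => simp
  · induction x using tm_induction with
    | h0 => simp
    | ha x y hx hy => simp only [map_add, hx, hy]
    | ht m n =>
      rw [Hom.map_tm, dr_tm, dr_tm, hf.2, hk.2]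
      generalize M.dr m = y
      generalize N.dr n = z
      induction y with
      | zero => simp
      | add y y' hy hy' => simp only [map_add, LinearMap.add_apply, hy, hy']
      | tmul a b =>
        induction z with
        | zero => simp
        | add z z' hz hz' => simp only [map_add, LinearMap.add_apply, hz, hz']
        | tmul c d => simp

theorem assocInv (M N P : HopfBimodule A) :
    IsBicomoduleMap (tensor M (tensor N P)) (tensor (tensor M N) P)
      (Hom.assocInv M N P).toLinearMap := by
  refine ⟨fun x => ?_, fun x => ?_⟩
  · induction x using tm_induction with
    | h0 => simp
    | ha x y hx hy => simp only [map_add, hx, hy]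
    | ht m y =>
      induction y using tm_induction with
      | h0 => simp
      | ha x y hx hy => simp only [map_add, hx, hy]
      | ht n p =>
        simp only [Hom.assocInv_tm, dl_tm]
        generalize M.dl m = x
        generalize N.dl n = y
        generalize P.dl p = z
        induction x with
        | zero => simp
        | add y y' hy hy' => simp only [map_add, LinearMap.add_apply, hy, hy']
        | tmul a b =>
          induction y with
          | zero => simp
          | add z z' hz hz' => simp only [map_add, LinearMap.add_apply, hz, hz']
          | tmul c d =>
            induction z with
            | zero => simp
            | add z z' hz hz' => simp only [map_add, LinearMap.add_apply, hz, hz']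
            | tmul e f => simp [mul_assoc]
  · induction x using tm_induction with
    | h0 => simp
    | ha x y hx hy => simp only [map_add, hx, hy]
    | ht m y =>
      induction y using tm_induction with
      | h0 => simp
      | ha x y hx hy => simp only [map_add, hx, hy]
      | ht n p =>
        simp only [Hom.assocInv_tm, dr_tm]
        generalize M.dr m = x
        generalize N.dr n = y
        generalize P.dr p = z
        induction x with
        | zero => simp
        | add y y' hy hy' => simp only [map_add, LinearMap.add_apply, hy, hy']
        | tmul a b =>
          induction y with
          | zero => simp
          | add z z' hz hz' => simp only [map_add, LinearMap.add_apply, hz, hz']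
          | tmul c d =>
            induction z with
            | zero => simp
            | add z z' hz hz' => simp only [map_add, LinearMap.add_apply, hz, hz']
            | tmul e f => simp [mul_assoc]

theorem assoc (M N P : HopfBimodule A) :
    IsBicomoduleMap (tensor (tensor M N) P) (tensor M (tensor N P))
      (Hom.assoc M N P).toLinearMap := by
  refine (assocInv M N P).inverse (tm_ext fun x p => ?_) (tm_ext fun m y => ?_)
  · induction x using tm_induction with
    | h0 => simp
    | ha x y hx hy => simp only [map_add, LinearMap.add_apply, hx, hy]
    | ht m n => simp
  · induction y using tm_induction with
    | h0 => simp
    | ha x y hx hy => simp only [map_add, LinearMap.add_apply, hx, hy]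
    | ht m n => simp

theorem lunit (M : HopfBimodule A) :
    IsBicomoduleMap (tensor (unit A) M) M (Hom.lunit M).toLinearMap := by
  refine ⟨fun x => ?_, fun x => ?_⟩
  · induction x using tm_induction with
    | h0 => simp
    | ha x y hx hy => simp only [map_add, hx, hy]
    | ht a m =>
      obtain ⟨a, rfl⟩ := ofA_surjective a
      rw [dl_tm, Hom.lunit_tm, M.dl_lsmul, dl_ofA]
      generalize Δ a = x
      generalize M.dl m = y
      induction x with
      | zero => simp
      | add y y' hy hy' => simp only [map_add, LinearMap.add_apply, hy, hy']
      | tmul a b =>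
        induction y with
        | zero => simp
        | add z z' hz hz' => simp only [map_add, LinearMap.add_apply, hz, hz']
        | tmul c d => simp
  · induction x using tm_induction with
    | h0 => simp
    | ha x y hx hy => simp only [map_add, hx, hy]
    | ht a m =>
      obtain ⟨a, rfl⟩ := ofA_surjective a
      rw [dr_tm, Hom.lunit_tm, M.dr_lsmul, dr_ofA]
      generalize Δ a = x
      generalize M.dr m = y
      induction x with
      | zero => simp
      | add y y' hy hy' => simp only [map_add, LinearMap.add_apply, hy, hy']
      | tmul a b =>
        induction y with
        | zero => simp
        | add z z' hz hz' => simp only [map_add, LinearMap.add_apply, hz, hz']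
        | tmul c d => simp

theorem runit (M : HopfBimodule A) :
    IsBicomoduleMap (tensor M (unit A)) M (Hom.runit M).toLinearMap := by
  refine ⟨fun x => ?_, fun x => ?_⟩
  · induction x using tm_induction with
    | h0 => simp
    | ha x y hx hy => simp only [map_add, hx, hy]
    | ht m a =>
      obtain ⟨a, rfl⟩ := ofA_surjective a
      rw [dl_tm, Hom.runit_tm, M.dl_rsmul, dl_ofA]
      generalize Δ a = x
      generalize M.dl m = y
      induction x with
      | zero => simp
      | add y y' hy hy' => simp only [map_add, LinearMap.add_apply, hy, hy']
      | tmul a b =>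
        induction y with
        | zero => simp
        | add z z' hz hz' => simp only [map_add, LinearMap.add_apply, hz, hz']
        | tmul c d => simp
  · induction x using tm_induction with
    | h0 => simp
    | ha x y hx hy => simp only [map_add, hx, hy]
    | ht m a =>
      obtain ⟨a, rfl⟩ := ofA_surjective a
      rw [dr_tm, Hom.runit_tm, M.dr_rsmul, dr_ofA]
      generalize Δ a = x
      generalize M.dr m = y
      induction x with
      | zero => simp
      | add y y' hy hy' => simp only [map_add, LinearMap.add_apply, hy, hy']
      | tmul a b =>
        induction y with
        | zero => simp
        | add z z' hz hz' => simp only [map_add, LinearMap.add_apply, hz, hz']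
        | tmul c d => simp

theorem tcast (Γ : HopfBimodule A) {k l : ℕ} (h : k = l) :
    IsBicomoduleMap (tpow Γ k) (tpow Γ l) (QuantumForms.tcast Γ h).toLinearMap := by
  subst h; exact id

/-- A bimodule map which commutes with the coactions on generators is a bicomodule map. -/
theorem of_generators {f : Hom M N} {s : Set M}
    (hs : ∀ x, x ∈ Submodule.span ℂ {y | ∃ a, ∃ m ∈ s, y = M.lsmul a m})
    (h : ∀ m ∈ s, N.dl (f.toLinearMap m) = f.toLinearMap.lTensor A (M.dl m) ∧
      N.dr (f.toLinearMap m) = f.toLinearMap.rTensor A (M.dr m)) :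
    IsBicomoduleMap M N f.toLinearMap := by
  have key : ∀ x, N.dl (f.toLinearMap x) = f.toLinearMap.lTensor A (M.dl x) ∧
      N.dr (f.toLinearMap x) = f.toLinearMap.rTensor A (M.dr x) := by
    intro x
    induction hs x using Submodule.span_induction with
    | zero => simp
    | add x y _ _ hx hy => simp only [map_add, hx.1, hx.2, hy.1, hy.2, and_self]
    | smul c x _ hx => simp only [map_smul, hx.1, hx.2, and_self]
    | mem x hx =>
      obtain ⟨a, m, hm, rfl⟩ := hx
      rw [f.lin_lsmul, N.dl_lsmul, M.dl_lsmul, N.dr_lsmul, M.dr_lsmul, (h m hm).1, (h m hm).2]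
      generalize Δ a = x
      generalize M.dl m = y
      generalize M.dr m = z
      induction x with
      | zero => simp
      | add x y hx hy =>
        simp only [map_add, LinearMap.add_apply, hx.1, hx.2, hy.1, hy.2, and_self]
      | tmul a b =>
        constructor
        · induction y with
          | zero => simp
          | add x y hx hy => simp only [map_add, hx, hy]
          | tmul c d => simp [f.lin_lsmul]
        · induction z with
          | zero => simp
          | add x y hx hy => simp only [map_add, hx, hy]
          | tmul c d => simp [f.lin_lsmul]
  exact ⟨fun x => (key x).1, fun x => (key x).2⟩

end IsBicomoduleMap

/-! ## Properties of the braiding -/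

namespace Frame

variable {M N : HopfBimodule A}

/-- The coefficients of the right factor move across `⊗_A` to the left factor, so elements `m ⊗ e_j`
suffice. -/
theorem tm_e_induction (G : Frame N) {p : (tensor M N).carrier → Prop} (h0 : p 0)
    (ht : ∀ m j, p (tm M N m (G.e j))) (ha : ∀ x y, p x → p y → p (x + y)) (x) : p x := by
  induction x using tm_induction with
  | h0 => exact h0
  | ha x y hx hy => exact ha x y hx hy
  | ht m n =>
    rw [← G.sum_coef n, map_sum]
    refine Finset.sum_induction _ p ha h0 fun j _ => ?_
    rw [← tm_rsmul]
    exact ht _ _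

theorem span_tm (F : Frame M) (G : Frame N) (x : tensor M N) :
    x ∈ Submodule.span ℂ {y | ∃ a, ∃ z ∈ Set.range (fun p : Fin F.n × Fin G.n =>
      tm M N (F.e p.1) (G.e p.2)), y = (tensor M N).lsmul a z} := by
  induction x using G.tm_e_induction with
  | h0 => exact zero_mem _
  | ha x y hx hy => exact add_mem hx hy
  | ht m j =>
    rw [← F.sum_coef m, map_sum, LinearMap.sum_apply]
    refine Submodule.sum_mem _ fun i _ =>
      Submodule.subset_span ⟨F.coef i m, _, ⟨(i, j), rfl⟩, ?_⟩
    rw [lsmul_tm]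

theorem eq_sum_coinv (F : Frame M) {m : M} (hm : m ∈ M.leftCoinv) :
    m = ∑ i, ε (F.coef i m) • F.e i := by
  conv_lhs => rw [← F.sum_coef m]
  refine Finset.sum_congr rfl fun i _ => ?_
  rw [F.coef_coinv i m hm]
  simp [M.one_lsmul]

theorem braiding_tm (G : Frame N) {m : M} (hm : m ∈ M.leftCoinv) (j : Fin G.n) :
    (HopfBimodule.braiding M N).toLinearMap (tm M N m (G.e j)) =
      ∑ k, tm N M (G.e k) (M.adj (G.v k j) m) := by
  rw [HopfBimodule.braiding_of_leftCoinv M N m hm, G.dr_e]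
  simp

theorem sum_adj_inverse (G : Frame N) (k l : Fin G.n) (a : A) :
    ∑ q, G.v k q * (𝓢 (G.v q l) * a) = if k = l then a else 0 := by
  simp only [← mul_assoc, ← Finset.sum_mul, G.corep.sum_mul_antipode]
  split_ifs <;> simp

/-- The braiding is a bimodule map, so products of basis vectors are enough. For the right coaction,
`σ(e_i ⊗ e_j)` produces coefficients `v_{lk} S(v_{kq}) v_{ri} v_{tj}`; the sum over `k` gives `l =
q` and leaves the coefficients of `e_i ⊗ e_j`. -/
theorem isBicomoduleMap_braiding (F : Frame M) :
    IsBicomoduleMap (tensor M M) (tensor M M) (HopfBimodule.braiding M M).toLinearMap := by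
  refine IsBicomoduleMap.of_generators (F.span_tm F) ?_
  rintro _ ⟨⟨i, j⟩, rfl⟩
  have hl : ∀ m ∈ M.leftCoinv, ∀ m' ∈ M.leftCoinv,
      (tensor M M).dl (tm M M m m') = 1 ⊗ₜ[ℂ] tm M M m m' := by
    intro m hm m' hm'
    rw [dl_tm, (M.mem_leftCoinv m).1 hm, (M.mem_leftCoinv m').1 hm']
    simp
  constructor
  · simp only [hl _ (F.mem i) _ (F.mem j), LinearMap.lTensor_tmul, F.braiding_tm (F.mem i),
      map_sum, TensorProduct.tmul_sum]
    exact Finset.sum_congr rfl fun k _ => hl _ (F.mem k) _ (M.adj_mem (F.mem i) _)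
  · simp only [F.braiding_tm (F.mem i), dr_tm, F.dr_e, map_sum, F.dr_adj_e F.corep,
      LinearMap.sum_apply, diagR_tmul, LinearMap.rTensor_tmul]
    have h1 : ∀ (l q t r : Fin F.n),
        ∑ k, tm M M (F.e l) (M.adj (F.v q t) (F.e r)) ⊗ₜ[ℂ]
          (F.v l k * (𝓢 (F.v k q) * (F.v r i * F.v t j))) =
        if l = q then tm M M (F.e l) (M.adj (F.v q t) (F.e r)) ⊗ₜ[ℂ] (F.v r i * F.v t j) else 0 := by
      intro l q t r
      rw [← TensorProduct.tmul_sum, F.sum_adj_inverse]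
      split_ifs <;> simp
    have h2 : ∀ f : Fin F.n → Fin F.n → Fin F.n → Fin F.n → Fin F.n → (tensor M M).carrier ⊗[ℂ] A,
        ∑ k, ∑ q, ∑ t, ∑ r, ∑ l, f l q t r k = ∑ l, ∑ q, ∑ t, ∑ r, ∑ k, f l q t r k := by
      intro f
      refine (Finset.sum_congr rfl fun k _ => sum_reverse₄ _).trans ?_
      rw [Finset.sum_comm]
      refine Finset.sum_congr rfl fun l _ => ?_
      exact sum_reverse₄ _
    refine (h2 fun l q t r k => tm M M (F.e l) (M.adj (F.v q t) (F.e r)) ⊗ₜ[ℂ]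
      (F.v l k * (𝓢 (F.v k q) * (F.v r i * F.v t j)))).trans ?_
    simp only [h1]
    have h3 : ∀ l, (∑ q, ∑ t, ∑ r, if l = q then tm M M (F.e l) (M.adj (F.v q t) (F.e r)) ⊗ₜ[ℂ]
        (F.v r i * F.v t j) else 0) = ∑ t, ∑ r, tm M M (F.e l) (M.adj (F.v l t) (F.e r)) ⊗ₜ[ℂ]
        (F.v r i * F.v t j) := by
      intro l
      rw [Finset.sum_eq_single l]
      · simp
      · intro b _ hb; simp [hb.symm]
      · simp
    simp only [h3, F.braiding_tm (F.mem _), TensorProduct.sum_tmul]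
    refine (sum_reverse₃ _).trans ?_
    rw [Finset.sum_comm]

/-- The coordinates of `M ⊗_A N` with respect to the frame of `N`. -/
def tmCoef (G : Frame N) (M : HopfBimodule A) (l : Fin G.n) : (tensor M N).carrier →ₗ[ℂ] M :=
  tensorLift (M.rsmul.flip.compl₂ (G.coef l)) (by
    intro m a n; simp [G.coef_lsmul, M.mul_rsmul])

@[simp] theorem tmCoef_tm (G : Frame N) (l : Fin G.n) (m : M) (n : N) :
    G.tmCoef M l (tm M N m n) = M.rsmul (G.coef l n) m :=
  tensorLift_tm _ _ _ _

theorem sum_tmCoef (G : Frame N) (x : tensor M N) : ∑ l, tm M N (G.tmCoef M l x) (G.e l) = x := by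
  induction x using tm_induction with
  | h0 => simp
  | ha x y hx hy => simp only [map_add, LinearMap.add_apply, Finset.sum_add_distrib, hx, hy]
  | ht m n =>
    simp only [tmCoef_tm, tm_rsmul]
    rw [← map_sum, G.sum_coef]

theorem tmCoef_tm_e (G : Frame N) (l j : Fin G.n) (m : M) :
    G.tmCoef M l (tm M N m (G.e j)) = if l = j then m else 0 := by
  rw [tmCoef_tm, G.coef_e]
  split_ifs <;> simp [M.one_rsmul]

theorem tmCoef_lsmul (G : Frame N) (l : Fin G.n) (a : A) (x : tensor M N) :
    G.tmCoef M l ((tensor M N).lsmul a x) = M.lsmul a (G.tmCoef M l x) := by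
  induction x using tm_induction with
  | h0 => simp
  | ha x y hx hy => simp only [map_add, hx, hy]
  | ht m n => simp [M.lsmul_rsmul]

/-- The matrix `w = S⁻¹(v)` satisfies the inverse relations in the opposite order of multiplication.
The inverse of `σ` is the left-linear map `e_p ⊗ e_q ↦ ∑_j (e_q ◁ w_{jp}) ⊗ e_j`. -/
theorem bijective_braiding (F : Frame M) (hS : Function.Bijective (𝓢)) :
    Function.Bijective (HopfBimodule.braiding M M).toLinearMap := by
  choose w hw using fun j p => hS.2 (F.v j p)
  have hw₁ : ∀ j j', ∑ k, F.v k j * w j' k = if j = j' then 1 else 0 := by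
    intro j j'
    apply hS.1
    rw [map_sum]
    simp only [HopfAlgebra.antipode_mul_antidistrib, hw]
    rw [F.corep.sum_mul_antipode]
    by_cases h : j = j'
    · subst h; simp
    · simp [h, Ne.symm h]
  have hw₂ : ∀ k p, ∑ j, w j p * F.v k j = if k = p then 1 else 0 := by
    intro k p
    apply hS.1
    rw [map_sum]
    simp only [HopfAlgebra.antipode_mul_antidistrib, hw]
    rw [F.corep.sum_antipode_mul]
    split_ifs <;> simp
  let τ : (tensor M M).carrier →ₗ[ℂ] (tensor M M).carrier :=
    ∑ p, ∑ q, (tensor M M).lsmul.flip (∑ j, tm M M (M.adj (w j p) (F.e q)) (F.e j)) ∘ₗ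
      F.coef p ∘ₗ F.tmCoef M q
  have hτ : ∀ x, τ x = ∑ p, ∑ q, (tensor M M).lsmul (F.coef p (F.tmCoef M q x))
      (∑ j, tm M M (M.adj (w j p) (F.e q)) (F.e j)) := by
    intro x
    simp only [τ, LinearMap.sum_apply, LinearMap.comp_apply, LinearMap.flip_apply]
  have hτl : ∀ a x, τ ((tensor M M).lsmul a x) = (tensor M M).lsmul a (τ x) := by
    intro a x
    simp only [hτ, F.tmCoef_lsmul, F.coef_lsmul, (tensor M M).mul_lsmul, ← map_sum]
  have hτe : ∀ p q, τ (tm M M (F.e p) (F.e q)) =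
      ∑ j, tm M M (M.adj (w j p) (F.e q)) (F.e j) := by
    intro p q
    rw [hτ, Finset.sum_eq_single p, Finset.sum_eq_single q]
    · rw [F.tmCoef_tm_e, if_pos rfl, F.coef_e, if_pos rfl, (tensor M M).one_lsmul]
    · intro b _ hb
      rw [F.tmCoef_tm_e, if_neg hb, map_zero, map_zero, LinearMap.zero_apply]
    · simp
    · intro b _ hb
      refine Finset.sum_eq_zero fun q' _ => ?_
      rw [F.tmCoef_tm_e]
      split_ifs
      · rw [F.coef_e, if_neg hb, map_zero, LinearMap.zero_apply]
      · rw [map_zero, map_zero, LinearMap.zero_apply]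
    · simp
  -- The formula is needed for all coinvariant second factors, since `σ` produces `e_i ◁ v_{kj}`
  -- there instead of a basis vector.
  have hτc : ∀ p, ∀ m ∈ M.leftCoinv, τ (tm M M (F.e p) m) =
      ∑ j, tm M M (M.adj (w j p) m) (F.e j) := by
    intro p m hm
    rw [F.eq_sum_coinv hm]
    simp only [map_sum, map_smul, hτe, LinearMap.sum_apply, LinearMap.smul_apply, Finset.smul_sum]
    exact Finset.sum_comm
  have hext : ∀ f : (tensor M M).carrier →ₗ[ℂ] (tensor M M).carrier,
      (∀ a x, f ((tensor M M).lsmul a x) = (tensor M M).lsmul a (f x)) →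
      (∀ i j, f (tm M M (F.e i) (F.e j)) = tm M M (F.e i) (F.e j)) → ∀ x, f x = x := by
    intro f hf he x
    induction F.span_tm F x using Submodule.span_induction with
    | zero => simp
    | add x y _ _ hx hy => rw [map_add, hx, hy]
    | smul c x _ hx => rw [map_smul, hx]
    | mem x hx =>
      obtain ⟨a, _, ⟨⟨i, j⟩, rfl⟩, rfl⟩ := hx
      rw [hf, he]
  have h₁ : ∀ x, τ ((HopfBimodule.braiding M M).toLinearMap x) = x := by
    refine hext (τ ∘ₗ (HopfBimodule.braiding M M).toLinearMap) (fun a x => ?_) fun i j => ?_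
    · rw [LinearMap.comp_apply, Hom.lin_lsmul, hτl]; rfl
    · rw [LinearMap.comp_apply, F.braiding_tm (F.mem i), map_sum]
      simp only [hτc _ _ (M.adj_mem (F.mem i) _), ← M.adj_mul]
      rw [Finset.sum_comm, Finset.sum_eq_single j]
      · rw [← LinearMap.sum_apply, ← map_sum, ← LinearMap.sum_apply, ← map_sum, hw₁, if_pos rfl,
          M.adj_one]
      · intro b _ hb
        rw [← LinearMap.sum_apply, ← map_sum, ← LinearMap.sum_apply, ← map_sum, hw₁,
          if_neg hb.symm]
        simp
      · simp
  have h₂ : ∀ x, (HopfBimodule.braiding M M).toLinearMap (τ x) = x := by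
    refine hext ((HopfBimodule.braiding M M).toLinearMap ∘ₗ τ) (fun a x => ?_) fun p q => ?_
    · rw [LinearMap.comp_apply, hτl, Hom.lin_lsmul]; rfl
    · rw [LinearMap.comp_apply, hτe, map_sum]
      simp only [F.braiding_tm (M.adj_mem (F.mem q) _), ← M.adj_mul]
      rw [Finset.sum_comm, Finset.sum_eq_single p]
      · rw [← map_sum, ← LinearMap.sum_apply, ← map_sum, hw₂, if_pos rfl, M.adj_one]
      · intro b _ hb
        rw [← map_sum, ← LinearMap.sum_apply, ← map_sum, hw₂, if_neg hb]
        simp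
      · simp
  exact ⟨Function.LeftInverse.injective h₁, Function.RightInverse.surjective h₂⟩

end Frame

theorem Hom.exists_inverse {M N : HopfBimodule A} (f : Hom M N)
    (hf : Function.Bijective f.toLinearMap) : ∃ k : Hom N M,
      (∀ x, k.toLinearMap (f.toLinearMap x) = x) ∧ ∀ y, f.toLinearMap (k.toLinearMap y) = y := by
  let E := LinearEquiv.ofBijective f.toLinearMap hf
  have h₁ : ∀ x, E.symm (f.toLinearMap x) = x := fun x => E.symm_apply_apply x
  have h₂ : ∀ y, f.toLinearMap (E.symm y) = y := fun y => E.apply_symm_apply y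
  refine ⟨⟨E.symm.toLinearMap, fun a y => ?_, fun a y => ?_⟩, h₁, h₂⟩
  · apply hf.1
    change f.toLinearMap (E.symm _) = f.toLinearMap (M.lsmul a (E.symm y))
    rw [h₂, f.lin_lsmul, h₂]
  · apply hf.1
    change f.toLinearMap (E.symm _) = f.toLinearMap (M.rsmul a (E.symm y))
    rw [h₂, f.lin_rsmul, h₂]

/-! ### The braid equation -/

/-- The braiding in the last two factors of `(T ⊗_A M) ⊗_A M`. -/
def braidLast (T M : HopfBimodule A) :
    Hom (tensor (tensor T M) M) (tensor (tensor T M) M) :=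
  ((Hom.assoc T M M).andThen (Hom.map (Hom.id T) (HopfBimodule.braiding M M))).andThen
    (Hom.assocInv T M M)

namespace Frame

variable {M : HopfBimodule A}

theorem braidLast_tm (F : Frame M) (T : HopfBimodule A) (t : T) {m : M} (hm : m ∈ M.leftCoinv)
    (j : Fin F.n) : (braidLast T M).toLinearMap (tm (tensor T M) M (tm T M t m) (F.e j)) =
      ∑ k, tm (tensor T M) M (tm T M t (F.e k)) (M.adj (F.v k j) m) := by
  simp [braidLast, F.braiding_tm hm]

/-- The middle step of the braid equation: the second factor is no longer a basis vector, and its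
right coaction is given by `dr_adj_e`. -/
theorem braidLast_tm_adj (F : Frame M) (T : HopfBimodule A) (t : T) {m : M}
    (hm : m ∈ M.leftCoinv) (i k l : Fin F.n) :
    (braidLast T M).toLinearMap (tm (tensor T M) M (tm T M t m) (M.adj (F.v k l) (F.e i))) =
      ∑ q, ∑ p, ∑ r, tm (tensor T M) M (tm T M t (M.adj (F.v q p) (F.e r)))
        (M.adj (𝓢 (F.v k q) * (F.v r i * F.v p l)) m) := by
  simp [braidLast, HopfBimodule.braiding_of_leftCoinv M M m hm, F.dr_adj_e F.corep]

/-- The braid equation. -/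
theorem braid_equation (F : Frame M) (T : HopfBimodule A)
    (x : tensor (tensor (tensor T M) M) M) :
    (braidLast (tensor T M) M).toLinearMap ((Hom.map (braidLast T M) (Hom.id M)).toLinearMap
      ((braidLast (tensor T M) M).toLinearMap x)) =
    (Hom.map (braidLast T M) (Hom.id M)).toLinearMap ((braidLast (tensor T M) M).toLinearMap
      ((Hom.map (braidLast T M) (Hom.id M)).toLinearMap x)) := by
  induction x using F.tm_e_induction with
  | h0 => simp
  | ha x y hx hy => simp only [map_add, hx, hy]
  | ht x c =>
    induction x using F.tm_e_induction with
    | h0 => simp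
    | ha x y hx hy => simp only [map_add, LinearMap.add_apply, hx, hy]
    | ht x b =>
      induction x using F.tm_e_induction with
      | h0 => simp
      | ha x y hx hy => simp only [map_add, LinearMap.add_apply, hx, hy]
      | ht t a =>
        have hadj := fun u i => M.adj_mem (F.mem i) u
        simp only [Hom.map_tm, Hom.id_lin, F.braidLast_tm _ _ (F.mem _), map_sum,
          LinearMap.sum_apply, F.braidLast_tm_adj _ _ (hadj _ _), F.braidLast_tm _ _ (hadj _ _),
          ← M.adj_mul]
        -- On `e_a ⊗ e_b ⊗ e_c` the composite on the left side has the extra factor `v_{lk}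
        -- S(v_{kq})` in its last adjoint action. Its sum over `k` forces `l = q`, and the result is
        -- the composite on the right side.
        have h1 : ∀ (l q p r : Fin F.n), ∑ k, tm (tensor (tensor T M) M) M
            (tm (tensor T M) M (tm T M t (F.e l)) (M.adj (F.v q p) (F.e r)))
            (M.adj (F.v l k * (𝓢 (F.v k q) * (F.v r b * F.v p c))) (F.e a)) =
            if l = q then tm (tensor (tensor T M) M) M
            (tm (tensor T M) M (tm T M t (F.e l)) (M.adj (F.v l p) (F.e r)))
            (M.adj (F.v r b * F.v p c) (F.e a)) else 0 := by
          intro l q p r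
          rw [← map_sum, ← LinearMap.sum_apply, ← map_sum, F.sum_adj_inverse]
          split_ifs with h
          · rw [h]
          · simp
        refine Finset.sum_comm.trans ?_
        refine Eq.trans (b := ∑ l, ∑ q, ∑ p, ∑ r, ∑ k, tm (tensor (tensor T M) M) M
            (tm (tensor T M) M (tm T M t (F.e l)) (M.adj (F.v q p) (F.e r)))
            (M.adj (F.v l k * (𝓢 (F.v k q) * (F.v r b * F.v p c))) (F.e a))) ?_ ?_
        · refine Finset.sum_congr rfl fun l _ => ?_
          refine (sum_reverse₄ _).trans ?_
          exact sum_reverse₃ fun r p q => _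
        simp only [h1]
        have h3 : ∀ l, (∑ q, ∑ p, ∑ r, if l = q then tm (tensor (tensor T M) M) M
            (tm (tensor T M) M (tm T M t (F.e l)) (M.adj (F.v l p) (F.e r)))
            (M.adj (F.v r b * F.v p c) (F.e a)) else 0) =
            ∑ p, ∑ r, tm (tensor (tensor T M) M) M
            (tm (tensor T M) M (tm T M t (F.e l)) (M.adj (F.v l p) (F.e r)))
            (M.adj (F.v r b * F.v p c) (F.e a)) := by
          intro l
          rw [Finset.sum_eq_single l]
          · simp
          · intro b _ hb; simp [hb.symm]
          · simp
        simp only [h3]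
        exact sum_reverse₃ fun l p r => _

end Frame

/-! ## Reduced words in the symmetric group -/

section Words

variable {k : ℕ}

theorem simpleTransposition_mul_self (i : Fin (k - 1)) :
    simpleTransposition k i * simpleTransposition k i = 1 := Equiv.swap_mul_self _ _

theorem simpleTransposition_inv (i : Fin (k - 1)) :
    (simpleTransposition k i)⁻¹ = simpleTransposition k i := Equiv.swap_inv _ _

theorem val_simpleTransposition (i : Fin (k - 1)) (a : Fin k) :
    (simpleTransposition k i a : ℕ) =
      if (a : ℕ) = i then (i : ℕ) + 1 else if (a : ℕ) = i + 1 then (i : ℕ) else a := by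
  simp only [simpleTransposition, Equiv.swap_apply_def, Fin.ext_iff]
  split_ifs <;> rfl

theorem simpleTransposition_comm {i j : Fin (k - 1)} (h : (i : ℕ) + 2 ≤ j) :
    simpleTransposition k i * simpleTransposition k j =
      simpleTransposition k j * simpleTransposition k i := by
  ext a
  simp only [Equiv.Perm.mul_apply, val_simpleTransposition]
  split_ifs <;> omega

theorem simpleTransposition_braid {i j : Fin (k - 1)} (h : (j : ℕ) = i + 1) :
    simpleTransposition k i * simpleTransposition k j * simpleTransposition k i =
      simpleTransposition k j * simpleTransposition k i * simpleTransposition k j := by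
  have hi : simpleTransposition k i = Equiv.swap ⟨i, by omega⟩ ⟨j, by omega⟩ := by
    simp only [simpleTransposition, h]
  have hj : simpleTransposition k j = Equiv.swap ⟨j, by omega⟩ ⟨j + 1, by omega⟩ := rfl
  rw [hi, hj]
  conv_rhs => rw [Equiv.swap_mul_swap_mul_swap (by simp; omega) (by simp; omega)]
  rw [Equiv.swap_comm (⟨i, _⟩ : Fin k), Equiv.swap_comm (⟨j, _⟩ : Fin k) ⟨j + 1, _⟩,
    Equiv.swap_mul_swap_mul_swap (by simp) (by simp; omega), Equiv.swap_comm]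

/-- The value of the permutation `ρ` at the place `i`. -/
def permVal (ρ : Equiv.Perm (Fin k)) (i : ℕ) : ℕ := if h : i < k then ρ ⟨i, h⟩ else 0

theorem permVal_val (ρ : Equiv.Perm (Fin k)) (a : Fin k) : permVal ρ a = ρ a := by
  simp [permVal]

theorem permVal_mul_simpleTransposition (ρ : Equiv.Perm (Fin k)) (i : Fin (k - 1)) {a : ℕ}
    (ha : a < k) : permVal (ρ * simpleTransposition k i) a =
      permVal ρ (if a = i then (i : ℕ) + 1 else if a = i + 1 then (i : ℕ) else a) := by
  have h := val_simpleTransposition i ⟨a, ha⟩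
  rw [← h, permVal_val, ← Equiv.Perm.mul_apply]
  exact permVal_val _ ⟨a, ha⟩

theorem permVal_mul_left (ρ : Equiv.Perm (Fin k)) (i : Fin (k - 1)) :
    permVal (ρ * simpleTransposition k i) i = permVal ρ (i + 1) := by
  rw [permVal_mul_simpleTransposition _ _ (by omega), if_pos rfl]

theorem permVal_mul_right (ρ : Equiv.Perm (Fin k)) (i : Fin (k - 1)) :
    permVal (ρ * simpleTransposition k i) (i + 1) = permVal ρ i := by
  rw [permVal_mul_simpleTransposition _ _ (by omega), if_neg (by omega), if_pos rfl]

theorem permVal_mul_of_ne (ρ : Equiv.Perm (Fin k)) (i : Fin (k - 1)) {a : ℕ} (ha : a < k)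
    (h₁ : a ≠ i) (h₂ : a ≠ i + 1) :
    permVal (ρ * simpleTransposition k i) a = permVal ρ a := by
  rw [permVal_mul_simpleTransposition _ _ ha, if_neg h₁, if_neg h₂]

theorem permVal_injOn (ρ : Equiv.Perm (Fin k)) {a b : ℕ} (ha : a < k) (hb : b < k)
    (h : permVal ρ a = permVal ρ b) : a = b := by
  have := permVal_val ρ ⟨a, ha⟩
  have h' := permVal_val ρ ⟨b, hb⟩
  simp only at this h'
  rw [this, h'] at h
  have := ρ.injective (Fin.ext h)
  simpa using this

/-- The number of inversions. -/
def invCount (ρ : Equiv.Perm (Fin k)) : ℕ :=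
  (Finset.univ.filter fun p : Fin k × Fin k => p.1 < p.2 ∧ ρ p.2 < ρ p.1).card

theorem invCount_one : invCount (1 : Equiv.Perm (Fin k)) = 0 := by
  rw [invCount, Finset.card_eq_zero, Finset.filter_eq_empty_iff]
  rintro p - ⟨h₁, h₂⟩
  exact absurd h₁ (not_lt.2 h₂.le)

theorem invCount_inv (ρ : Equiv.Perm (Fin k)) : invCount ρ⁻¹ = invCount ρ := by
  refine Finset.card_bij' (fun p _ => (ρ⁻¹ p.2, ρ⁻¹ p.1)) (fun p _ => (ρ p.2, ρ p.1)) ?_ ?_ ?_ ?_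
  · rintro ⟨a, b⟩ h; simpa [and_comm] using h
  · rintro ⟨a, b⟩ h; simpa [and_comm] using h
  · rintro ⟨a, b⟩ _; simp
  · rintro ⟨a, b⟩ _; simp

/-- Exchanging neighbouring places `i` and `i + 1` carries the inversions of `ρ` bijectively to
inversions of the product and creates exactly one more, the pair of these two places. -/
theorem invCount_mul_simpleTransposition (ρ : Equiv.Perm (Fin k)) (i : Fin (k - 1))
    (h : permVal ρ i < permVal ρ (i + 1)) :
    invCount (ρ * simpleTransposition k i) = invCount ρ + 1 := by
  set s := simpleTransposition k i with hs
  have hss : ∀ a, s (s a) = a := fun a => by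
    rw [← Equiv.Perm.mul_apply, hs, simpleTransposition_mul_self]; rfl
  let p₀ : Fin k × Fin k := (⟨i, by omega⟩, ⟨i + 1, by omega⟩)
  have hs₁ : s p₀.1 = p₀.2 := Equiv.swap_apply_left _ _
  have hs₂ : s p₀.2 = p₀.1 := Equiv.swap_apply_right _ _
  have hρ : ρ p₀.1 < ρ p₀.2 := by
    have h₁ := permVal_val ρ p₀.1
    have h₂ := permVal_val ρ p₀.2
    simp only [p₀] at h₁ h₂
    rw [h₁, h₂] at h
    exact h
  -- The transposition preserves the order of every pair of places except the neighbouring pair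
  -- itself.
  have hlt : ∀ a b : Fin k, a < b → (a, b) ≠ p₀ → s a < s b := by
    intro a b hab hne
    have hne' : ¬ ((a : ℕ) = i ∧ (b : ℕ) = i + 1) := by
      rintro ⟨h₁, h₂⟩
      exact hne (Prod.ext (Fin.ext h₁) (Fin.ext h₂))
    rw [Fin.lt_def] at hab ⊢
    simp only [hs, val_simpleTransposition]
    split_ifs <;> omega
  have hset : (Finset.univ.filter fun p : Fin k × Fin k =>
      p.1 < p.2 ∧ (ρ * s) p.2 < (ρ * s) p.1) = insert p₀
      ((Finset.univ.filter fun p : Fin k × Fin k => p.1 < p.2 ∧ ρ p.2 < ρ p.1).map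
        (s.prodCongr s).toEmbedding) := by
    ext ⟨a, b⟩
    have hmap : (a, b) ∈ (Finset.univ.filter fun p : Fin k × Fin k =>
        p.1 < p.2 ∧ ρ p.2 < ρ p.1).map (s.prodCongr s).toEmbedding ↔
        s a < s b ∧ ρ (s b) < ρ (s a) := by
      constructor
      · intro h
        obtain ⟨⟨c, d⟩, hcd, he⟩ := Finset.mem_map.1 h
        simp only [Equiv.coe_toEmbedding, Equiv.prodCongr_apply, Prod.map_apply,
          Prod.mk.injEq] at he
        obtain ⟨rfl, rfl⟩ := he
        simpa [hss] using hcd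
      · intro h
        exact Finset.mem_map.2 ⟨(s a, s b), by simpa using h, by simp [hss]⟩
    rw [Finset.mem_insert, hmap, Finset.mem_filter]
    constructor
    · rintro ⟨-, h₁, h₂⟩
      by_cases hp : (a, b) = p₀
      · exact Or.inl hp
      · exact Or.inr ⟨hlt a b h₁ hp, h₂⟩
    · rintro (hp | ⟨h₁, h₂⟩)
      · obtain ⟨rfl, rfl⟩ := Prod.ext_iff.1 hp
        refine ⟨Finset.mem_univ _, Fin.lt_def.2 (Nat.lt_succ_self _), ?_⟩
        simp only [Equiv.Perm.mul_apply]
        rw [hs₁, hs₂]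
        exact hρ
      · refine ⟨Finset.mem_univ _, ?_, h₂⟩
        have := hlt (s a) (s b) h₁ (by
          intro hp
          obtain ⟨h₃, h₄⟩ := Prod.ext_iff.1 hp
          simp only at h₃ h₄
          rw [h₃, h₄] at h₂
          exact absurd h₂ (not_lt.2 hρ.le))
        simpa [hss] using this
  rw [invCount, hset, Finset.card_insert_of_notMem, Finset.card_map, invCount]
  intro hmem
  obtain ⟨⟨c, d⟩, hcd, he⟩ := Finset.mem_map.1 hmem
  simp only [Equiv.coe_toEmbedding, Equiv.prodCongr_apply, Prod.map_apply] at he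
  obtain ⟨h₁, h₂⟩ := Prod.ext_iff.1 he
  simp only at h₁ h₂
  have h₃ : c = p₀.2 := by rw [← hss c, h₁, hs₁]
  have h₄ : d = p₀.1 := by rw [← hss d, h₂, hs₂]
  simp only [Finset.mem_filter, h₃, h₄] at hcd
  have := Fin.lt_def.1 hcd.2.1
  simp [p₀] at this

theorem permVal_ne (ρ : Equiv.Perm (Fin k)) (i : Fin (k - 1)) :
    permVal ρ i ≠ permVal ρ (i + 1) := fun h => by
  have := permVal_injOn ρ (by omega) (by omega) h
  omega

theorem invCount_mul_simpleTransposition_of_lt (ρ : Equiv.Perm (Fin k)) (i : Fin (k - 1))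
    (h : permVal ρ (i + 1) < permVal ρ i) :
    invCount (ρ * simpleTransposition k i) + 1 = invCount ρ := by
  have := invCount_mul_simpleTransposition (ρ * simpleTransposition k i) i (by
    rw [permVal_mul_simpleTransposition _ _ (by omega),
      permVal_mul_simpleTransposition _ _ (by omega)]
    simpa using h)
  rw [← this, mul_assoc, simpleTransposition_mul_self, mul_one]

theorem inv_simpleTransposition_mul (π : Equiv.Perm (Fin k)) (i : Fin (k - 1)) :
    (simpleTransposition k i * π)⁻¹ = π⁻¹ * simpleTransposition k i := by
  rw [mul_inv_rev, simpleTransposition_inv]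

theorem invCount_simpleTransposition_mul (π : Equiv.Perm (Fin k)) (i : Fin (k - 1))
    (h : permVal π⁻¹ i < permVal π⁻¹ (i + 1)) :
    invCount (simpleTransposition k i * π) = invCount π + 1 := by
  rw [← invCount_inv, inv_simpleTransposition_mul, invCount_mul_simpleTransposition _ _ h,
    invCount_inv]

theorem invCount_simpleTransposition_mul_of_lt (π : Equiv.Perm (Fin k)) (i : Fin (k - 1))
    (h : permVal π⁻¹ (i + 1) < permVal π⁻¹ i) :
    invCount (simpleTransposition k i * π) + 1 = invCount π := by
  rw [← invCount_inv, inv_simpleTransposition_mul, invCount_mul_simpleTransposition_of_lt _ _ h,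
    invCount_inv]

theorem eq_one_of_strictMono {ρ : Equiv.Perm (Fin k)} (h : StrictMono ρ) : ρ = 1 := by
  have := Subsingleton.elim (h.orderIsoOfSurjective ρ ρ.surjective) (OrderIso.refl (Fin k))
  exact Equiv.ext fun a => congrArg (fun f : Fin k ≃o Fin k => f a) this

theorem exists_permVal_lt {ρ : Equiv.Perm (Fin k)} (h : ρ ≠ 1) :
    ∃ i : Fin (k - 1), permVal ρ (i + 1) < permVal ρ i := by
  by_contra! hc
  apply h
  apply eq_one_of_strictMono
  cases k with
  | zero => exact fun a => a.elim0
  | succ n =>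
    refine Fin.strictMono_iff_lt_succ.2 fun i => ?_
    have h₁ := lt_of_le_of_ne (hc i) (permVal_ne ρ i)
    have h₂ := permVal_val ρ i.castSucc
    have h₃ := permVal_val ρ i.succ
    simp only [Fin.val_castSucc, Fin.val_succ] at h₂ h₃
    rw [h₂, h₃] at h₁
    exact h₁

/-- Each letter changes the inversion number by one in either direction. -/
theorem invCount_prod_le (w : List (Fin (k - 1))) :
    invCount (w.map (simpleTransposition k)).prod ≤ w.length := by
  induction w with
  | nil => simp [invCount_one]
  | cons i w ih =>
    simp only [List.map_cons, List.prod_cons, List.length_cons]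
    rcases lt_or_gt_of_ne (permVal_ne ((w.map (simpleTransposition k)).prod)⁻¹ i) with h | h
    · rw [invCount_simpleTransposition_mul _ _ h]; omega
    · have := invCount_simpleTransposition_mul_of_lt (w.map (simpleTransposition k)).prod i h
      omega

theorem exists_word (π : Equiv.Perm (Fin k)) :
    ∃ w : List (Fin (k - 1)), (w.map (simpleTransposition k)).prod = π ∧ w.length = invCount π := by
  induction hn : invCount π using Nat.strong_induction_on generalizing π with
  | _ n ih =>
    by_cases hπ : π = 1
    · subst hπ
      exact ⟨[], by simp, by rw [← hn, invCount_one]; rfl⟩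
    · obtain ⟨i, hi⟩ := exists_permVal_lt (ρ := π⁻¹) (by simpa using hπ)
      have h₁ := invCount_simpleTransposition_mul_of_lt _ _ hi
      obtain ⟨w, hw, hl⟩ := ih (invCount (simpleTransposition k i * π)) (by omega) _ rfl
      refine ⟨i :: w, ?_, by rw [List.length_cons]; omega⟩
      rw [List.map_cons, List.prod_cons, hw, ← mul_assoc, simpleTransposition_mul_self, one_mul]

/-- No word is shorter than the inversion number, and removing descents one by one gives a word of
that length. Reducedness thus becomes a counting condition. -/
theorem isReduced_iff {π : Equiv.Perm (Fin k)} {w : List (Fin (k - 1))} :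
    IsReduced π w ↔ (w.map (simpleTransposition k)).prod = π ∧ w.length = invCount π := by
  constructor
  · rintro ⟨h₁, h₂⟩
    obtain ⟨v, hv, hl⟩ := exists_word π
    have := invCount_prod_le w
    rw [h₁] at this
    exact ⟨h₁, le_antisymm (hl ▸ h₂ v hv) this⟩
  · rintro ⟨h₁, h₂⟩
    refine ⟨h₁, fun v hv => ?_⟩
    rw [h₂, ← hv]
    exact invCount_prod_le v

theorem isReduced_reducedWord (π : Equiv.Perm (Fin k)) : IsReduced π (reducedWord π) :=
  (exists_isReduced π).choose_spec

theorem IsReduced.reverse {π : Equiv.Perm (Fin k)} {w : List (Fin (k - 1))} (h : IsReduced π w) :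
    IsReduced π⁻¹ w.reverse := by
  rw [isReduced_iff] at h ⊢
  refine ⟨?_, by rw [List.length_reverse, invCount_inv, h.2]⟩
  rw [← h.1, List.prod_inv_reverse, List.map_reverse, List.map_map]
  congr 2

/-- If the first letter were not a descent of `π⁻¹`, removing it would raise the inversion number
above the length of the remaining word. -/
theorem IsReduced.of_cons {π : Equiv.Perm (Fin k)} {i : Fin (k - 1)} {w : List (Fin (k - 1))}
    (h : IsReduced π (i :: w)) : permVal π⁻¹ (i + 1) < permVal π⁻¹ i ∧
      IsReduced (simpleTransposition k i * π) w := by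
  rw [isReduced_iff] at h ⊢
  rw [List.map_cons, List.prod_cons, List.length_cons] at h
  have h₁ : (w.map (simpleTransposition k)).prod = simpleTransposition k i * π := by
    rw [← h.1, ← mul_assoc, simpleTransposition_mul_self, one_mul]
  have h₂ := invCount_prod_le w
  rw [h₁] at h₂
  have h₃ : permVal π⁻¹ (i + 1) < permVal π⁻¹ i := by
    by_contra hc
    have := invCount_simpleTransposition_mul π i
      (lt_of_le_of_ne (not_lt.1 hc) (permVal_ne _ _))
    omega
  have := invCount_simpleTransposition_mul_of_lt _ _ h₃
  exact ⟨h₃, h₁, by omega⟩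

theorem IsReduced.cons {π : Equiv.Perm (Fin k)} {i : Fin (k - 1)} {w : List (Fin (k - 1))}
    (h : IsReduced (simpleTransposition k i * π) w)
    (hi : permVal π⁻¹ (i + 1) < permVal π⁻¹ i) : IsReduced π (i :: w) := by
  rw [isReduced_iff] at h ⊢
  have := invCount_simpleTransposition_mul_of_lt _ _ hi
  refine ⟨?_, by rw [List.length_cons]; omega⟩
  rw [List.map_cons, List.prod_cons, h.1, ← mul_assoc, simpleTransposition_mul_self, one_mul]

end Words

/-! ### Braid relations and Matsumoto's theorem -/

/-- The elements `T 0, …, T (k - 2)` satisfy the relations of the braid group on `k` strands. -/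
structure BraidRelations {R : Type*} [Monoid R] (k : ℕ) (T : ℕ → R) : Prop where
  braid : ∀ i, i + 2 < k → T i * T (i + 1) * T i = T (i + 1) * T i * T (i + 1)
  comm : ∀ i j, i + 2 ≤ j → j + 1 < k → T i * T j = T j * T i

/-- The product of the elements `T i` along a reduced word of `π`. -/
def wordProd {R : Type*} [Monoid R] {k : ℕ} (T : ℕ → R) (π : Equiv.Perm (Fin k)) : R :=
  ((reducedWord π).map fun i : Fin (k - 1) => T i).prod

section WordProd

variable {R : Type*} [Monoid R] {k : ℕ} {T : ℕ → R}

/-- Matsumoto's theorem for the symmetric group. -/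
theorem BraidRelations.prod_eq (hT : BraidRelations k T) {π : Equiv.Perm (Fin k)}
    {w w' : List (Fin (k - 1))} (hw : IsReduced π w) (hw' : IsReduced π w') :
    (w.map fun i : Fin (k - 1) => T i).prod = (w'.map fun i : Fin (k - 1) => T i).prod := by
  induction hn : invCount π using Nat.strong_induction_on generalizing π w w' with
  | _ n ih =>
    -- The essential case of the induction: two reduced words with different first letters. Both are
    -- compared with words that begin with the two sides of the relation between these letters and
    -- have a common tail.
    have hlt : ∀ (i j : Fin (k - 1)) (v v' : List (Fin (k - 1))), i < j → IsReduced π (i :: v) →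
        IsReduced π (j :: v') →
        T i * (v.map fun i : Fin (k - 1) => T i).prod = T j * (v'.map fun i : Fin (k - 1) => T i).prod := by
      intro i j v v' hij hv hv'
      obtain ⟨hi, hv⟩ := hv.of_cons
      obtain ⟨hj, hv'⟩ := hv'.of_cons
      have hci := invCount_simpleTransposition_mul_of_lt _ _ hi
      have hcj := invCount_simpleTransposition_mul_of_lt _ _ hj
      rw [Fin.lt_def] at hij
      by_cases hd : (i : ℕ) + 2 ≤ j
      -- Distant letters: both are descents of `π⁻¹`, so `π` has reduced words `i j x` and `j i x`.
      · obtain ⟨x, hx⟩ :=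
          exists_isReduced (simpleTransposition k j * (simpleTransposition k i * π))
        have h₁ : IsReduced (simpleTransposition k i * π) (j :: x) := by
          refine hx.cons ?_
          rwa [inv_simpleTransposition_mul, permVal_mul_of_ne _ _ (by omega) (by omega) (by omega),
            permVal_mul_of_ne _ _ (by omega) (by omega) (by omega)]
        have h₂ : IsReduced (simpleTransposition k j * π) (i :: x) := by
          refine IsReduced.cons ?_ ?_
          · rwa [← mul_assoc, simpleTransposition_comm hd, mul_assoc]
          rwa [inv_simpleTransposition_mul, permVal_mul_of_ne _ _ (by omega) (by omega) (by omega),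
            permVal_mul_of_ne _ _ (by omega) (by omega) (by omega)]
        rw [ih _ (by omega) hv h₁ rfl, ih _ (by omega) hv' h₂ rfl]
        simp only [List.map_cons, List.prod_cons, ← mul_assoc]
        rw [hT.comm _ _ hd (by omega)]
      · have hd : (j : ℕ) = i + 1 := by omega
        have e₁ : ∀ ρ : Equiv.Perm (Fin k),
            permVal (ρ * simpleTransposition k i) j = permVal ρ i := by
          intro ρ; rw [hd, permVal_mul_right]
        have e₂ : ∀ ρ : Equiv.Perm (Fin k),
            permVal (ρ * simpleTransposition k j) (i + 1) = permVal ρ (j + 1) := by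
          intro ρ; rw [← hd, permVal_mul_left]
        have e₃ : ∀ ρ : Equiv.Perm (Fin k),
            permVal (ρ * simpleTransposition k i) (j + 1) = permVal ρ (j + 1) := by
          intro ρ; rw [permVal_mul_of_ne _ _ (by omega) (by omega) (by omega)]
        have e₄ : ∀ ρ : Equiv.Perm (Fin k),
            permVal (ρ * simpleTransposition k j) i = permVal ρ i := by
          intro ρ; rw [permVal_mul_of_ne _ _ (by omega) (by omega) (by omega)]
        have hi' : permVal π⁻¹ j < permVal π⁻¹ i := by rwa [hd]
        -- Neighbouring letters: three consecutive values of `π⁻¹` decrease, so `π` has reduced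
        -- words `i j i x` and `j i j x`.
        obtain ⟨x, hx⟩ := exists_isReduced (simpleTransposition k i *
          (simpleTransposition k j * (simpleTransposition k i * π)))
        have h₁ : IsReduced (simpleTransposition k i * π) (j :: i :: x) := by
          refine IsReduced.cons (hx.cons ?_) ?_
          · rw [inv_simpleTransposition_mul, inv_simpleTransposition_mul, e₂, e₃, e₄,
              permVal_mul_left, ← hd]
            exact hj
          · rw [inv_simpleTransposition_mul, e₁, e₃]
            exact hj.trans hi'
        have h₂ : IsReduced (simpleTransposition k j * π) (i :: j :: x) := by
          refine IsReduced.cons (IsReduced.cons ?_ ?_) ?_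
          · have : simpleTransposition k j * (simpleTransposition k i *
                (simpleTransposition k j * π)) = simpleTransposition k i *
                (simpleTransposition k j * (simpleTransposition k i * π)) := by
              simp only [← mul_assoc, simpleTransposition_braid hd]
            rwa [this]
          · rw [inv_simpleTransposition_mul, inv_simpleTransposition_mul, e₁, e₃, e₄,
              permVal_mul_right]
            exact hi'
          · rw [inv_simpleTransposition_mul, e₂, e₄]
            exact hj.trans hi'
        rw [ih _ (by omega) hv h₁ rfl, ih _ (by omega) hv' h₂ rfl]
        simp only [List.map_cons, List.prod_cons, ← mul_assoc]
        rw [hd, hT.braid i (by omega)]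
    have hl := (isReduced_iff.1 hw).2
    have hl' := (isReduced_iff.1 hw').2
    match w, w' with
    | [], [] => rfl
    | [], _ :: _ => rw [List.length_nil] at hl; rw [List.length_cons] at hl'; omega
    | _ :: _, [] => rw [List.length_cons] at hl; rw [List.length_nil] at hl'; omega
    | i :: v, j :: v' =>
      rw [List.map_cons, List.map_cons, List.prod_cons, List.prod_cons]
      rcases lt_trichotomy i j with h | h | h
      · exact hlt i j v v' h hw hw'
      · subst h
        rw [List.length_cons] at hl
        have hci := invCount_simpleTransposition_mul_of_lt _ _ hw.of_cons.1
        rw [ih _ (by omega) hw.of_cons.2 hw'.of_cons.2 rfl]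
      · exact (hlt j i v' v h hw' hw).symm

theorem BraidRelations.wordProd_eq (hT : BraidRelations k T) {π : Equiv.Perm (Fin k)}
    {w : List (Fin (k - 1))} (hw : IsReduced π w) :
    wordProd T π = (w.map fun i : Fin (k - 1) => T i).prod :=
  hT.prod_eq (isReduced_reducedWord π) hw

theorem wordProd_one : wordProd T (1 : Equiv.Perm (Fin k)) = 1 := by
  have := (isReduced_iff.1 (isReduced_reducedWord (1 : Equiv.Perm (Fin k)))).2
  rw [invCount_one, List.length_eq_zero_iff] at this
  simp [wordProd, this]

theorem BraidRelations.wordProd_simpleTransposition_mul (hT : BraidRelations k T)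
    (π : Equiv.Perm (Fin k)) (i : Fin (k - 1)) (h : permVal π⁻¹ i < permVal π⁻¹ (i + 1)) :
    wordProd T (simpleTransposition k i * π) = T i * wordProd T π := by
  have h₁ : IsReduced (simpleTransposition k i * π) (i :: reducedWord π) := by
    refine IsReduced.cons ?_ ?_
    · rw [← mul_assoc, simpleTransposition_mul_self, one_mul]
      exact isReduced_reducedWord π
    · rw [inv_simpleTransposition_mul, permVal_mul_simpleTransposition _ _ (by omega),
        permVal_mul_simpleTransposition _ _ (by omega)]
      simpa using h
  rw [hT.wordProd_eq h₁]
  rfl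

theorem BraidRelations.wordProd_mul_simpleTransposition (hT : BraidRelations k T)
    (π : Equiv.Perm (Fin k)) (i : Fin (k - 1)) (h : permVal π i < permVal π (i + 1)) :
    wordProd T (π * simpleTransposition k i) = wordProd T π * T i := by
  have h₁ : IsReduced (π * simpleTransposition k i) (reducedWord π ++ [i]) := by
    have h₂ := isReduced_iff.1 (isReduced_reducedWord π)
    rw [isReduced_iff]
    refine ⟨by simp [h₂.1], ?_⟩
    rw [invCount_mul_simpleTransposition _ _ h]
    simp [h₂.2]
  rw [hT.wordProd_eq h₁]
  simp [wordProd]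

/-- Induction on a permutation along a reduced word. -/
theorem perm_induction {p : Equiv.Perm (Fin k) → Prop} (h1 : p 1)
    (hs : ∀ π i, permVal π⁻¹ (i : Fin (k - 1)) < permVal π⁻¹ (i + 1) → p π →
      p (simpleTransposition k i * π)) (π : Equiv.Perm (Fin k)) : p π := by
  induction hn : invCount π using Nat.strong_induction_on generalizing π with
  | _ n ih =>
    by_cases hπ : π = 1
    · rwa [hπ]
    · obtain ⟨i, hi⟩ := exists_permVal_lt (ρ := π⁻¹) (by simpa using hπ)
      have h₁ := invCount_simpleTransposition_mul_of_lt _ _ hi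
      have h₂ := hs (simpleTransposition k i * π) i (by
        rw [inv_simpleTransposition_mul, permVal_mul_simpleTransposition _ _ (by omega),
          permVal_mul_simpleTransposition _ _ (by omega)]
        simpa using hi) (ih _ (by omega) _ rfl)
      rwa [← mul_assoc, simpleTransposition_mul_self, one_mul] at h₂

end WordProd

/-! ## Sums over the symmetric group -/

section Blocks

/-- The block of the places `o, …, o + k - 1`. -/
def block (k o K : ℕ) (h : o + k ≤ K) : Fin k ↪ Fin K :=
  ⟨fun i => ⟨i + o, by omega⟩, fun i j hij => by simpa [Fin.ext_iff] using hij⟩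

theorem val_block {k o K : ℕ} (h : o + k ≤ K) (i : Fin k) : (block k o K h i : ℕ) = i + o := rfl

variable {k o K : ℕ} (h : o + k ≤ K)

/-- A permutation of the block of the places `o, …, o + k - 1` as a permutation of all places. -/
def blockPerm : Equiv.Perm (Fin k) →* Equiv.Perm (Fin K) :=
  Equiv.Perm.viaEmbeddingHom (block k o K h)

theorem blockPerm_block (v : Equiv.Perm (Fin k)) (a : Fin k) :
    blockPerm h v (block k o K h a) = block k o K h (v a) :=
  Equiv.Perm.viaEmbedding_apply v (block k o K h) a

theorem blockPerm_simpleTransposition (i : Fin (k - 1)) :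
    blockPerm h (simpleTransposition k i) = simpleTransposition K ⟨i + o, by omega⟩ := by
  ext a
  rw [val_simpleTransposition]
  by_cases ha : a ∈ Set.range (block k o K h)
  · obtain ⟨a, rfl⟩ := ha
    rw [blockPerm_block, val_block, val_block, val_simpleTransposition]
    simp only
    split_ifs <;> omega
  · have h₁ : blockPerm h (simpleTransposition k i) a = a :=
      Equiv.Perm.viaEmbedding_apply_of_notMem _ _ _ ha
    rw [h₁, if_neg, if_neg]
    · intro h₂
      exact ha ⟨⟨i + 1, by omega⟩, Fin.ext (by rw [val_block]; simp only at h₂ ⊢; omega)⟩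
    · intro h₂
      exact ha ⟨⟨i, by omega⟩, Fin.ext (by rw [val_block]; simp only at h₂ ⊢; omega)⟩

theorem eq_one_of_strictMono_block {v : Equiv.Perm (Fin k)} {ρ : Equiv.Perm (Fin K)}
    (h₁ : StrictMono fun a => ρ (block k o K h a))
    (h₂ : StrictMono fun a => ρ (block k o K h (v a))) : v = 1 :=
  eq_one_of_strictMono fun _ _ hab => h₁.lt_iff_lt.1 (h₂ hab)

variable {R : Type*} [Ring R] {T : ℕ → R}

theorem BraidRelations.shift (h : o + k ≤ K) {R : Type*} [Monoid R] {T : ℕ → R}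
    (hT : BraidRelations K T) :
    BraidRelations k (fun i => T (i + o)) where
  braid i hi := by
    have := hT.braid (i + o) (by omega)
    rwa [show i + o + 1 = i + 1 + o by omega] at this
  comm i j hij hj := hT.comm (i + o) (j + o) (by omega) (by omega)

theorem permVal_block (ρ : Equiv.Perm (Fin K)) (a : ℕ) (ha : a < k) :
    permVal ρ (a + o) = ρ (block k o K h ⟨a, ha⟩) :=
  permVal_val ρ (block k o K h ⟨a, ha⟩)

/-- Lengths add: since `μ⁻¹` is increasing on the block, an ascent of the inverse of a block
permutation is an ascent of the inverse of its product with `μ`. Hence each letter from the block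
lengthens the reduced word. -/
theorem BraidRelations.wordProd_blockPerm_mul {R : Type*} [Monoid R] {T : ℕ → R}
    (hT : BraidRelations K T) {μ : Equiv.Perm (Fin K)}
    (hμ : StrictMono fun a => μ⁻¹ (block k o K h a)) (v : Equiv.Perm (Fin k)) :
    wordProd T (blockPerm h v * μ) = wordProd (fun i => T (i + o)) v * wordProd T μ := by
  induction v using perm_induction with
  | h1 => rw [map_one, one_mul, wordProd_one, one_mul]
  | hs π i hi ih =>
    have hT' : BraidRelations k (fun i => T (i + o)) := hT.shift h
    rw [hT'.wordProd_simpleTransposition_mul _ _ hi, map_mul, mul_assoc,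
      blockPerm_simpleTransposition, hT.wordProd_simpleTransposition_mul, ih, mul_assoc]
    have h₁ : ∀ a (ha : a < k), permVal (blockPerm h π * μ)⁻¹ (a + o) =
        μ⁻¹ (block k o K h (π⁻¹ ⟨a, ha⟩)) := by
      intro a ha
      rw [permVal_block h _ a ha, mul_inv_rev, ← map_inv, Equiv.Perm.mul_apply, blockPerm_block]
    have h₂ : ∀ a (ha : a < k), permVal π⁻¹ a = π⁻¹ ⟨a, ha⟩ := fun a ha => permVal_val π⁻¹ ⟨a, ha⟩
    have h₃ := h₁ (i + 1) (by omega)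
    rw [show (i : ℕ) + 1 + o = i + o + 1 by omega] at h₃
    change permVal _ (i + o) < permVal _ (i + o + 1)
    rw [h₁ i (by omega), h₃]
    rw [h₂ i (by omega), h₂ (i + 1) (by omega)] at hi
    exact hμ hi

open Classical in
/-- The sum over the symmetric group is the product of the sum over the permutations of a block and
the sum over the permutations whose inverse is increasing on the block. -/
theorem BraidRelations.sum_wordProd (hT : BraidRelations K T) :
    ∑ π : Equiv.Perm (Fin K), wordProd T π =
      (∑ v : Equiv.Perm (Fin k), wordProd (fun i => T (i + o)) v) *
        ∑ μ : Equiv.Perm (Fin K) with StrictMono fun a => μ⁻¹ (block k o K h a), wordProd T μ := by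
  rw [Finset.sum_mul_sum, ← Finset.sum_product']
  symm
  refine Finset.sum_bij (fun p _ => blockPerm h p.1 * p.2) (fun _ _ => Finset.mem_univ _) ?_ ?_ ?_
  · rintro ⟨v, μ⟩ hp ⟨v', μ'⟩ hp' he
    simp only [Finset.mem_product, Finset.mem_univ, Finset.mem_filter, true_and] at hp hp' he
    -- Uniqueness of the factorisation: both inverses are increasing on the block, and only the
    -- identity preserves this monotonicity.
    have h₁ : μ'⁻¹ = μ⁻¹ * blockPerm h (v⁻¹ * v') := by
      rw [map_mul, map_inv]
      have := congrArg (fun x => x⁻¹) he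
      simp only [mul_inv_rev] at this
      rw [← mul_assoc, this, mul_assoc, inv_mul_cancel, mul_one]
    have h₂ : v⁻¹ * v' = 1 := by
      refine eq_one_of_strictMono_block h hp ?_
      rw [h₁] at hp'
      simpa only [Equiv.Perm.mul_apply, blockPerm_block] using hp'
    have h₃ : v = v' := inv_mul_eq_one.1 h₂
    subst h₃
    exact Prod.ext rfl (mul_left_cancel he)
  · intro π _
    let f : Fin k → Fin K := fun a => π⁻¹ (block k o K h a)
    have hf : Function.Injective f := π⁻¹.injective.comp (block k o K h).injective
    -- Existence of the factorisation: sorting the values of `π⁻¹` on the block yields the block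
    -- permutation to be split off.
    let v := Tuple.sort f
    refine ⟨(v, (blockPerm h v)⁻¹ * π), ?_, by simp⟩
    simp only [Finset.mem_product, Finset.mem_univ, Finset.mem_filter, true_and]
    have h₁ : StrictMono (f ∘ v) :=
      (Tuple.monotone_sort f).strictMono_of_injective (hf.comp v.injective)
    have h₂ : (fun a => ((blockPerm h v)⁻¹ * π)⁻¹ (block k o K h a)) = f ∘ v := by
      funext a
      simp [f, blockPerm_block]
    rw [h₂]
    exact h₁
  · rintro ⟨v, μ⟩ hp
    simp only [Finset.mem_product, Finset.mem_univ, Finset.mem_filter, true_and] at hp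
    exact (hT.wordProd_blockPerm_mul h hp v).symm

theorem BraidRelations.op {R : Type*} [Monoid R] {T : ℕ → R} (hT : BraidRelations k T) :
    BraidRelations k (fun i => MulOpposite.op (T i)) where
  braid i hi := by
    simp only [← MulOpposite.op_mul, ← mul_assoc]
    rw [hT.braid i hi]
  comm i j hij hj := by
    simp only [← MulOpposite.op_mul]
    rw [hT.comm i j hij hj]

theorem BraidRelations.wordProd_op {R : Type*} [Monoid R] {T : ℕ → R} (hT : BraidRelations k T)
    (π : Equiv.Perm (Fin k)) :
    wordProd (fun i => MulOpposite.op (T i)) π = MulOpposite.op (wordProd T π⁻¹) := by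
  rw [hT.wordProd_eq (isReduced_reducedWord π).reverse, wordProd]
  generalize reducedWord π = w
  induction w with
  | nil => simp
  | cons i w ih => simp [ih]

open Classical in
/-- The mirror image of `BraidRelations.sum_wordProd`. -/
theorem BraidRelations.sum_wordProd_right (h : o + k ≤ K) (hT : BraidRelations K T) :
    ∃ Z : R, ∑ π : Equiv.Perm (Fin K), wordProd T π =
      Z * ∑ v : Equiv.Perm (Fin k), wordProd (fun i => T (i + o)) v := by
  have hT' : BraidRelations k (fun i => T (i + o)) := hT.shift h
  -- In the opposite ring words are reversed and permutations inverted, so the block factor moves to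
  -- the right. The other factor may remain unspecified, because only the resulting inclusion of
  -- kernels is needed.
  have h₁ := hT.op.sum_wordProd h
  simp only [hT.wordProd_op, hT'.wordProd_op] at h₁
  have h₂ := congrArg MulOpposite.unop h₁
  simp only [MulOpposite.unop_mul, Finset.unop_sum, MulOpposite.unop_op] at h₂
  rw [← Equiv.sum_comp (Equiv.inv _) fun v : Equiv.Perm (Fin k) => wordProd (fun i => T (i + o)) v,
    ← Equiv.sum_comp (Equiv.inv _) fun v : Equiv.Perm (Fin K) => wordProd T v]
  exact ⟨_, h₂⟩

end Blocks

/-! ### The longest permutation, inverse generators and adjoints -/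

section LongestElement

variable {k : ℕ}

theorem rev_simpleTransposition (i : Fin (k - 1)) :
    Fin.revPerm * simpleTransposition k i * Fin.revPerm = simpleTransposition k i.rev := by
  ext a
  simp only [Equiv.Perm.mul_apply, Fin.revPerm_apply, Fin.val_rev, val_simpleTransposition]
  split_ifs <;> omega

theorem revPerm_mul_self : (Fin.revPerm : Equiv.Perm (Fin k)) * Fin.revPerm = 1 := by
  ext a; simp

theorem prod_map_rev (w : List (Fin (k - 1))) :
    ((w.map Fin.rev).map (simpleTransposition k)).prod =
      Fin.revPerm * (w.map (simpleTransposition k)).prod * Fin.revPerm := by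
  induction w with
  | nil => simp [revPerm_mul_self]
  | cons i w ih =>
    simp only [List.map_cons, List.prod_cons, ih, ← rev_simpleTransposition]
    simp only [mul_assoc]
    rw [← mul_assoc Fin.revPerm Fin.revPerm, revPerm_mul_self, one_mul]

theorem IsReduced.map_rev {π : Equiv.Perm (Fin k)} {w : List (Fin (k - 1))} (h : IsReduced π w) :
    IsReduced (Fin.revPerm * π * Fin.revPerm) (w.map Fin.rev) := by
  refine ⟨by rw [prod_map_rev, h.1], fun w' hw' => ?_⟩
  have := h.2 (w'.map Fin.rev) (by
    rw [prod_map_rev, hw']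
    simp only [mul_assoc]
    rw [revPerm_mul_self, mul_one, ← mul_assoc, revPerm_mul_self, one_mul])
  simpa using this

theorem permVal_revPerm_mul (ρ : Equiv.Perm (Fin k)) {a : ℕ} (ha : a < k) :
    permVal (Fin.revPerm * ρ) a = k - (permVal ρ a + 1) := by
  have h₁ := permVal_val (Fin.revPerm * ρ) ⟨a, ha⟩
  have h₂ := permVal_val ρ ⟨a, ha⟩
  simp only at h₁ h₂
  rw [h₁, h₂]
  simp

theorem permVal_lt (ρ : Equiv.Perm (Fin k)) {a : ℕ} (ha : a < k) : permVal ρ a < k := by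
  rw [permVal, dif_pos ha]
  exact (ρ ⟨a, ha⟩).2

/-- The longest permutation is a product of `w₀ π⁻¹` and `π` in which lengths add. Moving one letter
across shortens the first factor and lengthens the second, because order reversal turns ascents into
descents. -/
theorem BraidRelations.wordProd_revPerm {R : Type*} [Monoid R] {T : ℕ → R}
    (hT : BraidRelations k T) (π : Equiv.Perm (Fin k)) :
    wordProd T (Fin.revPerm * π⁻¹) * wordProd T π =
      wordProd T (Fin.revPerm : Equiv.Perm (Fin k)) := by
  induction π using perm_induction with
  | h1 => rw [wordProd_one, inv_one, mul_one, mul_one]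
  | hs π i hi ih =>
    rw [hT.wordProd_simpleTransposition_mul _ _ hi, ← mul_assoc,
      ← hT.wordProd_mul_simpleTransposition, inv_simpleTransposition_mul]
    · rw [← ih]
      simp only [mul_assoc, simpleTransposition_mul_self, mul_one]
    · rw [inv_simpleTransposition_mul, ← mul_assoc, permVal_mul_left, permVal_mul_right,
        permVal_revPerm_mul _ (by omega), permVal_revPerm_mul _ (by omega)]
      have := permVal_lt π⁻¹ (a := i + 1) (by omega)
      omega

/-- The reversed reduced word represents `π⁻¹`, and the two words cancel from the middle outwards.
-/
theorem BraidRelations.wordProd_mul_wordProd_inv {R : Type*} [Monoid R] {T T' : ℕ → R}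
    (hT' : BraidRelations k T') (h : ∀ i, i + 1 < k → T i * T' i = 1) (π : Equiv.Perm (Fin k)) :
    wordProd T π * wordProd T' π⁻¹ = 1 := by
  rw [hT'.wordProd_eq (isReduced_reducedWord π).reverse, wordProd]
  generalize reducedWord π = w
  induction w with
  | nil => simp
  | cons i w ih =>
    simp only [List.map_cons, List.prod_cons, List.reverse_cons, List.map_append, List.map_nil,
      List.prod_append, List.prod_nil, mul_one]
    rw [mul_assoc, ← mul_assoc _ _ (T' i), ih, one_mul, h i (by omega)]

/-- The sums over the symmetric group for `T` and for the inverse elements `T'`. -/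
theorem BraidRelations.sum_inverse {R : Type*} [Ring R] {T T' : ℕ → R}
    (hT : BraidRelations k T) (hT' : BraidRelations k T') (h : ∀ i, i + 1 < k → T i * T' i = 1) :
    wordProd T (Fin.revPerm : Equiv.Perm (Fin k)) * ∑ π : Equiv.Perm (Fin k), wordProd T' π =
      ∑ π : Equiv.Perm (Fin k), wordProd T π := by
  -- The sums are matched by `T'_{π⁻¹}` on one side and `T_{w₀ π⁻¹}` on the other, so that `T_{w₀}
  -- T'_{π⁻¹} = T_{w₀ π⁻¹}` applies term by term.
  rw [← Equiv.sum_comp (Equiv.inv _) fun π : Equiv.Perm (Fin k) => wordProd T' π,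
    ← Equiv.sum_comp ((Equiv.inv _).trans (Equiv.mulLeft Fin.revPerm))
      fun π : Equiv.Perm (Fin k) => wordProd T π, Finset.mul_sum]
  refine Finset.sum_congr rfl fun π _ => ?_
  change wordProd T Fin.revPerm * wordProd T' π⁻¹ = wordProd T (Fin.revPerm * π⁻¹)
  rw [← hT.wordProd_revPerm π, mul_assoc, hT'.wordProd_mul_wordProd_inv h, mul_one]

/-- If `T i` is adjoint to `T' (k - 2 - i)` then the sums over the symmetric group are adjoint. -/
theorem BraidRelations.sum_adjoint {V W X : Type*} [AddCommGroup V] [AddCommGroup W]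
    [AddCommGroup X] [Module ℂ V] [Module ℂ W] [Module ℂ X] {T : ℕ → Module.End ℂ V}
    {T' : ℕ → Module.End ℂ W} (hT' : BraidRelations k T') (G : V →ₗ[ℂ] W →ₗ[ℂ] X)
    (h : ∀ i, i + 1 < k → ∀ x y, G (T i x) y = G x (T' (k - 1 - (i + 1)) y)) (x : V) (y : W) :
    G ((∑ π : Equiv.Perm (Fin k), wordProd T π) x) y =
      G x ((∑ π : Equiv.Perm (Fin k), wordProd T' π) y) := by
  -- Taking adjoints reverses the word and mirrors each letter, which replaces `π` by `w₀ π⁻¹ w₀`;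
  -- this is a bijection of the symmetric group.
  have h₁ : ∀ (π : Equiv.Perm (Fin k)) x y, G (wordProd T π x) y =
      G x (wordProd T' (Fin.revPerm * π⁻¹ * Fin.revPerm) y) := by
    intro π
    rw [hT'.wordProd_eq (isReduced_reducedWord π).reverse.map_rev, wordProd]
    generalize reducedWord π = w
    induction w with
    | nil => simp
    | cons i w ih =>
      intro x y
      simp only [List.map_cons, List.prod_cons, List.reverse_cons, List.map_append, List.map_nil,
        List.prod_append, List.prod_nil, mul_one, Module.End.mul_apply, h i (by omega), ih,
        Fin.val_rev]
  rw [← Equiv.sum_comp (((Equiv.inv _).trans (Equiv.mulLeft Fin.revPerm)).trans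
    (Equiv.mulRight Fin.revPerm)) fun π : Equiv.Perm (Fin k) => wordProd T' π]
  simp only [LinearMap.sum_apply, map_sum, h₁]
  rfl

end LongestElement

/-- Each simple transposition has sign `-1`. Thus the signed sums over `σ_π` are plain sums for the
generators `-σ_i`, which still satisfy the braid relations. -/
theorem prod_map_neg {R : Type*} [Ring R] [Algebra ℂ R] {k : ℕ} (t : Fin (k - 1) → R)
    (w : List (Fin (k - 1))) : (w.map fun i => -t i).prod =
      (((Equiv.Perm.sign (w.map (simpleTransposition k)).prod : ℤˣ) : ℤ) : ℂ) •
        (w.map t).prod := by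
  induction w with
  | nil => simp
  | cons i w ih =>
    have hi : Equiv.Perm.sign (simpleTransposition k i) = -1 := by
      refine Equiv.Perm.sign_swap ?_
      simp
    simp [ih, hi]

section Antisym

variable {A : Type u} [Ring A] [HopfAlgebra ℂ A]

theorem signedSigma_eq (Γ : HopfBimodule A) (k : ℕ) (s : Sgn) {t : ℕ → Module.End ℂ (tpow Γ k)}
    (ht : ∀ i : Fin (k - 1), t i = -sigmaPM Γ k s i) (π : Equiv.Perm (Fin k)) :
    signedSigma Γ k s π = wordProd t π := by
  have h₁ : wordProd t π = ((reducedWord π).map fun i => -sigmaPM Γ k s i).prod := by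
    simp only [wordProd, ht]
  rw [h₁, prod_map_neg, (isReduced_reducedWord π).1]
  rfl

end Antisym

/-! ## The braid group action on the tensor powers -/

/-- The endomorphisms of a Hopf bimodule. -/
def hopfEnd (M : HopfBimodule A) : Subalgebra ℂ (Module.End ℂ M) where
  carrier := {f | IsBicomoduleMap M M f ∧ (∀ a x, f (M.lsmul a x) = M.lsmul a (f x)) ∧
    ∀ a x, f (M.rsmul a x) = M.rsmul a (f x)}
  mul_mem' := by
    rintro f k ⟨hf, hfl, hfr⟩ ⟨hk, hkl, hkr⟩
    refine ⟨hf.comp hk, fun a x => ?_, fun a x => ?_⟩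
    · rw [Module.End.mul_apply, hkl, hfl]; rfl
    · rw [Module.End.mul_apply, hkr, hfr]; rfl
  add_mem' := by
    rintro f k ⟨hf, hfl, hfr⟩ ⟨hk, hkl, hkr⟩
    refine ⟨hf.add hk, fun a x => ?_, fun a x => ?_⟩
    · simp [hfl, hkl]
    · simp [hfr, hkr]
  algebraMap_mem' c := by
    refine ⟨IsBicomoduleMap.id.smul c, fun a x => ?_, fun a x => ?_⟩ <;> simp

theorem hopfEnd_inverse {M : HopfBimodule A} {f k : Module.End ℂ M} (hf : f ∈ hopfEnd M)
    (h₁ : f * k = 1) (h₂ : k * f = 1) : k ∈ hopfEnd M := by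
  have h₁' : ∀ x, f (k x) = x := fun x => LinearMap.congr_fun h₁ x
  have h₂' : ∀ x, k (f x) = x := fun x => LinearMap.congr_fun h₂ x
  refine ⟨hf.1.inverse h₁ h₂, fun a x => ?_, fun a x => ?_⟩
  · conv_lhs => rw [← h₁' x, ← hf.2.1, h₂']
  · conv_lhs => rw [← h₁' x, ← hf.2.2, h₂']

theorem wordProd_mem {R : Type*} [Ring R] [Algebra ℂ R] (S : Subalgebra ℂ R) {k : ℕ} {T : ℕ → R}
    (hT : ∀ i, i + 1 < k → T i ∈ S) (π : Equiv.Perm (Fin k)) : wordProd T π ∈ S := by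
  refine S.list_prod_mem fun x hx => ?_
  obtain ⟨i, _, rfl⟩ := List.mem_map.1 hx
  exact hT i (by omega)

theorem BraidRelations.neg {R : Type*} [Ring R] {k : ℕ} {T : ℕ → R} (hT : BraidRelations k T) :
    BraidRelations k (fun i => -T i) where
  braid i hi := by simp [hT.braid i hi]
  comm i j hij hj := by simp [hT.comm i j hij hj]

/-- Inversion in the group of units reverses words; both sides of the braid relation are
palindromes, and commuting units have commuting inverses. -/
theorem BraidRelations.inverse {R : Type*} [Monoid R] {k : ℕ} {T T' : ℕ → R}
    (hT : BraidRelations k T) (h₁ : ∀ i, T i * T' i = 1) (h₂ : ∀ i, T' i * T i = 1) :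
    BraidRelations k T' := by
  let U : ℕ → Rˣ := fun i => ⟨T i, T' i, h₁ i, h₂ i⟩
  refine ⟨fun i hi => ?_, fun i j hij hj => ?_⟩
  · have : U i * U (i + 1) * U i = U (i + 1) * U i * U (i + 1) :=
      Units.ext (hT.braid i hi)
    have h := congrArg (fun u => (u⁻¹ : Rˣ).val) this
    simpa [U, mul_assoc] using h
  · have : U i * U j = U j * U i := Units.ext (hT.comm i j hij hj)
    have h := congrArg (fun u => (u⁻¹ : Rˣ).val) this
    simpa [U] using h.symm

/-- `tapp Γ k x ρ` is the element `x ⊗ ρ` of `Γ^{⊗ k+1}`. -/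
def tapp (Γ : HopfBimodule A) (k : ℕ) : tpow Γ k →ₗ[ℂ] Γ →ₗ[ℂ] (tpow Γ (k + 1)).carrier :=
  tm (tpow Γ k) Γ

theorem tapp_induction {Γ : HopfBimodule A} {k : ℕ} {p : (tpow Γ (k + 1)).carrier → Prop}
    (h0 : p 0) (ht : ∀ x ρ, p (tapp Γ k x ρ)) (ha : ∀ x y, p x → p y → p (x + y)) (x) : p x :=
  tm_induction (M := tpow Γ k) (N := Γ) h0 ht ha x

theorem tapp_ext {Γ : HopfBimodule A} {k : ℕ} {V : Type*} [AddCommGroup V] [Module ℂ V]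
    {f f' : (tpow Γ (k + 1)).carrier →ₗ[ℂ] V}
    (h : ∀ x ρ, f (tapp Γ k x ρ) = f' (tapp Γ k x ρ)) : f = f' := by
  ext x
  induction x using tapp_induction with
  | h0 => simp
  | ht x ρ => exact h x ρ
  | ha x y hx hy => rw [map_add, map_add, hx, hy]

theorem tapp_rsmul {Γ : HopfBimodule A} {k : ℕ} (x : tpow Γ k) (a : A) (ρ : Γ) :
    tapp Γ k ((tpow Γ k).rsmul a x) ρ = tapp Γ k x (Γ.lsmul a ρ) := tm_rsmul x a ρ

theorem lsmul_tapp {Γ : HopfBimodule A} {k : ℕ} (x : tpow Γ k) (a : A) (ρ : Γ) :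
    (tpow Γ (k + 1)).lsmul a (tapp Γ k x ρ) = tapp Γ k ((tpow Γ k).lsmul a x) ρ :=
  lsmul_tm (M := tpow Γ k) a x ρ

theorem rsmul_tapp {Γ : HopfBimodule A} {k : ℕ} (x : tpow Γ k) (a : A) (ρ : Γ) :
    (tpow Γ (k + 1)).rsmul a (tapp Γ k x ρ) = tapp Γ k x (Γ.rsmul a ρ) :=
  rsmul_tm (M := tpow Γ k) a x ρ

theorem sigmaAt_last (Γ : HopfBimodule A) (k : ℕ) :
    sigmaAt Γ (k + 2) k = braidLast (tpow Γ k) Γ := if_pos rfl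

theorem sigmaAt_of_ne (Γ : HopfBimodule A) {k i : ℕ} (h : i ≠ k) :
    sigmaAt Γ (k + 2) i = Hom.map (sigmaAt Γ (k + 1) i) (Hom.id Γ) := if_neg h

theorem sigmaAt_tapp (Γ : HopfBimodule A) {k i : ℕ} (h : i + 1 < k) (x : tpow Γ k) (ρ : Γ) :
    (sigmaAt Γ (k + 1) i).toLinearMap (tapp Γ k x ρ) =
      tapp Γ k ((sigmaAt Γ k i).toLinearMap x) ρ := by
  obtain ⟨k, rfl⟩ : ∃ n, k = n + 2 := ⟨k - 2, by omega⟩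
  rw [sigmaAt_of_ne Γ (by omega)]
  exact Hom.map_tm (sigmaAt Γ (k + 2) i) (Hom.id Γ) x ρ

/-- In the form `t ⊗ y` with `y ∈ M ⊗ M` the braiding leaves `t` alone. This makes operators on
distant tensor factors commute visibly. -/
theorem braidLast_assocInv (T M : HopfBimodule A) (t : T) (x : tensor M M) :
    (braidLast T M).toLinearMap ((Hom.assocInv T M M).toLinearMap (tm T (tensor M M) t x)) =
      (Hom.assocInv T M M).toLinearMap
        (tm T (tensor M M) t ((HopfBimodule.braiding M M).toLinearMap x)) := by
  induction x using tm_induction with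
  | h0 => simp
  | ha x y hx hy => simp only [map_add, hx, hy]
  | ht m n => simp [braidLast]

theorem assocInv_induction {M N P : HopfBimodule A} {p : (tensor (tensor M N) P).carrier → Prop}
    (h0 : p 0) (ht : ∀ m x, p ((Hom.assocInv M N P).toLinearMap (tm M (tensor N P) m x)))
    (ha : ∀ x y, p x → p y → p (x + y)) (x) : p x := by
  induction x using tm_induction with
  | h0 => exact h0
  | ha x y hx hy => exact ha x y hx hy
  | ht x n =>
    induction x using tm_induction with
    | h0 => simpa using h0
    | ha x y hx hy => rw [map_add, LinearMap.add_apply]; exact ha _ _ hx hy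
    | ht m k =>
      rw [← Hom.assocInv_tm]
      exact ht _ _

theorem map_assocInv {M N P M' N' P' : HopfBimodule A} (f : Hom M M') (k : Hom N N') (l : Hom P P')
    (m : M) (x : tensor N P) : (Hom.map (Hom.map f k) l).toLinearMap
      ((Hom.assocInv M N P).toLinearMap (tm M (tensor N P) m x)) =
      (Hom.assocInv M' N' P').toLinearMap (tm M' (tensor N' P') (f.toLinearMap m)
        ((Hom.map k l).toLinearMap x)) := by
  induction x using tm_induction with
  | h0 => simp
  | ha x y hx hy => simp only [map_add, hx, hy]
  | ht m n => simp

theorem map_id_id {M N : HopfBimodule A} (x : tensor M N) :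
    (Hom.map (Hom.id M) (Hom.id N)).toLinearMap x = x := by
  induction x using tm_induction with
  | h0 => simp
  | ha x y hx hy => simp only [map_add, hx, hy]
  | ht m n => simp

theorem bijective_map {M N P Q : HopfBimodule A} {f : Hom M P} {k : Hom N Q}
    (hf : Function.Bijective f.toLinearMap) (hk : Function.Bijective k.toLinearMap) :
    Function.Bijective (Hom.map f k).toLinearMap := by
  obtain ⟨f', hf₁, hf₂⟩ := f.exists_inverse hf
  obtain ⟨k', hk₁, hk₂⟩ := k.exists_inverse hk
  refine Function.bijective_iff_has_inverse.2 ⟨(Hom.map f' k').toLinearMap, fun x => ?_, fun x => ?_⟩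
  · induction x using tm_induction with
    | h0 => simp
    | ha x y hx hy => simp only [map_add, hx, hy]
    | ht m n => simp [hf₁, hk₁]
  · induction x using tm_induction with
    | h0 => simp
    | ha x y hx hy => simp only [map_add, hx, hy]
    | ht m n => simp [hf₂, hk₂]

theorem bijective_assoc (M N P : HopfBimodule A) :
    Function.Bijective (Hom.assoc M N P).toLinearMap ∧
      Function.Bijective (Hom.assocInv M N P).toLinearMap := by
  have h₁ : ∀ x, (Hom.assocInv M N P).toLinearMap ((Hom.assoc M N P).toLinearMap x) = x := by
    intro x
    induction x using tm_induction with
    | h0 => simp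
    | ha x y hx hy => simp only [map_add, hx, hy]
    | ht x p =>
      induction x using tm_induction with
      | h0 => simp
      | ha x y hx hy => simp only [map_add, LinearMap.add_apply, hx, hy]
      | ht m n => simp
  have h₂ : ∀ x, (Hom.assoc M N P).toLinearMap ((Hom.assocInv M N P).toLinearMap x) = x := by
    intro x
    induction x using tm_induction with
    | h0 => simp
    | ha x y hx hy => simp only [map_add, hx, hy]
    | ht m x =>
      induction x using tm_induction with
      | h0 => simp
      | ha x y hx hy => simp only [map_add, LinearMap.add_apply, hx, hy]
      | ht m n => simp
  exact ⟨Function.bijective_iff_has_inverse.2 ⟨_, h₁, h₂⟩,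
    Function.bijective_iff_has_inverse.2 ⟨_, h₂, h₁⟩⟩

theorem bijective_id (M : HopfBimodule A) : Function.Bijective (Hom.id M).toLinearMap :=
  Function.bijective_id

theorem Hom.mem_hopfEnd {M : HopfBimodule A} {f : Hom M M} (hf : IsBicomoduleMap M M f.toLinearMap) :
    f.toLinearMap ∈ hopfEnd M := ⟨hf, f.lin_lsmul, f.lin_rsmul⟩

/-- `σ_i` for the sign `+` and its inverse for the sign `-`. -/
def sigmaEnd (Γ : HopfBimodule A) (k : ℕ) (s : Sgn) (i : ℕ) : Module.End ℂ (tpow Γ k) :=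
  match s with
  | .plus => (sigmaAt Γ k i).toLinearMap
  | .minus => Ring.inverse ((sigmaAt Γ k i).toLinearMap : Module.End ℂ (tpow Γ k))

theorem sigmaPM_eq (Γ : HopfBimodule A) (k : ℕ) (s : Sgn) (i : Fin (k - 1)) :
    sigmaPM Γ k s i = sigmaEnd Γ k s i := by
  cases s <;> rfl

theorem antisym_eq (Γ : HopfBimodule A) (k : ℕ) (s : Sgn) :
    antisym Γ k s = ∑ π : Equiv.Perm (Fin k), wordProd (fun i => -sigmaEnd Γ k s i) π :=
  Finset.sum_congr rfl fun π _ => signedSigma_eq Γ k s (fun i => by rw [sigmaPM_eq]) π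

/-- The antisymmetriser on the first `k` factors of `Γ^{⊗ k+1}`. -/
def antisymFirst (Γ : HopfBimodule A) (k : ℕ) (s : Sgn) : Module.End ℂ (tpow Γ (k + 1)) :=
  ∑ v : Equiv.Perm (Fin k), wordProd (fun i => -sigmaEnd Γ (k + 1) s (i + 0)) v

/-- The antisymmetriser on the last `k` factors of `Γ^{⊗ k+1}`. -/
def antisymLast (Γ : HopfBimodule A) (k : ℕ) (s : Sgn) : Module.End ℂ (tpow Γ (k + 1)) :=
  ∑ v : Equiv.Perm (Fin k), wordProd (fun i => -sigmaEnd Γ (k + 1) s (i + 1)) v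

theorem isShuffle_zero {k : ℕ} {π : Equiv.Perm (Fin k)} (h : IsShuffle 0 π) : π = 1 :=
  eq_one_of_strictMono fun a b hab => h.2 a b hab (Nat.zero_le _)

/-- A permutation increasing on all places is the identity. In equal degrees the contraction
therefore contains only the antisymmetriser. -/
theorem shuffleSum_zero (Γ : HopfBimodule A) (k : ℕ) (s : Sgn) : shuffleSum Γ 0 k s = 1 := by
  classical
  rw [shuffleSum, Finset.sum_eq_single 1]
  · rw [signedSigma_eq Γ k s (t := fun i => -sigmaEnd Γ k s i) (fun i => by rw [sigmaPM_eq]),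
      wordProd_one]
  · intro π hπ h
    exact absurd (inv_eq_one.1 (isShuffle_zero (Finset.mem_filter.1 hπ).2)) h
  · intro h
    refine absurd (Finset.mem_filter.2 ⟨Finset.mem_univ _, ?_⟩) h
    exact ⟨fun a b _ h => absurd h (Nat.not_lt_zero _), fun a b h _ => by simpa using h⟩

theorem antisym_one (Γ : HopfBimodule A) (s : Sgn) : antisym Γ 1 s = 1 := by
  rw [antisym_eq, Fintype.sum_subsingleton _ (1 : Equiv.Perm (Fin 1)), wordProd_one]

theorem antisym_zero (Γ : HopfBimodule A) (s : Sgn) : antisym Γ 0 s = 1 := by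
  rw [antisym_eq, Fintype.sum_subsingleton _ (1 : Equiv.Perm (Fin 0)), wordProd_one]

/-- The second block has a single place and imposes no condition. -/
theorem isShuffle_iff_first {k : ℕ} (π : Equiv.Perm (Fin (k + 1))) :
    IsShuffle k π ↔ StrictMono fun a => π (block k 0 (k + 1) (by omega) a) := by
  constructor
  · intro h a b hab
    exact h.1 _ _ (Fin.lt_def.2 (by simpa [val_block] using hab)) (by simp [val_block])
  · intro h
    refine ⟨fun a b hab hb => ?_, fun a b hab ha => ?_⟩
    · have := @h ⟨a, by rw [Fin.lt_def] at hab; omega⟩ ⟨b, hb⟩ hab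
      exact this
    · rw [Fin.lt_def] at hab; omega

theorem isShuffle_iff_last {k : ℕ} (π : Equiv.Perm (Fin (k + 1))) :
    IsShuffle 1 π ↔ StrictMono fun a => π (block k 1 (k + 1) (by omega) a) := by
  constructor
  · intro h a b hab
    exact h.2 _ _ (Fin.lt_def.2 (by simpa [val_block] using hab)) (by simp [val_block])
  · intro h
    refine ⟨fun a b hab hb => ?_, fun a b hab ha => ?_⟩
    · rw [Fin.lt_def] at hab; omega
    · rw [Fin.lt_def] at hab
      have := @h ⟨a - 1, by omega⟩ ⟨b - 1, by omega⟩ (Fin.lt_def.2 (by simp only; omega))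
      have ha' : block k 1 (k + 1) (by omega) ⟨a - 1, by omega⟩ = a :=
        Fin.ext (by rw [val_block]; simp only; omega)
      have hb' : block k 1 (k + 1) (by omega) ⟨b - 1, by omega⟩ = b :=
        Fin.ext (by rw [val_block]; simp only; omega)
      simp only [ha', hb'] at this
      exact this

/-- An intertwiner for the generators intertwines all word products. This transports
antisymmetrisers through tensoring with a form and through contraction with a form. -/
theorem wordProd_intertwine {V W : Type*} [AddCommGroup V] [AddCommGroup W] [Module ℂ V]
    [Module ℂ W] {k : ℕ} {T : ℕ → Module.End ℂ V} {T' : ℕ → Module.End ℂ W} (f : V →ₗ[ℂ] W)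
    (h : ∀ i, i + 1 < k → ∀ x, f (T i x) = T' i (f x)) (x : V) :
    f ((∑ π : Equiv.Perm (Fin k), wordProd T π) x) =
      (∑ π : Equiv.Perm (Fin k), wordProd T' π) (f x) := by
  have h₁ : ∀ (π : Equiv.Perm (Fin k)) x, f (wordProd T π x) = wordProd T' π (f x) := by
    intro π
    simp only [wordProd]
    generalize reducedWord π = w
    induction w with
    | nil => simp
    | cons i w ih => intro x; simp [h i (by omega), ih]
  simp only [LinearMap.sum_apply, map_sum, h₁]

namespace Frame

variable {Γ : HopfBimodule A}

theorem bijective_braidLast (F : Frame Γ) (hS : Function.Bijective (𝓢)) (T : HopfBimodule A) :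
    Function.Bijective (braidLast T Γ).toLinearMap :=
  (bijective_assoc T Γ Γ).2.comp
    ((bijective_map (bijective_id T) (F.bijective_braiding hS)).comp (bijective_assoc T Γ Γ).1)

theorem isBicomoduleMap_braidLast (F : Frame Γ) (T : HopfBimodule A) :
    IsBicomoduleMap _ _ (braidLast T Γ).toLinearMap :=
  ((IsBicomoduleMap.assoc T Γ Γ).andThen
    (IsBicomoduleMap.map (f := Hom.id T) IsBicomoduleMap.id F.isBicomoduleMap_braiding)).andThen
    (IsBicomoduleMap.assocInv T Γ Γ)

theorem bijective_sigmaAt (F : Frame Γ) (hS : Function.Bijective (𝓢)) (k i : ℕ) :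
    Function.Bijective (sigmaAt Γ k i).toLinearMap := by
  induction k with
  | zero => exact bijective_id _
  | succ k ih =>
    match k with
    | 0 => exact bijective_id _
    | k + 1 =>
      by_cases h : i = k
      · subst h
        rw [sigmaAt_last]
        exact F.bijective_braidLast hS _
      · rw [sigmaAt_of_ne Γ h]
        exact bijective_map ih (bijective_id Γ)

theorem isBicomoduleMap_sigmaAt (F : Frame Γ) (k i : ℕ) :
    IsBicomoduleMap _ _ (sigmaAt Γ k i).toLinearMap := by
  induction k with
  | zero => exact IsBicomoduleMap.id
  | succ k ih =>
    match k with
    | 0 => exact IsBicomoduleMap.id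
    | k + 1 =>
      by_cases h : i = k
      · subst h
        rw [sigmaAt_last]
        exact F.isBicomoduleMap_braidLast _
      · rw [sigmaAt_of_ne Γ h]
        exact ih.map (k := Hom.id Γ) IsBicomoduleMap.id

theorem isUnit_sigmaAt (F : Frame Γ) (hS : Function.Bijective (𝓢)) (k i : ℕ) :
    IsUnit ((sigmaAt Γ k i).toLinearMap : Module.End ℂ (tpow Γ k)) :=
  (Module.End.isUnit_iff _).2 (F.bijective_sigmaAt hS k i)

theorem sigmaEnd_mul (F : Frame Γ) (hS : Function.Bijective (𝓢)) (k i : ℕ) :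
    sigmaEnd Γ k .plus i * sigmaEnd Γ k .minus i = 1 :=
  Ring.mul_inverse_cancel _ (F.isUnit_sigmaAt hS k i)

theorem sigmaEnd_mul' (F : Frame Γ) (hS : Function.Bijective (𝓢)) (k i : ℕ) :
    sigmaEnd Γ k .minus i * sigmaEnd Γ k .plus i = 1 :=
  Ring.inverse_mul_cancel _ (F.isUnit_sigmaAt hS k i)

theorem sigmaEnd_mem (F : Frame Γ) (hS : Function.Bijective (𝓢)) (k : ℕ) (s : Sgn) (i : ℕ) :
    sigmaEnd Γ k s i ∈ hopfEnd (tpow Γ k) := by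
  have h := Hom.mem_hopfEnd (F.isBicomoduleMap_sigmaAt k i)
  cases s with
  | plus => exact h
  | minus => exact hopfEnd_inverse h (F.sigmaEnd_mul hS k i) (F.sigmaEnd_mul' hS k i)

theorem antisym_mem (F : Frame Γ) (hS : Function.Bijective (𝓢)) (k : ℕ) (s : Sgn) :
    antisym Γ k s ∈ hopfEnd (tpow Γ k) := by
  rw [antisym_eq]
  exact sum_mem fun π _ => wordProd_mem _ (fun i _ => neg_mem (F.sigmaEnd_mem hS k s i)) π

theorem shuffleSum_mem (F : Frame Γ) (hS : Function.Bijective (𝓢)) (i k : ℕ) (s : Sgn) :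
    shuffleSum Γ i k s ∈ hopfEnd (tpow Γ k) := by
  refine sum_mem fun π _ => ?_
  rw [signedSigma_eq Γ k s (t := fun i => -sigmaEnd Γ k s i) (fun i => by rw [sigmaPM_eq])]
  exact wordProd_mem _ (fun i _ => neg_mem (F.sigmaEnd_mem hS k s i)) π

/-- Induction on the number of factors: relations not involving the last factor are inherited. The
remaining braid relation is `braid_equation`, and the remaining commutation relations are between
operators on separate factors. -/
theorem braidRelations_plus (F : Frame Γ) (k : ℕ) :
    BraidRelations k (sigmaEnd Γ k .plus) := by
  induction k with
  | zero => exact ⟨fun i h => by omega, fun i j h h' => by omega⟩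
  | succ k ih =>
    have hlift : ∀ i, i + 1 < k → ∀ x ρ, sigmaEnd Γ (k + 1) .plus i (tapp Γ k x ρ) =
        tapp Γ k (sigmaEnd Γ k .plus i x) ρ := fun i hi x ρ => sigmaAt_tapp Γ hi x ρ
    constructor
    · intro i hi
      by_cases h : i + 2 < k
      · refine tapp_ext fun x ρ => ?_
        have := LinearMap.congr_fun (ih.braid i h) x
        simp only [Module.End.mul_apply] at this ⊢
        rw [hlift i (by omega), hlift (i + 1) (by omega), hlift i (by omega),
          hlift (i + 1) (by omega), hlift i (by omega), hlift (i + 1) (by omega), this]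
      -- The braid relation of the last three factors.
      · obtain rfl : k = i + 2 := by omega
        have h₁ : sigmaEnd Γ (i + 2 + 1) .plus i =
            (Hom.map (braidLast (tpow Γ i) Γ) (Hom.id Γ)).toLinearMap := by
          change (sigmaAt Γ (i + 1 + 2) i).toLinearMap = _
          rw [sigmaAt_of_ne Γ (by omega), sigmaAt_last]
          rfl
        have h₂ : sigmaEnd Γ (i + 2 + 1) .plus (i + 1) =
            (braidLast (tensor (tpow Γ i) Γ) Γ).toLinearMap := by
          change (sigmaAt Γ (i + 1 + 2) (i + 1)).toLinearMap = _
          rw [sigmaAt_last]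
          rfl
        rw [h₁, h₂]
        exact LinearMap.ext fun x => (F.braid_equation (tpow Γ i) x).symm
    · intro i j hij hj
      by_cases h : j + 1 < k
      · refine tapp_ext fun x ρ => ?_
        have := LinearMap.congr_fun (ih.comm i j hij h) x
        simp only [Module.End.mul_apply] at this ⊢
        rw [hlift j h, hlift i (by omega), hlift i (by omega), hlift j h, this]
      -- Here `σ_j` acts on the last two factors and `σ_i` only on the factors before them.
      · obtain rfl : k = j + 1 := by omega
        have h₁ : sigmaEnd Γ (j + 1 + 1) .plus j =
            (braidLast (tpow Γ j) Γ).toLinearMap := by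
          change (sigmaAt Γ (j + 2) j).toLinearMap = _
          rw [sigmaAt_last]
        obtain ⟨n, rfl⟩ : ∃ n, j = n + 1 := ⟨j - 1, by omega⟩
        have h₂ : sigmaEnd Γ (n + 1 + 1 + 1) .plus i =
            (Hom.map (Hom.map (sigmaAt Γ (n + 1) i) (Hom.id Γ)) (Hom.id Γ)).toLinearMap := by
          change (sigmaAt Γ (n + 1 + 2) i).toLinearMap = _
          rw [sigmaAt_of_ne Γ (by omega), sigmaAt_of_ne Γ (by omega)]
          rfl
        rw [h₁, h₂]
        refine LinearMap.ext fun x => ?_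
        have hcomm : ∀ x : tensor (tensor (tpow Γ (n + 1)) Γ) Γ,
            (Hom.map (Hom.map (sigmaAt Γ (n + 1) i) (Hom.id Γ)) (Hom.id Γ)).toLinearMap
              ((braidLast (tpow Γ (n + 1)) Γ).toLinearMap x) =
            (braidLast (tpow Γ (n + 1)) Γ).toLinearMap
              ((Hom.map (Hom.map (sigmaAt Γ (n + 1) i) (Hom.id Γ)) (Hom.id Γ)).toLinearMap x) := by
          intro x
          induction x using assocInv_induction with
          | h0 => simp
          | ha x y hx hy => simp only [map_add, hx, hy]
          | ht m x => rw [braidLast_assocInv, map_assocInv, map_assocInv, braidLast_assocInv,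
              map_id_id, map_id_id]
        exact hcomm x

theorem braidRelations (F : Frame Γ) (hS : Function.Bijective (𝓢)) (k : ℕ) (s : Sgn) :
    BraidRelations k (fun i => -sigmaEnd Γ k s i) := by
  cases s with
  | plus => exact (F.braidRelations_plus k).neg
  | minus => exact ((F.braidRelations_plus k).inverse (F.sigmaEnd_mul hS k)
      (F.sigmaEnd_mul' hS k)).neg

/-- An intertwiner for `σ` is also one for `σ⁻¹`. -/
theorem sigmaEnd_intertwine {Λ : HopfBimodule A} (F : Frame Γ) (G : Frame Λ)
    (hS : Function.Bijective (𝓢)) {k l i j : ℕ} (f : tpow Γ k →ₗ[ℂ] tpow Λ l)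
    (h : ∀ x, f ((sigmaAt Γ k i).toLinearMap x) = (sigmaAt Λ l j).toLinearMap (f x)) (s : Sgn)
    (x : tpow Γ k) : f (sigmaEnd Γ k s i x) = sigmaEnd Λ l s j (f x) := by
  cases s with
  | plus => exact h x
  | minus =>
    apply (G.bijective_sigmaAt hS l j).1
    rw [← h]
    have h₁ := LinearMap.congr_fun (F.sigmaEnd_mul hS k i) x
    have h₂ := LinearMap.congr_fun (G.sigmaEnd_mul hS l j) (f x)
    exact (congrArg f h₁).trans h₂.symm

theorem antisymFirst_tapp (F : Frame Γ) (hS : Function.Bijective (𝓢)) (k : ℕ) (s : Sgn)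
    (x : tpow Γ k) (ρ : Γ) : antisymFirst Γ k s (tapp Γ k x ρ) =
      tapp Γ k (antisym Γ k s x) ρ := by
  rw [antisym_eq]
  refine (wordProd_intertwine ((tapp Γ k).flip ρ) (fun i hi y => ?_) x).symm
  have := F.sigmaEnd_intertwine (k := k) (l := k + 1) F hS ((tapp Γ k).flip ρ)
    (fun x => (sigmaAt_tapp Γ hi x ρ).symm) s y
  rw [LinearMap.neg_apply, map_neg, this]
  rfl

/-- The coset factorisation for the block of the first `k` places; the shuffle condition on `π⁻¹`
singles out the minimal representatives. -/
theorem antisym_succ_first (F : Frame Γ) (hS : Function.Bijective (𝓢)) (k : ℕ) (s : Sgn) :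
    antisym Γ (k + 1) s = antisymFirst Γ k s * shuffleSum Γ k (k + 1) s := by
  classical
  rw [antisym_eq, (F.braidRelations hS (k + 1) s).sum_wordProd (k := k) (o := 0) (by omega)]
  congr 1
  refine Finset.sum_congr ?_ fun π _ =>
    (signedSigma_eq Γ (k + 1) s (fun i => by rw [sigmaPM_eq]) π).symm
  ext π
  simp only [Finset.mem_filter, Finset.mem_univ, true_and, isShuffle_iff_first]

theorem antisym_succ_last (F : Frame Γ) (hS : Function.Bijective (𝓢)) (k : ℕ) (s : Sgn) :
    antisym Γ (k + 1) s = antisymLast Γ k s * shuffleSum Γ 1 (k + 1) s := by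
  classical
  rw [antisym_eq, (F.braidRelations hS (k + 1) s).sum_wordProd (k := k) (o := 1) (by omega)]
  congr 1
  refine Finset.sum_congr ?_ fun π _ =>
    (signedSigma_eq Γ (k + 1) s (fun i => by rw [sigmaPM_eq]) π).symm
  ext π
  simp only [Finset.mem_filter, Finset.mem_univ, true_and, isShuffle_iff_last]

/-- With the antisymmetriser of fewer factors on the right, its kernel lies in that of `A_{k+1}`.
This makes the exterior product well defined. -/
theorem exists_antisym_eq_mul_first (F : Frame Γ) (hS : Function.Bijective (𝓢)) (k : ℕ) (s : Sgn) :
    ∃ Z, antisym Γ (k + 1) s = Z * antisymFirst Γ k s := by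
  rw [antisym_eq]
  exact (F.braidRelations hS (k + 1) s).sum_wordProd_right (k := k) (o := 0) (by omega)

theorem exists_antisym_eq_mul_last (F : Frame Γ) (hS : Function.Bijective (𝓢)) (k : ℕ) (s : Sgn) :
    ∃ Z, antisym Γ (k + 1) s = Z * antisymLast Γ k s := by
  rw [antisym_eq]
  exact (F.braidRelations hS (k + 1) s).sum_wordProd_right (k := k) (o := 1) (by omega)

/-- `A_k^+ = T_{w₀} A_k^-`, where `T_{w₀}` is the invertible word product of the longest
permutation. Hence the quotient by `ker A_k^+` also serves the contractions with the sign `-`. -/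
theorem ker_antisym (F : Frame Γ) (hS : Function.Bijective (𝓢)) (k : ℕ) (s : Sgn) :
    LinearMap.ker (antisym Γ k s) = LinearMap.ker (antisym Γ k .plus) := by
  cases s with
  | plus => rfl
  | minus =>
    have h := (F.braidRelations hS k .plus).sum_inverse (F.braidRelations hS k .minus)
      (fun i _ => by rw [neg_mul_neg, F.sigmaEnd_mul hS])
    have hu : IsUnit (wordProd (fun i => -sigmaEnd Γ k .plus i)
        (Fin.revPerm : Equiv.Perm (Fin k))) := by
      have h₁ := (F.braidRelations hS k .minus).wordProd_mul_wordProd_inv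
        (T := fun i => -sigmaEnd Γ k .plus i)
        (fun i _ => by rw [neg_mul_neg, F.sigmaEnd_mul hS]) Fin.revPerm
      have h₂ := (F.braidRelations hS k .plus).wordProd_mul_wordProd_inv
        (T := fun i => -sigmaEnd Γ k .minus i)
        (fun i _ => by rw [neg_mul_neg, F.sigmaEnd_mul' hS]) (Fin.revPerm : Equiv.Perm (Fin k))⁻¹
      rw [inv_inv] at h₂
      exact ⟨⟨_, _, h₁, h₂⟩, rfl⟩
    rw [← antisym_eq, ← antisym_eq] at h
    rw [← h]
    ext x
    rw [LinearMap.mem_ker, LinearMap.mem_ker, Module.End.mul_apply]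
    constructor
    · intro hx
      rw [hx, map_zero]
    · intro hx
      exact ((Module.End.isUnit_iff _).1 hu).1 (hx.trans (map_zero _).symm)

end Frame

/-! ## Contractions of tensors -/

section TensorZero

variable (Γ : HopfBimodule A)

/-- An element of `A` as an element of `Γ^{⊗ 0}`. -/
def tzero : A →ₗ[ℂ] (tpow Γ 0).carrier := (LinearMap.id : A →ₗ[ℂ] A)

/-- An element of `Γ^{⊗ 0}` as an element of `A`. -/
def fromZero : (tpow Γ 0).carrier →ₗ[ℂ] A := (LinearMap.id : A →ₗ[ℂ] A)

theorem tzero_surjective (x : tpow Γ 0) : ∃ a, tzero Γ a = x := ⟨x, rfl⟩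

theorem lsmul_tzero (a b : A) : (tpow Γ 0).lsmul a (tzero Γ b) = tzero Γ (a * b) := rfl

theorem rsmul_tzero (a b : A) : (tpow Γ 0).rsmul a (tzero Γ b) = tzero Γ (b * a) := rfl

theorem tapp_tzero (a : A) (ρ : Γ) :
    tapp Γ 0 (tzero Γ a) ρ = tapp Γ 0 (tzero Γ 1) (Γ.lsmul a ρ) := by
  rw [← tapp_rsmul, rsmul_tzero, one_mul]

/-- `Γ^{⊗ 1}` is `A ⊗_A Γ`, in which every element has the form `1 ⊗ ρ`. -/
theorem tone_induction {p : (tpow Γ 1).carrier → Prop}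
    (h : ∀ ρ, p (tapp Γ 0 (tzero Γ 1) ρ)) (x) : p x := by
  have : ∃ ρ, tapp Γ 0 (tzero Γ 1) ρ = x := by
    induction x using tapp_induction with
    | h0 => exact ⟨0, by simp⟩
    | ht x ρ =>
      obtain ⟨a, rfl⟩ := tzero_surjective Γ x
      exact ⟨_, (tapp_tzero Γ a ρ).symm⟩
    | ha x y hx hy =>
      obtain ⟨ρ, rfl⟩ := hx
      obtain ⟨ρ', rfl⟩ := hy
      exact ⟨ρ + ρ', map_add _ _ _⟩
  obtain ⟨ρ, rfl⟩ := this
  exact h ρ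

theorem toA_lsmul {M : HopfBimodule A} (f : Hom M (unit A)) (a : A) (x : M) :
    f.toA (M.lsmul a x) = a * f.toA x := f.lin_lsmul a x

theorem toA_rsmul {M : HopfBimodule A} (f : Hom M (unit A)) (a : A) (x : M) :
    f.toA (M.rsmul a x) = f.toA x * a := f.lin_rsmul a x

end TensorZero

/-! ### Tensoring with a form from the left -/

section LeftApp

variable {Γ : HopfBimodule A}

/-- `lapp n ρ ζ` is the element `ρ ⊗ ζ` of `Γ^{⊗ n+1}`. -/
def lapp (Γ : HopfBimodule A) (n : ℕ) : Γ →ₗ[ℂ] tpow Γ n →ₗ[ℂ] (tpow Γ (n + 1)).carrier :=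
  ((tm (tpow Γ 1) (tpow Γ n)).compr₂
    (tmulHom Γ n 1 (n + 1) (Nat.add_comm n 1)).toLinearMap) ∘ₗ tapp Γ 0 (tzero Γ 1)

theorem lapp_zero (ρ : Γ) (a : A) :
    lapp Γ 0 ρ (tzero Γ a) = tapp Γ 0 (tzero Γ 1) (Γ.rsmul a ρ) := by
  rw [← rsmul_tapp]
  exact Hom.runit_tm a (tapp Γ 0 (tzero Γ 1) ρ)

theorem lapp_assocInv (n : ℕ) (ρ : Γ) (z : tpow Γ n) (η : Γ) :
    lapp Γ (n + 1) ρ (tapp Γ n z η) = tapp Γ (n + 1) (lapp Γ n ρ z) η := by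
  change (Hom.map _ (Hom.id Γ)).toLinearMap ((Hom.assocInv (tpow Γ 1) (tpow Γ n) Γ).toLinearMap
    (tm (tpow Γ 1) (tensor (tpow Γ n) Γ) _ (tm (tpow Γ n) Γ z η))) = _
  rw [Hom.assocInv_tm, Hom.map_tm]
  rfl

/-- `tapp₂ n t y` is the element `t ⊗ y` of `Γ^{⊗ n+2}` for `y ∈ Γ ⊗ Γ`. -/
def tapp₂ (Γ : HopfBimodule A) (n : ℕ) :
    tpow Γ n →ₗ[ℂ] (tensor Γ Γ).carrier →ₗ[ℂ] (tpow Γ (n + 2)).carrier :=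
  (tm (tpow Γ n) (tensor Γ Γ)).compr₂ (Hom.assocInv (tpow Γ n) Γ Γ).toLinearMap

theorem tapp₂_tm (n : ℕ) (t : tpow Γ n) (ρ ρ' : Γ) :
    tapp₂ Γ n t (tm Γ Γ ρ ρ') = tapp Γ (n + 1) (tapp Γ n t ρ) ρ' :=
  Hom.assocInv_tm _ _ _

theorem tapp₂_induction {n : ℕ} {p : (tpow Γ (n + 2)).carrier → Prop} (h0 : p 0)
    (ht : ∀ (t : tpow Γ n) (y : tensor Γ Γ), p (tapp₂ Γ n t y))
    (ha : ∀ x y, p x → p y → p (x + y)) (x) : p x :=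
  assocInv_induction (M := tpow Γ n) (N := Γ) (P := Γ) h0 ht ha x

theorem sigmaAt_tapp₂ (n : ℕ) (t : tpow Γ n) (y : tensor Γ Γ) :
    (sigmaAt Γ (n + 2) n).toLinearMap (tapp₂ Γ n t y) =
      tapp₂ Γ n t ((HopfBimodule.braiding Γ Γ).toLinearMap y) := by
  rw [sigmaAt_last]
  exact braidLast_assocInv _ _ _ _

theorem lapp_tapp₂ (n : ℕ) (ρ : Γ) (t : tpow Γ n) (y : tensor Γ Γ) :
    lapp Γ (n + 2) ρ (tapp₂ Γ n t y) = tapp₂ Γ (n + 1) (lapp Γ n ρ t) y := by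
  induction y using tm_induction with
  | h0 => simp
  | ha x y hx hy => simp only [map_add, hx, hy]
  | ht m n => rw [tapp₂_tm, tapp₂_tm, lapp_assocInv, lapp_assocInv]

/-- The new factor occupies the place `0`, so all later positions shift by one. The induction peels
factors off at the end, where the tensor powers are built. -/
theorem sigmaAt_lapp (n : ℕ) {i : ℕ} (hi : i + 1 < n) (ρ : Γ) (z : tpow Γ n) :
    (sigmaAt Γ (n + 1) (i + 1)).toLinearMap (lapp Γ n ρ z) =
      lapp Γ n ρ ((sigmaAt Γ n i).toLinearMap z) := by
  induction n with
  | zero => omega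
  | succ n ih =>
    by_cases h : i + 1 < n
    · induction z using tapp_induction with
      | h0 => simp
      | ha x y hx hy => simp only [map_add, hx, hy]
      | ht z η =>
        rw [sigmaAt_tapp Γ h, lapp_assocInv, lapp_assocInv, sigmaAt_tapp Γ (by omega), ih h]
    · obtain rfl : n = i + 1 := by omega
      induction z using tapp₂_induction with
      | h0 => simp
      | ha x y hx hy => simp only [map_add, hx, hy]
      | ht t y => rw [sigmaAt_tapp₂, lapp_tapp₂, lapp_tapp₂, sigmaAt_tapp₂]

end LeftApp

/-! ### Contraction with the first tensor factor, and the full contraction in equal degrees -/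

section Peel

variable {Γ Λ : HopfBimodule A} (g : Hom (tensor Γ Λ) (unit A))

/-- `peelMap g n ρ (η ⊗ ζ) = g(ρ, η) ζ`. -/
def peelMap (n : ℕ) : Γ →ₗ[ℂ] tpow Λ (n + 1) →ₗ[ℂ] (tpow Λ n).carrier :=
  (tm Γ (tpow Λ (n + 1))).compr₂ (peel g n).toLinearMap

theorem peelMap_zero (ρ : Γ) (a : A) (η : Λ) :
    peelMap g 0 ρ (tapp Λ 0 (tzero Λ a) η) = tzero Λ (g.toA (tm Γ Λ ρ (Λ.lsmul a η))) := by
  change g.toLinearMap ((Hom.map (Hom.id Γ) (Hom.lunit Λ)).toLinearMap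
    (tm Γ (tensor (unit A) Λ) ρ (tm (unit A) Λ (ofA a) η))) = _
  rw [Hom.map_tm, Hom.lunit_tm]
  rfl

theorem peelMap_tapp (n : ℕ) (ρ : Γ) (z : tpow Λ (n + 1)) (η : Λ) :
    peelMap g (n + 1) ρ (tapp Λ (n + 1) z η) = tapp Λ n (peelMap g n ρ z) η := by
  change (Hom.map (peel g n) (Hom.id Λ)).toLinearMap
    ((Hom.assocInv Γ (tpow Λ (n + 1)) Λ).toLinearMap
      (tm Γ (tensor (tpow Λ (n + 1)) Λ) ρ (tm (tpow Λ (n + 1)) Λ z η))) = _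
  rw [Hom.assocInv_tm, Hom.map_tm]
  rfl

theorem peelMap_lsmul (n : ℕ) (ρ : Γ) (a : A) (z : tpow Λ (n + 1)) :
    peelMap g n (Γ.lsmul a ρ) z = (tpow Λ n).lsmul a (peelMap g n ρ z) := by
  simp only [peelMap, LinearMap.compr₂_apply, ← lsmul_tm, Hom.lin_lsmul]

theorem peelMap_rsmul (n : ℕ) (ρ : Γ) (a : A) (z : tpow Λ (n + 1)) :
    peelMap g n (Γ.rsmul a ρ) z = peelMap g n ρ ((tpow Λ (n + 1)).lsmul a z) := by
  simp only [peelMap, LinearMap.compr₂_apply, tm_rsmul]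

theorem peelMap_lapp (n : ℕ) (ρ : Γ) (η : Λ) (z : tpow Λ n) :
    peelMap g n ρ (lapp Λ n η z) = (tpow Λ n).lsmul (g.toA (tm Γ Λ ρ η)) z := by
  induction n with
  | zero =>
    obtain ⟨a, rfl⟩ := tzero_surjective Λ z
    rw [lapp_zero, peelMap_zero, Λ.one_lsmul, ← rsmul_tm, toA_rsmul, lsmul_tzero]
  | succ n ih =>
    induction z using tapp_induction with
    | h0 => simp
    | ha x y hx hy => simp only [map_add, hx, hy]
    | ht z β => rw [lapp_assocInv, peelMap_tapp, ih, lsmul_tapp]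

theorem peelMap_tapp₂ (n : ℕ) (ρ : Γ) (t : tpow Λ (n + 1)) (y : tensor Λ Λ) :
    peelMap g (n + 2) ρ (tapp₂ Λ (n + 1) t y) = tapp₂ Λ n (peelMap g n ρ t) y := by
  induction y using tm_induction with
  | h0 => simp
  | ha x y hx hy => simp only [map_add, hx, hy]
  | ht m n => rw [tapp₂_tm, tapp₂_tm, peelMap_tapp, peelMap_tapp]

/-- Contraction uses up the factor number `0`, so a braiding away from it survives with its position
lowered by one. -/
theorem peelMap_sigmaAt (n : ℕ) {i : ℕ} (hi : i + 1 < n) (ρ : Γ) (z : tpow Λ (n + 1)) :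
    peelMap g n ρ ((sigmaAt Λ (n + 1) (i + 1)).toLinearMap z) =
      (sigmaAt Λ n i).toLinearMap (peelMap g n ρ z) := by
  induction n with
  | zero => omega
  | succ n ih =>
    by_cases h : i + 1 < n
    · induction z using tapp_induction with
      | h0 => simp
      | ha x y hx hy => simp only [map_add, hx, hy]
      | ht z η =>
        rw [sigmaAt_tapp Λ (by omega), peelMap_tapp, peelMap_tapp, sigmaAt_tapp Λ h, ih h]
    · obtain rfl : n = i + 1 := by omega
      induction z using tapp₂_induction with
      | h0 => simp
      | ha x y hx hy => simp only [map_add, hx, hy]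
      | ht t y => rw [sigmaAt_tapp₂, peelMap_tapp₂, peelMap_tapp₂, sigmaAt_tapp₂]

/-- `peelMap₂ g n (ρ ⊗ ρ') ζ = peelMap ρ (peelMap ρ' ζ)`. -/
def peelMap₂ (n : ℕ) : (tensor Γ Γ).carrier →ₗ[ℂ] tpow Λ (n + 2) →ₗ[ℂ] (tpow Λ n).carrier :=
  tensorLift
    (LinearMap.mk₂ ℂ (fun ρ ρ' => peelMap g n ρ ∘ₗ peelMap g (n + 1) ρ')
      (by intros; ext; simp) (by intros; ext; simp) (by intros; ext; simp)
      (by intros; ext; simp))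
    (by
      intro ρ a ρ'
      ext z
      simp only [LinearMap.mk₂_apply, LinearMap.comp_apply, peelMap_rsmul, peelMap_lsmul])

theorem peelMap₂_tm (n : ℕ) (ρ ρ' : Γ) (z : tpow Λ (n + 2)) :
    peelMap₂ g n (tm Γ Γ ρ ρ') z = peelMap g n ρ (peelMap g (n + 1) ρ' z) := by
  rw [peelMap₂, tensorLift_tm]
  rfl

theorem peelMap₂_tapp (n : ℕ) (y : tensor Γ Γ) (z : tpow Λ (n + 2)) (η : Λ) :
    peelMap₂ g (n + 1) y (tapp Λ (n + 2) z η) = tapp Λ n (peelMap₂ g n y z) η := by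
  induction y using tm_induction with
  | h0 => simp
  | ha x y hx hy => simp only [map_add, LinearMap.add_apply, hx, hy]
  | ht ρ ρ' => rw [peelMap₂_tm, peelMap₂_tm, peelMap_tapp, peelMap_tapp]

/-- The extension of `g` to `Γ^{⊗ k} × Λ^{⊗ k} → A`. -/
def bracket (k : ℕ) : tpow Γ k →ₗ[ℂ] tpow Λ k →ₗ[ℂ] A :=
  (tm (tpow Γ k) (tpow Λ k)).compr₂
    (fromZero Γ ∘ₗ (gtildeL g k k 0 (Nat.zero_add k).symm).toLinearMap)

theorem bracket_zero (a b : A) : bracket g 0 (tzero Γ a) (tzero Λ b) = a * b :=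
  congrArg (fromZero Γ) (Hom.runit_tm (M := tpow Γ 0) b (tzero Γ a))

theorem bracket_succ (k : ℕ) (x : tpow Γ k) (ρ : Γ) (z : tpow Λ (k + 1)) :
    bracket g (k + 1) (tapp Γ k x ρ) z = bracket g k x (peelMap g k ρ z) := by
  change fromZero Γ ((gtildeL g k k 0 _).toLinearMap
    ((Hom.map (Hom.id (tpow Γ k)) (peel g k)).toLinearMap
      ((Hom.assoc (tpow Γ k) Γ (tpow Λ (k + 1))).toLinearMap
        (tm (tensor (tpow Γ k) Γ) (tpow Λ (k + 1)) (tm (tpow Γ k) Γ x ρ) z)))) = _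
  rw [Hom.assoc_tm, Hom.map_tm]
  rfl

theorem bracket_lsmul (k : ℕ) (a : A) (x : tpow Γ k) (z : tpow Λ k) :
    bracket g k ((tpow Γ k).lsmul a x) z = a * bracket g k x z := by
  simp only [bracket, LinearMap.compr₂_apply, LinearMap.comp_apply, ← lsmul_tm, Hom.lin_lsmul]
  rfl

theorem bracket_apply_rsmul (k : ℕ) (a : A) (x : tpow Γ k) (z : tpow Λ k) :
    bracket g k x ((tpow Λ k).rsmul a z) = bracket g k x z * a := by
  simp only [bracket, LinearMap.compr₂_apply, LinearMap.comp_apply, ← rsmul_tm, Hom.lin_rsmul]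
  rfl

/-- Contractions are nested: neighbouring factors are contracted first, and the outermost factors
`ρ` and `η` meet last, with the value of the inner contraction between them. -/
theorem bracket_lapp (k : ℕ) (ρ : Γ) (x : tpow Γ k) (z : tpow Λ k) (η : Λ) :
    bracket g (k + 1) (lapp Γ k ρ x) (tapp Λ k z η) =
      g.toA (tm Γ Λ (Γ.rsmul (bracket g k x z) ρ) η) := by
  induction k with
  | zero =>
    obtain ⟨a, rfl⟩ := tzero_surjective Γ x
    obtain ⟨b, rfl⟩ := tzero_surjective Λ z
    rw [lapp_zero, bracket_succ, peelMap_zero, bracket_zero, bracket_zero, one_mul, ← tm_rsmul,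
      Γ.mul_rsmul]
  | succ k ih =>
    induction x using tapp_induction with
    | h0 => simp
    | ha x y hx hy => simp only [map_add, LinearMap.add_apply, hx, hy]
    | ht x ρ' => rw [lapp_assocInv, bracket_succ, peelMap_tapp, ih, bracket_succ]

theorem bracket_tapp₂ (n : ℕ) (t : tpow Γ n) (y : tensor Γ Γ) (z : tpow Λ (n + 2)) :
    bracket g (n + 2) (tapp₂ Γ n t y) z = bracket g n t (peelMap₂ g n y z) := by
  induction y using tm_induction with
  | h0 => simp
  | ha x y hx hy => simp only [map_add, LinearMap.add_apply, hx, hy]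
  | ht ρ ρ' => rw [tapp₂_tm, bracket_succ, bracket_succ, peelMap₂_tm]

end Peel

/-! ### Adjointness of the braidings under the metric -/

namespace SigmaMetric

variable {Γ : Sgn → HopfBimodule A} (g : SigmaMetric Γ) {τ τ' : Sgn} (h : τ ≠ τ')

/-- The map `ρ ⊗ ρ' ⊗ η ⊗ η' ↦ g(ρ, g(ρ', η) η')`. -/
def nested : Hom (tensor (tensor (Γ τ) (Γ τ)) (tensor (Γ τ') (Γ τ'))) (unit A) :=
  ((Hom.assoc (Γ τ) (Γ τ) _).andThen (Hom.map (Hom.id (Γ τ))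
    ((Hom.assocInv (Γ τ) (Γ τ') (Γ τ')).andThen (g12 (g.g h) (Γ τ'))))).andThen (g.g h)

/-- The map `(g ⊗ g) (id ⊗ σ ⊗ id)`. -/
def crossed : Hom (tensor (tensor (Γ τ) (Γ τ)) (tensor (Γ τ') (Γ τ'))) (unit A) :=
  ((Hom.assoc (Γ τ) (Γ τ) _).andThen (Hom.map (Hom.id (Γ τ))
    ((((Hom.assocInv (Γ τ) (Γ τ') (Γ τ')).andThen
      (Hom.map (HopfBimodule.braiding (Γ τ) (Γ τ')) (Hom.id (Γ τ')))).andThen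
      (Hom.assoc (Γ τ') (Γ τ) (Γ τ'))).andThen (g23 (g.g h) (Γ τ'))))).andThen (g.g h)

theorem nested_tm (ρ ρ' : Γ τ) (η η' : Γ τ') :
    (g.nested h).toA (tm _ _ (tm _ _ ρ ρ') (tm _ _ η η')) =
      (g.g h).toA (tm _ _ ρ ((Γ τ').lsmul ((g.g h).toA (tm _ _ ρ' η)) η')) := by
  change (g.nested h).toLinearMap _ = _
  simp only [nested, Hom.andThen_lin, Hom.assoc_tm, Hom.map_tm, Hom.id_lin, Hom.assocInv_tm, g12,
    ← ofA_toA, Hom.lunit_tm]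
  rfl

/-- The inner part `g(ρ', η) η'` is `g_{12}`, which the second braid condition rewrites as `g_{23}
σ_{12} σ_{23}`. The `σ_{23}` acts on `η ⊗ η'` and the remainder is the crossed contraction. -/
theorem nested_braiding_right (y : tensor (Γ τ) (Γ τ)) (z : tensor (Γ τ') (Γ τ')) :
    (g.nested h).toA (tm _ _ y z) =
      (g.crossed h).toA (tm _ _ y ((HopfBimodule.braiding (Γ τ') (Γ τ')).toLinearMap z)) := by
  induction y using tm_induction with
  | h0 => simp
  | ha x y hx hy => simp only [map_add, LinearMap.add_apply, hx, hy]
  | ht ρ ρ' =>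
    change (g.nested h).toLinearMap _ = (g.crossed h).toLinearMap _
    simp only [nested, crossed, Hom.andThen_lin, Hom.assoc_tm, Hom.map_tm, Hom.id_lin]
    rw [← g.braid_right h τ']
    congr 3
    simp only [sigma12sigma23, Hom.andThen_lin]
    induction z using tm_induction with
    | h0 => simp
    | ha x y hx hy => simp only [map_add, hx, hy]
    | ht η η' => simp only [Hom.assocInv_tm, Hom.assoc_tm, Hom.map_tm, Hom.id_lin]

/-- The two contractions of the crossed form have disjoint arguments, so either one may be performed
first; the bimodule property of `g` moves the scalar factors. -/
theorem crossed_aux (ρ : Γ τ) (w : tensor (Γ τ') (Γ τ)) (η : Γ τ') :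
    (g.g h).toA (tm _ _ ρ ((g23 (g.g h) (Γ τ')).toLinearMap
      ((Hom.assoc (Γ τ') (Γ τ) (Γ τ')).toLinearMap (tm _ _ w η)))) =
    (g.g h).toA (tm _ _ ((g12 (g.g h) (Γ τ)).toLinearMap
      ((Hom.assocInv (Γ τ) (Γ τ') (Γ τ)).toLinearMap (tm _ _ ρ w))) η) := by
  induction w using tm_induction with
  | h0 => simp
  | ha x y hx hy => simp only [map_add, LinearMap.add_apply, hx, hy]
  | ht η' ρ' =>
    simp only [Hom.assoc_tm, Hom.assocInv_tm, g12, g23, Hom.andThen_lin, Hom.map_tm, Hom.id_lin,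
      ← ofA_toA, Hom.lunit_tm, Hom.runit_tm]
    rw [← rsmul_tm, toA_rsmul, ← lsmul_tm, toA_lsmul]

theorem sigma23sigma12_assoc (X Y Z : HopfBimodule A) (y : tensor X Y) (η : Z) :
    (sigma23sigma12 X Y Z).toLinearMap ((Hom.assoc X Y Z).toLinearMap (tm _ _ y η)) =
      (Hom.assocInv Y Z X).toLinearMap
        ((Hom.map (Hom.id Y) (HopfBimodule.braiding X Z)).toLinearMap
          ((Hom.assoc Y X Z).toLinearMap
            (tm _ _ ((HopfBimodule.braiding X Y).toLinearMap y) η))) := by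
  induction y using tm_induction with
  | h0 => simp
  | ha x y hx hy => simp only [map_add, LinearMap.add_apply, hx, hy]
  | ht ρ ρ' => simp only [sigma23sigma12, Hom.andThen_lin, Hom.assoc_tm, Hom.assocInv_tm,
      Hom.map_tm, Hom.id_lin]

/-- Symmetrically, `g(ρ, g(ρ', η) η') = g(ρ g(ρ', η), η')` contains `g_{23}`, which the first braid
condition rewrites as `g_{12} σ_{23} σ_{12}`. So a braiding on either side of the nested form leads
to the same crossed form. -/
theorem nested_braiding_left (y : tensor (Γ τ) (Γ τ)) (z : tensor (Γ τ') (Γ τ')) :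
    (g.nested h).toA (tm _ _ y z) =
      (g.crossed h).toA (tm _ _ ((HopfBimodule.braiding (Γ τ) (Γ τ)).toLinearMap y) z) := by
  induction z using tm_induction with
  | h0 => simp
  | ha x y hx hy => simp only [map_add, hx, hy]
  | ht η η' =>
    have h₁ : ∀ y : tensor (Γ τ) (Γ τ), (g.crossed h).toA (tm _ _ y (tm _ _ η η')) =
        (g.g h).toA (tm _ _ ((g12 (g.g h) (Γ τ)).toLinearMap
          ((Hom.assocInv (Γ τ) (Γ τ') (Γ τ)).toLinearMap
            ((Hom.map (Hom.id (Γ τ)) (HopfBimodule.braiding (Γ τ) (Γ τ'))).toLinearMap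
              ((Hom.assoc (Γ τ) (Γ τ) (Γ τ')).toLinearMap (tm _ _ y η))))) η') := by
      intro y
      induction y using tm_induction with
      | h0 => simp
      | ha x y hx hy => simp only [map_add, LinearMap.add_apply, hx, hy]
      | ht ρ ρ' =>
        rw [Hom.assoc_tm, Hom.map_tm, Hom.id_lin, ← g.crossed_aux h]
        change (g.crossed h).toLinearMap _ = _
        simp only [crossed, Hom.andThen_lin, Hom.assoc_tm, Hom.map_tm, Hom.id_lin, Hom.assocInv_tm]
        rfl
    have h₂ : (g.nested h).toA (tm _ _ y (tm _ _ η η')) =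
        (g.g h).toA (tm _ _ ((g23 (g.g h) (Γ τ)).toLinearMap
          ((Hom.assoc (Γ τ) (Γ τ) (Γ τ')).toLinearMap (tm _ _ y η))) η') := by
      induction y using tm_induction with
      | h0 => simp
      | ha x y hx hy => simp only [map_add, LinearMap.add_apply, hx, hy]
      | ht ρ ρ' =>
        rw [nested_tm, ← tm_rsmul]
        simp only [Hom.assoc_tm, g23, Hom.andThen_lin, Hom.map_tm, Hom.id_lin, ← ofA_toA,
          Hom.runit_tm]
    rw [h₁, h₂, ← g.braid_left h τ, sigma23sigma12_assoc]

theorem nested_braiding (y : tensor (Γ τ) (Γ τ)) (z : tensor (Γ τ') (Γ τ')) :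
    (g.nested h).toA (tm _ _ ((HopfBimodule.braiding (Γ τ) (Γ τ)).toLinearMap y) z) =
      (g.nested h).toA (tm _ _ y ((HopfBimodule.braiding (Γ τ') (Γ τ')).toLinearMap z)) := by
  rw [nested_braiding_right, nested_braiding_left]

/-- Only the first two factors of `z` are contracted. Splitting off later factors at the end reduces
to degree two, which is `nested_braiding`. -/
theorem peelMap₂_braiding (n : ℕ) (y : tensor (Γ τ) (Γ τ)) (z : tpow (Γ τ') (n + 2)) :
    peelMap₂ (g.g h) n ((HopfBimodule.braiding (Γ τ) (Γ τ)).toLinearMap y) z =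
      peelMap₂ (g.g h) n y ((sigmaAt (Γ τ') (n + 2) 0).toLinearMap z) := by
  induction n with
  | zero =>
    have h₁ : ∀ (y : tensor (Γ τ) (Γ τ)) (a : A) (w : tensor (Γ τ') (Γ τ')),
        peelMap₂ (g.g h) 0 y (tapp₂ (Γ τ') 0 (tzero (Γ τ') a) w) =
          tzero (Γ τ') ((g.nested h).toA (tm _ _ y ((tensor (Γ τ') (Γ τ')).lsmul a w))) := by
      intro y a w
      induction w using tm_induction with
      | h0 => simp
      | ha x y hx hy => simp only [map_add, hx, hy]
      | ht η η' =>
        induction y using tm_induction with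
        | h0 => simp
        | ha x y hx hy => simp only [map_add, LinearMap.add_apply, hx, hy]
        | ht ρ ρ' =>
          rw [tapp₂_tm, peelMap₂_tm, peelMap_tapp, peelMap_zero, peelMap_zero, lsmul_tm, nested_tm]
    induction z using tapp₂_induction with
    | h0 => simp
    | ha x y hx hy => simp only [map_add, hx, hy]
    | ht t w =>
      obtain ⟨a, rfl⟩ := tzero_surjective (Γ τ') t
      rw [sigmaAt_tapp₂, h₁, h₁, nested_braiding, Hom.lin_lsmul]
  | succ n ih =>
    induction z using tapp_induction with
    | h0 => simp
    | ha x y hx hy => simp only [map_add, hx, hy]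
    | ht z η =>
      rw [sigmaAt_tapp (Γ τ') (by omega), peelMap₂_tapp, peelMap₂_tapp, ih]

/-- The last factor of `x` is contracted with the first factor of `z`, so positions are mirrored:
`i` corresponds to `k - 2 - i`. -/
theorem bracket_sigmaAt (k : ℕ) {i : ℕ} (hi : i + 1 < k) (x : tpow (Γ τ) k) (z : tpow (Γ τ') k) :
    bracket (g.g h) k ((sigmaAt (Γ τ) k i).toLinearMap x) z =
      bracket (g.g h) k x ((sigmaAt (Γ τ') k (k - 1 - (i + 1))).toLinearMap z) := by
  induction k with
  | zero => omega
  | succ k ih =>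
    by_cases hk : i + 1 < k
    · induction x using tapp_induction with
      | h0 => simp
      | ha x y hx hy => simp only [map_add, LinearMap.add_apply, hx, hy]
      | ht x ρ =>
        have hj : k + 1 - 1 - (i + 1) = k - 1 - (i + 1) + 1 := by omega
        rw [sigmaAt_tapp (Γ τ) hk, bracket_succ, bracket_succ, ih hk, hj,
          peelMap_sigmaAt _ _ (by omega)]
    · obtain rfl : k = i + 1 := by omega
      induction x using tapp₂_induction with
      | h0 => simp
      | ha x y hx hy => simp only [map_add, LinearMap.add_apply, hx, hy]
      | ht t y =>
        have hj : i + 1 + 1 - 1 - (i + 1) = 0 := by omega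
        rw [sigmaAt_tapp₂, bracket_tapp₂, bracket_tapp₂, g.peelMap₂_braiding h, hj]

theorem bracket_sigmaEnd (F : ∀ τ, Frame (Γ τ)) (hS : Function.Bijective (𝓢)) (k : ℕ) {i : ℕ}
    (hi : i + 1 < k) (s : Sgn) (x : tpow (Γ τ) k) (z : tpow (Γ τ') k) :
    bracket (g.g h) k (sigmaEnd (Γ τ) k s i x) z =
      bracket (g.g h) k x (sigmaEnd (Γ τ') k s (k - 1 - (i + 1)) z) := by
  cases s with
  | plus => exact g.bracket_sigmaAt h k hi x z
  | minus =>
    have h₁ := LinearMap.congr_fun ((F τ).sigmaEnd_mul hS k i) x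
    have h₂ := LinearMap.congr_fun ((F τ').sigmaEnd_mul hS k (k - 1 - (i + 1))) z
    -- Adjointness of the inverses is adjointness of `σ` applied to `σ⁻¹ x` and `σ⁻¹ z`.
    have h₃ := g.bracket_sigmaAt h k hi (sigmaEnd (Γ τ) k .minus i x)
      (sigmaEnd (Γ τ') k .minus (k - 1 - (i + 1)) z)
    conv_lhs => rw [show z = _ from h₂.symm]
    conv_rhs => rw [show x = _ from h₁.symm]
    exact h₃.symm

/-- The mirroring of positions is conjugation by the longest permutation, under which the sum over
the symmetric group is invariant. -/
theorem bracket_antisym (F : ∀ τ, Frame (Γ τ)) (hS : Function.Bijective (𝓢)) (k : ℕ) (s : Sgn)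
    (x : tpow (Γ τ) k) (z : tpow (Γ τ') k) :
    bracket (g.g h) k (antisym (Γ τ) k s x) z = bracket (g.g h) k x (antisym (Γ τ') k s z) := by
  rw [antisym_eq, antisym_eq]
  refine ((F τ').braidRelations hS k s).sum_adjoint _ (fun i hi x y => ?_) x z
  rw [LinearMap.neg_apply, LinearMap.neg_apply, map_neg, map_neg, LinearMap.neg_apply,
    g.bracket_sigmaEnd h F hS k hi]

end SigmaMetric

theorem peelMap_antisymLast {Γ Λ : HopfBimodule A} (g : Hom (tensor Γ Λ) (unit A)) (F : Frame Λ)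
    (hS : Function.Bijective (𝓢)) (k : ℕ) (s : Sgn) (ρ : Γ) (z : tpow Λ (k + 1)) :
    peelMap g k ρ (antisymLast Λ k s z) = antisym Λ k s (peelMap g k ρ z) := by
  rw [antisym_eq]
  refine wordProd_intertwine (peelMap g k ρ) (fun i hi y => ?_) z
  have := F.sigmaEnd_intertwine F hS (peelMap g k ρ) (fun x => peelMap_sigmaAt g k hi ρ x) s y
  rw [LinearMap.neg_apply, map_neg, this]
  rfl

theorem antisymLast_lapp {Λ : HopfBimodule A} (F : Frame Λ) (hS : Function.Bijective (𝓢)) (k : ℕ)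
    (s : Sgn) (ρ : Λ) (z : tpow Λ k) :
    antisymLast Λ k s (lapp Λ k ρ z) = lapp Λ k ρ (antisym Λ k s z) := by
  rw [antisym_eq]
  refine (wordProd_intertwine (lapp Λ k ρ) (fun i hi y => ?_) z).symm
  have := F.sigmaEnd_intertwine F hS (lapp Λ k ρ) (fun x => (sigmaAt_lapp k hi ρ x).symm) s y
  rw [LinearMap.neg_apply, map_neg, this]
  rfl

/-! ## Non-degeneracy of the contraction and exterior powers -/

namespace SigmaMetric

variable {Γ : Sgn → HopfBimodule A} (g : SigmaMetric Γ) {τ τ' : Sgn} (h : τ ≠ τ')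

/-- The metric takes scalar values on left-coinvariant elements. -/
theorem metric_coinv {m : Γ τ} {n : Γ τ'} (hm : m ∈ (Γ τ).leftCoinv) (hn : n ∈ (Γ τ').leftCoinv) :
    (g.g h).toA (tm _ _ m n) = ε ((g.g h).toA (tm _ _ m n)) • (1 : A) := by
  have h₁ := g.covariant_left h (tm _ _ m n)
  rw [dl_tm, ((Γ τ).mem_leftCoinv m).1 hm, ((Γ τ').mem_leftCoinv n).1 hn, diagL_tmul, one_mul,
    LinearMap.lTensor_tmul] at h₁
  have h₂ := congrArg (fun x => TensorProduct.rid ℂ A ((ε).lTensor A x)) h₁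
  simpa using h₂

/-- On coinvariant elements the metric is scalar by `metric_coinv`. Coinvariants generate both
calculi, so non-degeneracy of `g` passes to this scalar pairing, which is then perfect by finite
dimension. The dual basis `β` generates the second calculus as a right module. -/
theorem exists_dualFrame (F : Frame (Γ τ)) (hS : Function.Bijective (𝓢))
    [FiniteDimensional ℂ (Γ τ).leftCoinv] : ∃ β : Fin F.n → Γ τ',
      (∀ i j, (g.g h).toA (tm _ _ (F.e i) (β j)) = if i = j then 1 else 0) ∧
      ∀ y, ∃ a : Fin F.n → A, y = ∑ j, (Γ τ').rsmul (a j) (β j) := by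
  let p : (Γ τ).leftCoinv →ₗ[ℂ] (Γ τ').leftCoinv →ₗ[ℂ] ℂ :=
    (((tm (Γ τ) (Γ τ')).compr₂ (ε ∘ₗ (g.g h).toA)).compl₁₂
      (Γ τ).leftCoinv.subtype (Γ τ').leftCoinv.subtype)
  have hp : ∀ (m : (Γ τ).leftCoinv) (n : (Γ τ').leftCoinv),
      (g.g h).toA (tm _ _ (m : Γ τ) (n : Γ τ')) = p m n • (1 : A) :=
    fun m n => g.metric_coinv h m.2 n.2
  have hl : Function.Injective p := by
    refine (injective_iff_map_eq_zero p).2 fun m hm => ?_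
    apply Subtype.ext
    refine g.nondegenerate_left h _ fun ζ => ?_
    induction (Γ τ').span_rsmul_leftCoinv hS.2 ζ using Submodule.span_induction with
    | zero => simp
    | add x y _ _ hx hy => simp only [map_add, hx, hy, add_zero]
    | smul c x _ hx => simp only [map_smul, hx, smul_zero]
    | mem x hx =>
      obtain ⟨a, y, hy, rfl⟩ := hx
      rw [← rsmul_tm, toA_rsmul, hp m ⟨y, hy⟩, hm]
      simp
  have hr : Function.Injective p.flip := by
    refine (injective_iff_map_eq_zero p.flip).2 fun n hn => ?_
    apply Subtype.ext
    refine g.nondegenerate_right h _ fun ξ => ?_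
    rw [← F.sum_coef ξ]
    simp only [map_sum, LinearMap.sum_apply]
    refine Finset.sum_eq_zero fun i _ => ?_
    have := LinearMap.congr_fun hn ⟨F.e i, F.mem i⟩
    rw [LinearMap.flip_apply] at this
    rw [← lsmul_tm, toA_lsmul, hp ⟨F.e i, F.mem i⟩ n, this]
    simp
  have hperf : p.IsPerfPair := LinearMap.IsPerfPair.of_injective hl hr
  choose β hβ using fun j => hperf.bijective_right.2 (ε ∘ₗ F.coef j ∘ₗ (Γ τ).leftCoinv.subtype)
  have hpβ : ∀ m j, p m (β j) = ε (F.coef j m) := fun m j => LinearMap.congr_fun (hβ j) m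
  refine ⟨fun j => β j, fun i j => ?_, fun y => ?_⟩
  · rw [hp ⟨F.e i, F.mem i⟩, hpβ, F.coef_e]
    by_cases hij : i = j
    · subst hij; simp
    · simp [hij, Ne.symm hij]
  · have hspan : ∀ n : (Γ τ').leftCoinv, n = ∑ j, p ⟨F.e j, F.mem j⟩ n • β j := by
      intro n
      apply hr
      ext m
      have hm : m = ∑ i, ε (F.coef i m) • (⟨F.e i, F.mem i⟩ : (Γ τ).leftCoinv) := by
        apply Subtype.ext
        rw [Submodule.coe_sum]
        exact F.eq_sum_coinv m.2
      conv_lhs => rw [hm]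
      simp only [LinearMap.flip_apply, map_sum, map_smul, LinearMap.sum_apply,
        LinearMap.smul_apply, hpβ, smul_eq_mul]
      exact Finset.sum_congr rfl fun j _ => mul_comm _ _
    induction (Γ τ').span_rsmul_leftCoinv hS.2 y using Submodule.span_induction with
    | zero => exact ⟨0, by simp⟩
    | add x y _ _ hx hy =>
      obtain ⟨a, rfl⟩ := hx
      obtain ⟨b, rfl⟩ := hy
      exact ⟨a + b, by simp [Finset.sum_add_distrib]⟩
    | smul c x _ hx =>
      obtain ⟨a, rfl⟩ := hx
      exact ⟨c • a, by simp [Finset.smul_sum]⟩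
    | mem x hx =>
      obtain ⟨a, n, hn, rfl⟩ := hx
      refine ⟨fun j => p ⟨F.e j, F.mem j⟩ ⟨n, hn⟩ • a, ?_⟩
      have := congrArg (fun z : (Γ τ').leftCoinv => (Γ τ').rsmul a (z : Γ τ')) (hspan ⟨n, hn⟩)
      simpa using this

theorem exists_eq_sum_lapp {Λ : HopfBimodule A} {m : ℕ} {β : Fin m → Λ}
    (hβ : ∀ y, ∃ a : Fin m → A, y = ∑ j, Λ.rsmul (a j) (β j)) (n : ℕ) (z : tpow Λ (n + 1)) :
    ∃ ζ : Fin m → tpow Λ n, z = ∑ j, lapp Λ n (β j) (ζ j) := by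
  induction n with
  | zero =>
    induction z using tone_induction with
    | h ρ =>
      obtain ⟨a, rfl⟩ := hβ ρ
      exact ⟨fun j => tzero Λ (a j), by simp [lapp_zero]⟩
  | succ n ih =>
    induction z using tapp_induction with
    | h0 => exact ⟨0, by simp⟩
    | ha x y hx hy =>
      obtain ⟨a, rfl⟩ := hx
      obtain ⟨b, rfl⟩ := hy
      exact ⟨a + b, by simp [Finset.sum_add_distrib]⟩
    | ht z η =>
      obtain ⟨a, rfl⟩ := ih z
      exact ⟨fun j => tapp Λ n (a j) η, by simp [lapp_assocInv]⟩

/-- Expand `x = ∑ y_l ⊗ e_l` and `z = ∑ β_j ⊗ ζ_j`. The factors that meet first are dual to each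
other, so each `y_j` and each `ζ_j` is detected in degree `k`. -/
theorem bracket_nondegenerate (F : Frame (Γ τ)) (hS : Function.Bijective (𝓢))
    [FiniteDimensional ℂ (Γ τ).leftCoinv] (k : ℕ) :
    (∀ x : tpow (Γ τ) k, (∀ z, bracket (g.g h) k x z = 0) → x = 0) ∧
      ∀ z : tpow (Γ τ') k, (∀ x, bracket (g.g h) k x z = 0) → z = 0 := by
  obtain ⟨β, hβ, hspan⟩ := g.exists_dualFrame h F hS
  induction k with
  | zero =>
    constructor
    · intro x hx
      obtain ⟨a, rfl⟩ := tzero_surjective (Γ τ) x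
      have := hx (tzero _ 1)
      rw [bracket_zero, mul_one] at this
      rw [this, map_zero]
    · intro x hx
      obtain ⟨a, rfl⟩ := tzero_surjective (Γ τ') x
      have := hx (tzero _ 1)
      rw [bracket_zero, one_mul] at this
      rw [this, map_zero]
  | succ k ih =>
    have hpeel : ∀ i j (z : tpow (Γ τ') k), peelMap (g.g h) k (F.e i) (lapp (Γ τ') k (β j) z) =
        if i = j then z else 0 := by
      intro i j z
      rw [peelMap_lapp, hβ]
      split_ifs
      · exact (tpow (Γ τ') k).one_lsmul z
      · simp
    constructor
    · intro x hx
      obtain ⟨y, rfl⟩ : ∃ y : Fin F.n → tpow (Γ τ) k, ∑ l, tapp (Γ τ) k (y l) (F.e l) = x :=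
        ⟨fun l => F.tmCoef (tpow (Γ τ) k) l x, F.sum_tmCoef (M := tpow (Γ τ) k) x⟩
      refine Finset.sum_eq_zero fun j _ => ?_
      have : y j = 0 := by
        refine ih.1 _ fun z => ?_
        have := hx (lapp (Γ τ') k (β j) z)
        rw [map_sum, LinearMap.sum_apply, Finset.sum_eq_single j, bracket_succ, hpeel,
          if_pos rfl] at this
        · exact this
        · intro l _ hl
          rw [bracket_succ, hpeel, if_neg hl, map_zero]
        · simp
      rw [this, map_zero, LinearMap.zero_apply]
    · intro z hz
      obtain ⟨ζ, rfl⟩ := exists_eq_sum_lapp hspan k z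
      refine Finset.sum_eq_zero fun j _ => ?_
      have : ζ j = 0 := by
        refine ih.2 _ fun x => ?_
        have := hz (tapp (Γ τ) k x (F.e j))
        rw [map_sum, Finset.sum_eq_single j, bracket_succ, hpeel, if_pos rfl] at this
        · exact this
        · intro l _ hl
          rw [bracket_succ, hpeel, if_neg hl.symm, map_zero]
        · simp
      rw [this, map_zero]

end SigmaMetric

/-! ### Maps induced on exterior powers -/

section Descend

variable {V W X : Type*} [AddCommGroup V] [AddCommGroup W] [AddCommGroup X]
  [Module ℂ V] [Module ℂ W] [Module ℂ X]

theorem descend_mkQ {p : Submodule ℂ V} {f : V →ₗ[ℂ] X} (h : ∀ x ∈ p, f x = 0) (x : V) :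
    descend p f (p.mkQ x) = f x := by
  have h' : p ≤ LinearMap.ker f := fun x hx => LinearMap.mem_ker.2 (h x hx)
  rw [descend, dif_pos h']
  rfl

/-- `descend` has the default value `0`, so the intended formula holds only after vanishing on both
subspaces has been established. -/
theorem descend₂_mkQ {p : Submodule ℂ V} {q : Submodule ℂ W} {f : V →ₗ[ℂ] W →ₗ[ℂ] X}
    (hp : ∀ x ∈ p, ∀ y, f x y = 0) (hq : ∀ x, ∀ y ∈ q, f x y = 0) (x : V) (y : W) :
    descend₂ p q f (p.mkQ x) (q.mkQ y) = f x y := by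
  have h₁ : ∀ y, descend q f.flip (q.mkQ y) = f.flip y :=
    descend_mkQ fun y hy => LinearMap.ext fun x => hq x y hy
  rw [descend₂, descend_mkQ, LinearMap.flip_apply, h₁, LinearMap.flip_apply]
  intro x hx
  ext y
  simp only [LinearMap.comp_apply, LinearMap.flip_apply]
  exact (LinearMap.congr_fun (h₁ y) x).trans (hp x hx y)

end Descend

theorem toExt_surjective (Γ : HopfBimodule A) (k : ℕ) : Function.Surjective (toExt Γ k) :=
  Submodule.mkQ_surjective _

theorem toExt_eq_zero {Γ : HopfBimodule A} {k : ℕ} {x : tpow Γ k} :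
    toExt Γ k x = 0 ↔ antisym Γ k .plus x = 0 := by
  rw [toExt, Submodule.mkQ_apply, Submodule.Quotient.mk_eq_zero, LinearMap.mem_ker]

theorem extZero_toExt (Γ : HopfBimodule A) (x : tpow Γ 0) :
    extZero Γ (toExt Γ 0 x) = fromZero Γ x := by
  refine descend_mkQ (fun x hx => ?_) x
  rw [LinearMap.mem_ker, antisym_zero] at hx
  exact hx

namespace Frame

variable {Γ : HopfBimodule A}

theorem antisym_eq_zero_iff (F : Frame Γ) (hS : Function.Bijective (𝓢)) {k : ℕ} (s : Sgn)
    {x : tpow Γ k} : antisym Γ k s x = 0 ↔ x ∈ LinearMap.ker (antisym Γ k .plus) := by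
  rw [← F.ker_antisym hS k s, LinearMap.mem_ker]

/-- `A_{k+1}` factors through the antisymmetriser of the first `k` places, so the kernels form a
right ideal in the tensor algebra; the next lemma is the left version. -/
theorem antisym_tapp_eq_zero (F : Frame Γ) (hS : Function.Bijective (𝓢)) {k : ℕ} {x : tpow Γ k}
    (hx : antisym Γ k .plus x = 0) (ρ : Γ) : antisym Γ (k + 1) .plus (tapp Γ k x ρ) = 0 := by
  obtain ⟨Z, hZ⟩ := F.exists_antisym_eq_mul_first hS k .plus
  rw [hZ, Module.End.mul_apply, F.antisymFirst_tapp hS, hx, map_zero, LinearMap.zero_apply,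
    map_zero]

theorem antisym_lapp_eq_zero (F : Frame Γ) (hS : Function.Bijective (𝓢)) {k : ℕ} {x : tpow Γ k}
    (hx : antisym Γ k .plus x = 0) (ρ : Γ) : antisym Γ (k + 1) .plus (lapp Γ k ρ x) = 0 := by
  obtain ⟨Z, hZ⟩ := F.exists_antisym_eq_mul_last hS k .plus
  rw [hZ, Module.End.mul_apply, antisymLast_lapp F hS, hx, map_zero, map_zero]

theorem wedge_oneForm (F : Frame Γ) (hS : Function.Bijective (𝓢)) (k : ℕ) (x : tpow Γ k) (ρ : Γ) :
    wedge Γ k 1 (k + 1) rfl (toExt Γ k x) (oneForm Γ ρ) = toExt Γ (k + 1) (tapp Γ k x ρ) := by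
  have h₁ : ∀ x ρ, (tmulHom Γ 1 k (k + 1) rfl).toLinearMap
      (tm (tpow Γ k) (tpow Γ 1) x (tapp Γ 0 (tzero Γ 1) ρ)) = tapp Γ k x ρ := by
    intro x ρ
    change (Hom.map (tmulHom Γ 0 k k rfl) (Hom.id Γ)).toLinearMap
      ((Hom.assocInv (tpow Γ k) (tpow Γ 0) Γ).toLinearMap
        (tm (tpow Γ k) (tensor (tpow Γ 0) Γ) x (tm (tpow Γ 0) Γ (tzero Γ 1) ρ))) = _
    rw [Hom.assocInv_tm, Hom.map_tm]
    have : (tmulHom Γ 0 k k rfl).toLinearMap (tm (tpow Γ k) (tpow Γ 0) x (tzero Γ 1)) = x :=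
      (Hom.runit_tm (1 : A) x).trans ((tpow Γ k).one_rsmul x)
    rw [this]
    rfl
  refine (descend₂_mkQ (fun x hx y => ?_) (fun x y hy => ?_) x _).trans
    (congrArg (toExt Γ (k + 1)) (h₁ x ρ))
  · induction y using tone_induction with
    | h ρ =>
      refine (congrArg (toExt Γ (k + 1)) (h₁ x ρ)).trans ?_
      exact toExt_eq_zero.2 (F.antisym_tapp_eq_zero hS hx ρ)
  · rw [LinearMap.mem_ker, antisym_one] at hy
    rw [show y = 0 from hy, map_zero]

theorem oneForm_wedge (F : Frame Γ) (hS : Function.Bijective (𝓢)) (k : ℕ) (x : tpow Γ k) (ρ : Γ) :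
    wedge Γ 1 k (k + 1) (Nat.add_comm k 1) (oneForm Γ ρ) (toExt Γ k x) =
      toExt Γ (k + 1) (lapp Γ k ρ x) := by
  refine descend₂_mkQ (fun y hy x => ?_) (fun y x hx => ?_) _ x
  · rw [LinearMap.mem_ker, antisym_one] at hy
    rw [show y = 0 from hy, map_zero, LinearMap.zero_apply]
  · induction y using tone_induction with
    | h ρ => exact toExt_eq_zero.2 (F.antisym_lapp_eq_zero hS hx ρ)

end Frame

/-! ### Contraction with a one-form on exterior powers -/

section Contract

variable {Γ Λ : HopfBimodule A} (g : Hom (tensor Γ Λ) (unit A))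

/-- `endContract g k (x ⊗ ρ) η = x g(ρ, η)`. -/
def endContract (k : ℕ) : tpow Γ (k + 1) →ₗ[ℂ] Λ →ₗ[ℂ] (tpow Γ k).carrier :=
  ((tm (tpow Γ (k + 1)) (tpow Λ 1)).compr₂ (gtildeL g 1 (k + 1) k rfl).toLinearMap).compl₂
    (tapp Λ 0 (tzero Λ 1))

theorem endContract_tapp (k : ℕ) (x : tpow Γ k) (ρ : Γ) (η : Λ) :
    endContract g k (tapp Γ k x ρ) η = (tpow Γ k).rsmul (g.toA (tm Γ Λ ρ η)) x := by
  change (gtildeL g 0 k k rfl).toLinearMap ((Hom.map (Hom.id (tpow Γ k)) (peel g 0)).toLinearMap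
    ((Hom.assoc (tpow Γ k) Γ (tpow Λ 1)).toLinearMap
      (tm (tensor (tpow Γ k) Γ) (tpow Λ 1) (tm (tpow Γ k) Γ x ρ) (tapp Λ 0 (tzero Λ 1) η)))) = _
  rw [Hom.assoc_tm, Hom.map_tm]
  have h₁ : (peel g 0).toLinearMap (tm Γ (tpow Λ 1) ρ (tapp Λ 0 (tzero Λ 1) η)) =
      tzero Λ (g.toA (tm Γ Λ ρ η)) :=
    (peelMap_zero g ρ 1 η).trans (by rw [Λ.one_lsmul])
  rw [h₁]
  exact Hom.runit_tm _ _

theorem endContract_antisymFirst (F : Frame Γ) (hS : Function.Bijective (𝓢)) (k : ℕ) (s : Sgn)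
    (x : tpow Γ (k + 1)) (η : Λ) :
    endContract g k (antisymFirst Γ k s x) η = antisym Γ k s (endContract g k x η) := by
  induction x using tapp_induction with
  | h0 => simp
  | ha x y hx hy => simp only [map_add, LinearMap.add_apply, hx, hy]
  | ht x ρ =>
    rw [F.antisymFirst_tapp hS, endContract_tapp, endContract_tapp, (F.antisym_mem hS k s).2.2]

/-- Well defined because `A_k` of the contracted shuffle sum is the contraction of `A_{k+1} x`, by
`antisym_succ_first`. So the kernel of `A_{k+1}` is mapped into the kernel of `A_k`. -/
theorem contractL_oneForm (F : Frame Γ) (hS : Function.Bijective (𝓢)) (k : ℕ) (s : Sgn)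
    (x : tpow Γ (k + 1)) (η : Λ) :
    contractL g s (k + 1) 1 k rfl (toExt Γ (k + 1) x) (oneForm Λ η) =
      toExt Γ k (endContract g k (shuffleSum Γ k (k + 1) s x) η) := by
  have h₁ : ∀ x η, (((tm (tpow Γ (k + 1)) (tpow Λ 1)).compr₂
      (toExt Γ k ∘ₗ (gtildeL g 1 (k + 1) k rfl).toLinearMap)).compl₁₂
      (shuffleSum Γ k (k + 1) s) (antisym Λ 1 s)) x (tapp Λ 0 (tzero Λ 1) η) =
      toExt Γ k (endContract g k (shuffleSum Γ k (k + 1) s x) η) := by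
    intro x η
    rw [antisym_one]
    rfl
  refine (descend₂_mkQ (fun x hx y => ?_) (fun x y hy => ?_) x _).trans (h₁ x η)
  · induction y using tone_induction with
    | h η =>
      rw [h₁, toExt_eq_zero]
      refine (F.antisym_eq_zero_iff hS s).1 ?_
      rw [← endContract_antisymFirst g F hS, ← Module.End.mul_apply, ← F.antisym_succ_first hS,
        (F.antisym_eq_zero_iff hS s).2 hx, map_zero, LinearMap.zero_apply]
  · rw [LinearMap.mem_ker, antisym_one] at hy
    rw [show y = 0 from hy, map_zero]

/-- The same argument at the other end, with the antisymmetriser on the last `k` places. -/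
theorem contractR_oneForm (F : Frame Λ) (hS : Function.Bijective (𝓢)) (k : ℕ) (s : Sgn)
    (ρ : Γ) (z : tpow Λ (k + 1)) :
    contractR g s 1 (k + 1) k rfl (oneForm Γ ρ) (toExt Λ (k + 1) z) =
      toExt Λ k (peelMap g k ρ (shuffleSum Λ 1 (k + 1) s z)) := by
  have h₂ : ∀ z ρ, (gtildeR g 1 (k + 1) k rfl).toLinearMap
      (tm (tpow Γ 1) (tpow Λ (k + 1)) (tapp Γ 0 (tzero Γ 1) ρ) z) = peelMap g k ρ z := by
    intro z ρ
    change (gtildeR g 0 k k rfl).toLinearMap ((Hom.map (Hom.id (tpow Γ 0)) (peel g k)).toLinearMap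
      ((Hom.assoc (tpow Γ 0) Γ (tpow Λ (k + 1))).toLinearMap
        (tm (tensor (tpow Γ 0) Γ) (tpow Λ (k + 1)) (tm (tpow Γ 0) Γ (tzero Γ 1) ρ) z))) = _
    rw [Hom.assoc_tm, Hom.map_tm]
    exact (Hom.lunit_tm (1 : A) _).trans ((tpow Λ k).one_lsmul _)
  have h₁ : ∀ z ρ, (((tm (tpow Γ 1) (tpow Λ (k + 1))).compr₂
      (toExt Λ k ∘ₗ (gtildeR g 1 (k + 1) k rfl).toLinearMap)).compl₁₂
      (antisym Γ 1 s) (shuffleSum Λ 1 (k + 1) s)) (tapp Γ 0 (tzero Γ 1) ρ) z =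
      toExt Λ k (peelMap g k ρ (shuffleSum Λ 1 (k + 1) s z)) := by
    intro z ρ
    rw [antisym_one]
    exact congrArg (toExt Λ k) (h₂ _ ρ)
  refine (descend₂_mkQ (fun y hy z => ?_) (fun y z hz => ?_) _ z).trans (h₁ z ρ)
  · rw [LinearMap.mem_ker, antisym_one] at hy
    rw [show y = 0 from hy, map_zero, LinearMap.zero_apply]
  · induction y using tone_induction with
    | h ρ =>
      rw [h₁, toExt_eq_zero]
      refine (F.antisym_eq_zero_iff hS s).1 ?_
      rw [← peelMap_antisymLast g F hS, ← Module.End.mul_apply, ← F.antisym_succ_last hS,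
        (F.antisym_eq_zero_iff hS s).2 hz, map_zero]

end Contract

namespace SigmaMetric

variable {Γ : Sgn → HopfBimodule A} (g : SigmaMetric Γ) {τ τ' : Sgn} (h : τ ≠ τ')

/-- The expression vanishes on the kernel in `z` directly, and in `x` by self-adjointness of the
antisymmetriser. Equality of the kernels for the two signs is used in both places. -/
theorem pairing_toExt (F : ∀ τ, Frame (Γ τ)) (hS : Function.Bijective (𝓢)) (k : ℕ) (s : Sgn)
    (x : tpow (Γ τ) k) (z : tpow (Γ τ') k) :
    pairing (g.g h) s k (toExt (Γ τ) k x) (toExt (Γ τ') k z) =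
      bracket (g.g h) k x (antisym (Γ τ') k s z) := by
  have h₁ : ∀ x z, (((tm (tpow (Γ τ) k) (tpow (Γ τ') k)).compr₂
      (toExt (Γ τ) 0 ∘ₗ (gtildeL (g.g h) k k 0 (Nat.zero_add k).symm).toLinearMap)).compl₁₂
      (shuffleSum (Γ τ) 0 k s) (antisym (Γ τ') k s)) x z =
      toExt (Γ τ) 0 (tzero (Γ τ) (bracket (g.g h) k x (antisym (Γ τ') k s z))) := by
    intro x z
    rw [shuffleSum_zero]
    rfl
  have h₂ : contractL (g.g h) s k k 0 (Nat.zero_add k).symm (toExt (Γ τ) k x) (toExt (Γ τ') k z) =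
      toExt (Γ τ) 0 (tzero (Γ τ) (bracket (g.g h) k x (antisym (Γ τ') k s z))) := by
    refine (descend₂_mkQ (fun x hx z => ?_) (fun x z hz => ?_) x z).trans (h₁ x z)
    · rw [h₁, ← g.bracket_antisym h F hS, ((F τ).antisym_eq_zero_iff hS s).2 hx, map_zero,
        LinearMap.zero_apply, map_zero, map_zero]
    · rw [h₁, ((F τ').antisym_eq_zero_iff hS s).2 hz, map_zero, map_zero, map_zero]
  rw [pairing, LinearMap.compr₂_apply, h₂, extZero_toExt]
  rfl

end SigmaMetric

/-! ## The actions of the dual space on Hopf bimodules -/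

namespace HopfBimodule

variable (M : HopfBimodule A)

/-- `m ↦ φ(m₍₋₁₎) m₍₀₎`. -/
def lact (φ : A →ₗ[ℂ] ℂ) : M →ₗ[ℂ] M := lslice φ ∘ₗ M.dl

/-- `m ↦ m₍₀₎ φ(m₍₁₎)`. -/
def ract (φ : A →ₗ[ℂ] ℂ) : M →ₗ[ℂ] M := rslice φ ∘ₗ M.dr

theorem lact_counit (m : M) : M.lact ε m = m := M.counit_left m

theorem ract_counit (m : M) : M.ract ε m = m := M.counit_right m

theorem dl_lact (φ : A →ₗ[ℂ] ℂ) (m : M) : M.dl (M.lact φ m) = (lhit φ).rTensor M (M.dl m) := by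
  have h₁ : ∀ x : A ⊗[ℂ] M, lslice φ (TensorProduct.assoc ℂ A A M ((Δ).rTensor M x)) =
      (lhit φ).rTensor M x := by
    intro x
    induction x with
    | zero => simp
    | add x y hx hy => simp only [map_add, hx, hy]
    | tmul a m =>
      rw [LinearMap.rTensor_tmul, LinearMap.rTensor_tmul, lhit, LinearMap.comp_apply]
      generalize Δ a = x
      induction x with
      | zero => simp
      | add x y hx hy => simp only [map_add, TensorProduct.add_tmul, hx, hy]
      | tmul a b => simp [TensorProduct.smul_tmul']
  rw [← h₁, M.coassoc_left, lslice_lTensor]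
  rfl

theorem dr_ract (φ : A →ₗ[ℂ] ℂ) (m : M) : M.dr (M.ract φ m) = (rhit φ).lTensor M (M.dr m) := by
  have h₁ : ∀ x : M ⊗[ℂ] A, rslice φ ((TensorProduct.assoc ℂ M A A).symm ((Δ).lTensor M x)) =
      (rhit φ).lTensor M x := by
    intro x
    induction x with
    | zero => simp
    | add x y hx hy => simp only [map_add, hx, hy]
    | tmul m a =>
      rw [LinearMap.lTensor_tmul, LinearMap.lTensor_tmul, rhit, LinearMap.comp_apply]
      generalize Δ a = x
      induction x with
      | zero => simp
      | add x y hx hy => simp only [map_add, TensorProduct.tmul_add, hx, hy]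
      | tmul a b => simp
  rw [← h₁, ← M.coassoc_right, LinearEquiv.symm_apply_apply, rslice_rTensor]
  rfl

theorem dl_ract (φ : A →ₗ[ℂ] ℂ) (m : M) : M.dl (M.ract φ m) = (M.ract φ).lTensor A (M.dl m) := by
  have h₁ : ∀ x : (A ⊗[ℂ] M) ⊗[ℂ] A, rslice φ x =
      (rslice φ).lTensor A (TensorProduct.assoc ℂ A M A x) := by
    intro x
    induction x with
    | zero => simp
    | add x y hx hy => simp only [map_add, hx, hy]
    | tmul y a =>
      induction y with
      | zero => simp
      | add x y hx hy => simp only [map_add, TensorProduct.add_tmul, hx, hy]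
      | tmul a b => simp
  have h₂ := h₁ (M.dl.rTensor A (M.dr m))
  rw [M.bicomodule, rslice_rTensor, ← LinearMap.lTensor_comp_apply] at h₂
  exact h₂

end HopfBimodule

namespace IsBicomoduleMap

variable {M N : HopfBimodule A} {f : M →ₗ[ℂ] N}

theorem lact (hf : IsBicomoduleMap M N f) (φ : A →ₗ[ℂ] ℂ) (m : M) :
    N.lact φ (f m) = f (M.lact φ m) := by
  rw [HopfBimodule.lact, LinearMap.comp_apply, hf.1, lslice_lTensor]
  rfl

theorem ract (hf : IsBicomoduleMap M N f) (φ : A →ₗ[ℂ] ℂ) (m : M) :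
    N.ract φ (f m) = f (M.ract φ m) := by
  rw [HopfBimodule.ract, LinearMap.comp_apply, hf.2, rslice_rTensor]
  rfl

end IsBicomoduleMap

/-! ### Isotypic components by support functionals -/

section Isotypic

variable {Γ : HopfBimodule A}

namespace Frame

theorem toExt_lact_eq_zero (F : Frame Γ) (hS : Function.Bijective (𝓢))
    {k : ℕ} {x : tpow Γ k} (hx : toExt Γ k x = 0) (φ : A →ₗ[ℂ] ℂ) :
    toExt Γ k ((tpow Γ k).lact φ x) = 0 := by
  rw [toExt_eq_zero] at hx ⊢
  rw [← (F.antisym_mem hS k .plus).1.lact, hx, map_zero]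

theorem toExt_ract_eq_zero (F : Frame Γ) (hS : Function.Bijective (𝓢))
    {k : ℕ} {x : tpow Γ k} (hx : toExt Γ k x = 0) (φ : A →ₗ[ℂ] ℂ) :
    toExt Γ k ((tpow Γ k).ract φ x) = 0 := by
  rw [toExt_eq_zero] at hx ⊢
  rw [← (F.antisym_mem hS k .plus).1.ract, hx, map_zero]

/-- The antisymmetriser commutes with all actions of functionals, so its kernel is a subcomodule;
slicing reduces the claim to this. -/
theorem extDl_toExt (F : Frame Γ) (hS : Function.Bijective (𝓢)) {k : ℕ} (x : tpow Γ k) :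
    extDl Γ k (toExt Γ k x) = (toExt Γ k).lTensor A ((tpow Γ k).dl x) := by
  refine descend_mkQ (fun x hx => ?_) x
  refine eq_of_lslice_eq fun φ => ?_
  rw [LinearMap.comp_apply, lslice_lTensor, map_zero]
  exact F.toExt_lact_eq_zero hS (toExt_eq_zero.2 hx) φ

theorem extDr_toExt (F : Frame Γ) (hS : Function.Bijective (𝓢)) {k : ℕ} (x : tpow Γ k) :
    extDr Γ k (toExt Γ k x) = (toExt Γ k).rTensor A ((tpow Γ k).dr x) := by
  refine descend_mkQ (fun x hx => ?_) x
  refine eq_of_rslice_eq fun φ => ?_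
  rw [LinearMap.comp_apply, rslice_rTensor, map_zero]
  exact F.toExt_ract_eq_zero hS (toExt_eq_zero.2 hx) φ

theorem extDlr_toExt (F : Frame Γ) (hS : Function.Bijective (𝓢))
    {k : ℕ} (x : tpow Γ k) : extDlr Γ k (toExt Γ k x) =
    ((toExt Γ k).rTensor A ∘ₗ (tpow Γ k).dr).lTensor A ((tpow Γ k).dl x) := by
  rw [extDlr, LinearMap.comp_apply, F.extDl_toExt hS, ← LinearMap.lTensor_comp_apply]
  congr 2
  ext y
  exact F.extDr_toExt hS y

theorem slice_extDlr_toExt (F : Frame Γ) (hS : Function.Bijective (𝓢))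
    {k : ℕ} (φ ψ : A →ₗ[ℂ] ℂ) (x : tpow Γ k) :
    rslice ψ (lslice φ (extDlr Γ k (toExt Γ k x))) =
      toExt Γ k ((tpow Γ k).ract ψ ((tpow Γ k).lact φ x)) := by
  rw [F.extDlr_toExt hS, lslice_lTensor, LinearMap.comp_apply, rslice_rTensor]
  rfl

theorem extDlr_toExt_ract_lact (F : Frame Γ) (hS : Function.Bijective (𝓢))
    {k : ℕ} (φ ψ : A →ₗ[ℂ] ℂ) (x : tpow Γ k) :
    extDlr Γ k (toExt Γ k ((tpow Γ k).ract ψ ((tpow Γ k).lact φ x))) =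
      TensorProduct.map (lhit φ) ((rhit ψ).lTensor _) (extDlr Γ k (toExt Γ k x)) := by
  rw [F.extDlr_toExt hS, F.extDlr_toExt hS, HopfBimodule.dl_ract, HopfBimodule.dl_lact,
    ← LinearMap.lTensor_comp_apply]
  generalize (tpow Γ k).dl x = y
  induction y with
  | zero => simp
  | add y z hy hz => simp only [map_add, hy, hz]
  | tmul a m =>
    simp only [LinearMap.rTensor_tmul, LinearMap.lTensor_tmul, LinearMap.comp_apply,
      HopfBimodule.dr_ract, TensorProduct.map_tmul]
    congr 1
    generalize (tpow Γ k).dr m = z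
    induction z with
    | zero => simp
    | add y z hy hz => simp only [map_add, hy, hz]
    | tmul m b => simp

variable {k m n : ℕ} {u : Matrix (Fin m) (Fin m) A} {v : Matrix (Fin n) (Fin n) A}

/-- The legs of the two-sided coaction lie in `C(u)` and `C(v)`, where the functionals cannot be
distinguished from the counit. -/
theorem toExt_ract_lact_of_mem (F : Frame Γ) (hS : Function.Bijective (𝓢))
    {x : tpow Γ k} (hx : toExt Γ k x ∈ isotypic Γ k u v)
    {φ ψ : A →ₗ[ℂ] ℂ} (hφ : ∀ c ∈ matrixElements u, φ c = ε c)
    (hψ : ∀ c ∈ matrixElements v, ψ c = ε c) :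
    toExt Γ k ((tpow Γ k).ract ψ ((tpow Γ k).lact φ x)) = toExt Γ k x := by
  have h₁ : ∀ y ∈ LinearMap.range (TensorProduct.map (matrixElements u).subtype
      ((matrixElements v).subtype.lTensor (ExtPow Γ k))),
      rslice ψ (lslice φ y) = rslice ε (lslice ε y) := by
    rintro _ ⟨y, rfl⟩
    induction y with
    | zero => simp
    | add y z hy hz => simp only [map_add, hy, hz]
    | tmul a z =>
      induction z with
      | zero => simp
      | add y z hy hz => simp only [map_add, TensorProduct.tmul_add, hy, hz]
      | tmul w b => simp [hφ _ a.2, hψ _ b.2]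
  have h₂ := h₁ _ hx
  rwa [F.slice_extDlr_toExt hS, F.slice_extDlr_toExt hS, HopfBimodule.lact_counit,
    HopfBimodule.ract_counit] at h₂

theorem toExt_lact_of_mem (F : Frame Γ) (hS : Function.Bijective (𝓢))
    {x : tpow Γ k} (hx : toExt Γ k x ∈ isotypic Γ k u v)
    {φ : A →ₗ[ℂ] ℂ} (hφ : ∀ c ∈ matrixElements u, φ c = ε c) :
    toExt Γ k ((tpow Γ k).lact φ x) = toExt Γ k x := by
  have := F.toExt_ract_lact_of_mem hS hx hφ (ψ := ε) fun _ _ => rfl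
  rwa [HopfBimodule.ract_counit] at this

theorem toExt_ract_of_mem (F : Frame Γ) (hS : Function.Bijective (𝓢))
    {x : tpow Γ k} (hx : toExt Γ k x ∈ isotypic Γ k u v)
    {ψ : A →ₗ[ℂ] ℂ} (hψ : ∀ c ∈ matrixElements v, ψ c = ε c) :
    toExt Γ k ((tpow Γ k).ract ψ x) = toExt Γ k x := by
  have := F.toExt_ract_lact_of_mem hS hx (φ := ε) (fun _ _ => rfl) hψ
  rwa [HopfBimodule.lact_counit] at this

/-- The action of a functional on a form becomes a hit on the corresponding leg of its coaction.
Together with the preceding lemmas, support functionals give projections onto isotypic components.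
-/
theorem toExt_ract_lact_mem (F : Frame Γ) (hS : Function.Bijective (𝓢))
    {φ ψ : A →ₗ[ℂ] ℂ} (hφ : ∀ a, lhit φ a ∈ matrixElements u)
    (hψ : ∀ a, rhit ψ a ∈ matrixElements v) (x : tpow Γ k) :
    toExt Γ k ((tpow Γ k).ract ψ ((tpow Γ k).lact φ x)) ∈ isotypic Γ k u v := by
  rw [isotypic, Submodule.mem_comap, F.extDlr_toExt_ract_lact hS]
  generalize extDlr Γ k (toExt Γ k x) = y
  refine ⟨TensorProduct.map ((lhit φ).codRestrict _ hφ)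
    (((rhit ψ).codRestrict _ hψ).lTensor _) y, ?_⟩
  induction y with
  | zero => simp
  | add y z hy hz => simp only [map_add, hy, hz]
  | tmul a z =>
    induction z with
    | zero => simp
    | add y z hy hz => simp only [map_add, TensorProduct.tmul_add, hy, hz]
    | tmul w b => simp

/-- Bicomodule maps which descend to exterior powers preserve isotypic components. -/
theorem toExt_map_mem_isotypic (F : Frame Γ) (hS : Function.Bijective (𝓢))
    {Λ : HopfBimodule A} (G : Frame Λ) (hA : IsCosemisimple A)
    (hu : IsCorep u) (hv : IsCorep v) {l : ℕ} {f : tpow Γ k →ₗ[ℂ] tpow Λ l}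
    (hf : IsBicomoduleMap (tpow Γ k) (tpow Λ l) f) {f' : ExtPow Γ k →ₗ[ℂ] ExtPow Λ l}
    (hf' : ∀ x, f' (toExt Γ k x) = toExt Λ l (f x)) {ρ : ExtPow Γ k} (hρ : ρ ∈ isotypic Γ k u v) :
    f' ρ ∈ isotypic Λ l u v := by
  obtain ⟨x, rfl⟩ := toExt_surjective Γ k ρ
  obtain ⟨φ, hφ, hφ'⟩ := exists_support_functional hA hu.stable_matrixElements
  obtain ⟨ψ, hψ, hψ'⟩ := exists_support_functional hA hv.stable_matrixElements
  -- The form is replaced by its own projection, and the projection is moved through the bicomodule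
  -- map.
  rw [← F.toExt_ract_lact_of_mem hS hρ hφ hψ, hf', ← hf.ract, ← hf.lact]
  exact G.toExt_ract_lact_mem hS (fun a => (hφ' a).1) (fun a => (hψ' a).2) _

end Frame

end Isotypic

/-! ## Invariant forms -/

section Invariant

variable {M N : HopfBimodule A} {B : M →ₗ[ℂ] N →ₗ[ℂ] ℂ}

/-- If `m₍₋₁₎ n₍₋₁₎ B(m₍₀₎, n₍₀₎) = B(m, n) 1`, then the left action of `φ` has an adjoint. -/
theorem form_lact_antipode (hB : ∀ m n, TensorProduct.rid ℂ A
      (TensorProduct.map₂ (LinearMap.mul ℂ A) B (M.dl m) (N.dl n)) = B m n • (1 : A))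
    (φ : A →ₗ[ℂ] ℂ) (m : M) (n : N) : B (M.lact (φ ∘ₗ 𝓢) m) n = B m (N.lact φ n) := by
  let P : A ⊗[ℂ] M →ₗ[ℂ] A := (TensorProduct.rid ℂ A).toLinearMap ∘ₗ
    (TensorProduct.map₂ (LinearMap.mul ℂ A) B).flip (N.dl n)
  -- The proof evaluates `φ(S(m₍₋₂₎) m₍₋₁₎ n₍₋₁₎) B(m₍₀₎, n₍₀₎)` in two ways: by invariance of `B`,
  -- and by cancelling the antipode.
  let T : A ⊗[ℂ] (A ⊗[ℂ] M) →ₗ[ℂ] ℂ := φ ∘ₗ LinearMap.mul' ℂ A ∘ₗ TensorProduct.map 𝓢 P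
  have hP₀ : ∀ x, P x = TensorProduct.rid ℂ A
      (TensorProduct.map₂ (LinearMap.mul ℂ A) B x (N.dl n)) := fun _ => rfl
  have hP : ∀ m, P (M.dl m) = B m n • (1 : A) := fun m => hB m n
  have hP₂ : ∀ a b m, P ((a * b) ⊗ₜ m) = a * P (b ⊗ₜ m) := by
    intro a b m
    rw [hP₀, hP₀]
    generalize N.dl n = y
    induction y with
    | zero => simp
    | add y z hy hz => simp only [map_add, mul_add, hy, hz]
    | tmul c n => simp [mul_assoc]
  have hP₃ : ∀ m, φ (P (1 ⊗ₜ m)) = B m (N.lact φ n) := by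
    intro m
    rw [hP₀, HopfBimodule.lact, LinearMap.comp_apply]
    generalize N.dl n = y
    induction y with
    | zero => simp
    | add y z hy hz => simp only [map_add, hy, hz]
    | tmul c n => simp [mul_comm]
  have h₁ : ∀ z, T (M.dl.lTensor A z) = B (lslice (φ ∘ₗ 𝓢) z) n := by
    intro z
    induction z with
    | zero => simp
    | add y z hy hz => simp only [map_add, LinearMap.add_apply, hy, hz]
    | tmul c m => simp [T, hP, mul_comm]
  have h₂ : ∀ z, T (TensorProduct.assoc ℂ A A M ((Δ).rTensor M z)) =
      B (TensorProduct.lid ℂ M ((ε).rTensor M z)) (N.lact φ n) := by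
    intro z
    induction z with
    | zero => simp
    | add y z hy hz => simp only [map_add, LinearMap.add_apply, hy, hz]
    | tmul a m =>
      have h₃ : ∀ y : A ⊗[ℂ] A, LinearMap.mul' ℂ A (TensorProduct.map 𝓢 P
          (TensorProduct.assoc ℂ A A M (y ⊗ₜ m))) =
          LinearMap.mul' ℂ A ((𝓢).rTensor A y) * P (1 ⊗ₜ m) := by
        intro y
        induction y with
        | zero => simp
        | add y z hy hz => simp only [map_add, TensorProduct.add_tmul, add_mul, hy, hz]
        | tmul b c =>
          simp only [TensorProduct.assoc_tmul, TensorProduct.map_tmul, LinearMap.mul'_apply,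
            LinearMap.rTensor_tmul]
          have h₃ := hP₂ c 1 m
          rw [mul_one] at h₃
          rw [h₃, mul_assoc]
      have h₄ : LinearMap.mul' ℂ A ((𝓢).rTensor A (Δ a)) = algebraMap ℂ A (ε a) :=
        HopfAlgebra.mul_antipode_rTensor_comul_apply a
      rw [LinearMap.rTensor_tmul, LinearMap.rTensor_tmul, TensorProduct.lid_tmul, map_smul,
        LinearMap.smul_apply, ← hP₃]
      change φ (LinearMap.mul' ℂ A (TensorProduct.map 𝓢 P _)) = _
      rw [h₃, h₄, ← Algebra.smul_def, map_smul]
  have h₅ := h₂ (M.dl m)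
  rw [M.coassoc_left, h₁, M.counit_left] at h₅
  exact h₅

/-- If `B(m₍₀₎, n₍₀₎) m₍₁₎ n₍₁₎ = B(m, n) 1`, then the right action of `φ` has an adjoint. -/
theorem form_ract_antipode (hB : ∀ m n, TensorProduct.lid ℂ A
      (TensorProduct.map₂ B (LinearMap.mul ℂ A) (M.dr m) (N.dr n)) = B m n • (1 : A))
    (φ : A →ₗ[ℂ] ℂ) (m : M) (n : N) : B (M.ract φ m) n = B m (N.ract (φ ∘ₗ 𝓢) n) := by
  let P : N ⊗[ℂ] A →ₗ[ℂ] A := (TensorProduct.lid ℂ A).toLinearMap ∘ₗ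
    (TensorProduct.map₂ B (LinearMap.mul ℂ A)) (M.dr m)
  -- Here the expression is `B(m₍₀₎, n₍₀₎) φ(m₍₁₎ n₍₁₎ S(n₍₂₎))`. The antipode therefore ends up on
  -- the other argument than for the left action.
  let T : (N ⊗[ℂ] A) ⊗[ℂ] A →ₗ[ℂ] ℂ := φ ∘ₗ LinearMap.mul' ℂ A ∘ₗ TensorProduct.map P 𝓢
  have hP : ∀ n, P (N.dr n) = B m n • (1 : A) := fun n => hB m n
  have hP₂ : ∀ a b n, P (n ⊗ₜ (a * b)) = P (n ⊗ₜ a) * b := by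
    intro a b n
    change TensorProduct.lid ℂ A (TensorProduct.map₂ B (LinearMap.mul ℂ A) (M.dr m) _) =
      TensorProduct.lid ℂ A (TensorProduct.map₂ B (LinearMap.mul ℂ A) (M.dr m) _) * b
    generalize M.dr m = y
    induction y with
    | zero => simp
    | add y z hy hz => simp only [map_add, LinearMap.add_apply, add_mul, hy, hz]
    | tmul m c => simp [mul_assoc]
  have hP₃ : ∀ n, φ (P (n ⊗ₜ 1)) = B (M.ract φ m) n := by
    intro n
    change φ (TensorProduct.lid ℂ A (TensorProduct.map₂ B (LinearMap.mul ℂ A) (M.dr m) _)) =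
      B (rslice φ (M.dr m)) n
    generalize M.dr m = y
    induction y with
    | zero => simp
    | add y z hy hz => simp only [map_add, LinearMap.add_apply, hy, hz]
    | tmul m c => simp [mul_comm]
  have h₁ : ∀ z, T (N.dr.rTensor A z) = B m (rslice (φ ∘ₗ 𝓢) z) := by
    intro z
    induction z with
    | zero => simp
    | add y z hy hz => simp only [map_add, hy, hz]
    | tmul n c => simp [T, hP, mul_comm]
  have h₂ : ∀ z, T ((TensorProduct.assoc ℂ N A A).symm ((Δ).lTensor N z)) =
      B (M.ract φ m) (TensorProduct.rid ℂ N ((ε).lTensor N z)) := by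
    intro z
    induction z with
    | zero => simp
    | add y z hy hz => simp only [map_add, hy, hz]
    | tmul n a =>
      have h₃ : ∀ y : A ⊗[ℂ] A, LinearMap.mul' ℂ A (TensorProduct.map P 𝓢
          ((TensorProduct.assoc ℂ N A A).symm (n ⊗ₜ y))) =
          P (n ⊗ₜ 1) * LinearMap.mul' ℂ A ((𝓢).lTensor A y) := by
        intro y
        induction y with
        | zero => simp
        | add y z hy hz => simp only [map_add, TensorProduct.tmul_add, mul_add, hy, hz]
        | tmul b c =>
          simp only [TensorProduct.assoc_symm_tmul, TensorProduct.map_tmul, LinearMap.mul'_apply,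
            LinearMap.lTensor_tmul]
          have h₃ := hP₂ 1 b n
          rw [one_mul] at h₃
          rw [h₃, mul_assoc]
      have h₄ : LinearMap.mul' ℂ A ((𝓢).lTensor A (Δ a)) = algebraMap ℂ A (ε a) :=
        HopfAlgebra.mul_antipode_lTensor_comul_apply a
      rw [LinearMap.lTensor_tmul, LinearMap.lTensor_tmul, TensorProduct.rid_tmul, map_smul, ← hP₃]
      change φ (LinearMap.mul' ℂ A (TensorProduct.map P 𝓢 _)) = _
      rw [h₃, h₄, ← Algebra.commutes, ← Algebra.smul_def, map_smul]
  have h₅ := h₂ (N.dr n)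
  rw [← N.coassoc_right, LinearEquiv.symm_apply_apply, h₁, N.counit_right] at h₅
  exact h₅.symm

end Invariant

/-! ### Covariance of contractions and of tensoring with biinvariant forms -/

section BracketCovariance

variable {Γ Λ : HopfBimodule A} {g : Hom (tensor Γ Λ) (unit A)}

theorem IsBicomoduleMap.peel (hg : IsBicomoduleMap (tensor Γ Λ) (unit A) g.toLinearMap) (n : ℕ) :
    IsBicomoduleMap (tensor Γ (tpow Λ (n + 1))) (tpow Λ n) (peel g n).toLinearMap := by
  induction n with
  | zero => exact (map (f := Hom.id Γ) id (lunit Λ)).andThen hg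
  | succ n ih =>
    exact (assocInv Γ (tpow Λ (n + 1)) Λ).andThen (map (k := Hom.id Λ) ih id)

theorem IsBicomoduleMap.gtildeL (hg : IsBicomoduleMap (tensor Γ Λ) (unit A) g.toLinearMap)
    (l k m : ℕ) (h : k = m + l) :
    IsBicomoduleMap (tensor (tpow Γ k) (tpow Λ l)) (tpow Γ m) (gtildeL g l k m h).toLinearMap := by
  induction l generalizing k with
  | zero => exact (runit (tpow Γ k)).andThen (tcast Γ h)
  | succ l ih =>
    cases k with
    | zero => omega
    | succ k =>
      exact ((assoc (tpow Γ k) Γ (tpow Λ (l + 1))).andThen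
        (map (f := Hom.id (tpow Γ k)) id (hg.peel l))).andThen (ih k (by omega))

theorem IsBicomoduleMap.tmulHom (Γ : HopfBimodule A) (l k n : ℕ) (h : n = k + l) :
    IsBicomoduleMap (tensor (tpow Γ k) (tpow Γ l)) (tpow Γ n)
      (tmulHom Γ l k n h).toLinearMap := by
  induction l generalizing n with
  | zero => exact (runit (tpow Γ k)).andThen (tcast Γ h.symm)
  | succ l ih =>
    cases n with
    | zero => omega
    | succ n =>
      exact (assocInv (tpow Γ k) (tpow Γ l) Γ).andThen (map (k := Hom.id Γ) (ih n (by omega)) id)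

theorem isBicomoduleMap_tm_left {M : HopfBimodule A} {ω : M} (hl : ω ∈ M.leftCoinv)
    (hr : ω ∈ M.rightCoinv) (N : HopfBimodule A) :
    IsBicomoduleMap N (tensor M N) (tm M N ω) := by
  have hr' : M.dr ω = ω ⊗ₜ 1 := by simpa [HopfBimodule.rightCoinv, sub_eq_zero] using hr
  refine ⟨fun x => ?_, fun x => ?_⟩
  · rw [dl_tm, (M.mem_leftCoinv ω).1 hl]
    generalize N.dl x = y
    induction y with
    | zero => simp
    | add y z hy hz => simp only [map_add, hy, hz]
    | tmul c n => simp
  · rw [dr_tm, hr']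
    generalize N.dr x = y
    induction y with
    | zero => simp
    | add y z hy hz => simp only [map_add, hy, hz]
    | tmul c n => simp

theorem isBicomoduleMap_tm_right {N : HopfBimodule A} {ω : N} (hl : ω ∈ N.leftCoinv)
    (hr : ω ∈ N.rightCoinv) (M : HopfBimodule A) :
    IsBicomoduleMap M (tensor M N) ((tm M N).flip ω) := by
  have hr' : N.dr ω = ω ⊗ₜ 1 := by simpa [HopfBimodule.rightCoinv, sub_eq_zero] using hr
  refine ⟨fun x => ?_, fun x => ?_⟩
  · rw [LinearMap.flip_apply, dl_tm, (N.mem_leftCoinv ω).1 hl]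
    generalize M.dl x = y
    induction y with
    | zero => simp
    | add y z hy hz => simp only [map_add, LinearMap.add_apply, hy, hz]
    | tmul c n => simp
  · rw [LinearMap.flip_apply, dr_tm, hr']
    generalize M.dr x = y
    induction y with
    | zero => simp
    | add y z hy hz => simp only [map_add, LinearMap.add_apply, hy, hz]
    | tmul c n => simp

end BracketCovariance

/-! ## The Haar functional and contractions -/

namespace IsHaarFunctional

variable {h : A →ₗ[ℂ] ℂ}

/-- Since `h = ε ∘ rhit h`, a covariant map carries `h` to the action of `h` on its argument. For
the Haar functional that argument becomes right coinvariant. -/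
theorem apply_eq_counit_ract (h : A →ₗ[ℂ] ℂ) {M : HopfBimodule A} {f : M →ₗ[ℂ] A}
    (hf : ∀ x, Δ (f x) = f.rTensor A (M.dr x)) (x : M) : h (f x) = ε (f (M.ract h x)) := by
  rw [← counit_rhit, rhit, LinearMap.comp_apply, hf, rslice_rTensor]
  rfl

theorem dr_ract (hh : IsHaarFunctional h) {M : HopfBimodule A} (x : M) :
    M.dr (M.ract h x) = M.ract h x ⊗ₜ 1 := by
  rw [HopfBimodule.dr_ract, HopfBimodule.ract, LinearMap.comp_apply]
  generalize M.dr x = y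
  induction y with
  | zero => simp
  | add y z hy hz => simp only [map_add, TensorProduct.add_tmul, hy, hz]
  | tmul m a =>
    rw [LinearMap.lTensor_tmul, ((isHaarFunctional_iff h).1 hh).2.1, rslice_tmul,
      TensorProduct.smul_tmul]

/-- Pairing with a bi-invariant form is symmetric under the Haar functional. -/
theorem metric_symm (hh : IsHaarFunctional h) {Γ : Sgn → HopfBimodule A} (g : SigmaMetric Γ)
    {τ τ' : Sgn} (hτ : τ ≠ τ') {ω : Γ τ} (hl : ω ∈ (Γ τ).leftCoinv) (hr : ω ∈ (Γ τ).rightCoinv)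
    (x : Γ τ') :
    h ((g.g hτ).toA (tm _ _ ω x)) = h ((g.g hτ.symm).toA (tm _ _ x ω)) := by
  have hl' := isBicomoduleMap_tm_left hl hr (Γ τ')
  have hr' := isBicomoduleMap_tm_right hl hr (Γ τ')
  have h₁ := apply_eq_counit_ract h (f := (g.g hτ).toA) (g.covariant_right hτ) (tm _ _ ω x)
  have h₂ := apply_eq_counit_ract h (f := (g.g hτ.symm).toA) (g.covariant_right hτ.symm)
    (tm _ _ x ω)
  rw [hl'.ract] at h₁
  have h₃ := hr'.ract h x
  rw [LinearMap.flip_apply, LinearMap.flip_apply] at h₃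
  rw [h₃] at h₂
  -- After averaging, `x` is right coinvariant, so `σ(ω ⊗ x) = x ⊗ (ω ◁ 1) = x ⊗ ω`, and `g ∘ σ = g`
  -- finishes.
  rw [h₁, h₂, ← g.sigma_symm hτ, HopfBimodule.braiding_of_leftCoinv _ _ _ hl, hh.dr_ract]
  congr 2
  simp [HopfBimodule.braidCore, HopfBimodule.adj_one]

end IsHaarFunctional

namespace SigmaMetric

variable {Γ : Sgn → HopfBimodule A} (g : SigmaMetric Γ) {τ τ' : Sgn} (hτ : τ ≠ τ')

theorem isBicomoduleMap :
    IsBicomoduleMap (tensor (Γ τ) (Γ τ')) (unit A) (g.g hτ).toLinearMap :=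
  ⟨g.covariant_left hτ, g.covariant_right hτ⟩

variable {h : A →ₗ[ℂ] ℂ}

/-- The contraction is a bicomodule map, so this is the invariance of `h` at its value. -/
theorem bracket_invariant_left (hh : IsHaarFunctional h) (k : ℕ) (x : tpow (Γ τ) k)
    (z : tpow (Γ τ') k) : TensorProduct.rid ℂ A (TensorProduct.map₂ (LinearMap.mul ℂ A)
      ((bracket (g.g hτ) k).compr₂ h) ((tpow (Γ τ) k).dl x) ((tpow (Γ τ') k).dl z)) =
      (bracket (g.g hτ) k).compr₂ h x z • (1 : A) := by
  let P := (gtildeL (g.g hτ) k k 0 (Nat.zero_add k).symm)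
  have h₁ : Δ (bracket (g.g hτ) k x z) = (fromZero (Γ τ) ∘ₗ P.toLinearMap).lTensor A
      ((tensor (tpow (Γ τ) k) (tpow (Γ τ') k)).dl (tm _ _ x z)) :=
    ((g.isBicomoduleMap hτ).gtildeL k k 0 (Nat.zero_add k).symm).1 _
  have h₂ := ((isHaarFunctional_iff h).1 hh).2.1 (bracket (g.g hτ) k x z)
  rw [rhit, LinearMap.comp_apply, h₁, rslice_lTensor, dl_tm] at h₂
  rw [LinearMap.compr₂_apply, ← h₂]
  generalize (tpow (Γ τ) k).dl x = y
  generalize (tpow (Γ τ') k).dl z = w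
  induction y with
  | zero => simp
  | add y y' hy hy' => simp only [map_add, LinearMap.add_apply, hy, hy']
  | tmul a m =>
    induction w with
    | zero => simp
    | add y y' hy hy' => simp only [map_add, hy, hy']
    | tmul b n =>
      rw [diagL_tmul, rslice_tmul, TensorProduct.map₂_apply_tmul, TensorProduct.map_tmul,
        TensorProduct.rid_tmul]
      rfl

theorem bracket_invariant_right (hh : IsHaarFunctional h) (k : ℕ) (x : tpow (Γ τ) k)
    (z : tpow (Γ τ') k) : TensorProduct.lid ℂ A (TensorProduct.map₂
      ((bracket (g.g hτ) k).compr₂ h) (LinearMap.mul ℂ A) ((tpow (Γ τ) k).dr x)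
      ((tpow (Γ τ') k).dr z)) =
      (bracket (g.g hτ) k).compr₂ h x z • (1 : A) := by
  let P := (gtildeL (g.g hτ) k k 0 (Nat.zero_add k).symm)
  have h₁ : Δ (bracket (g.g hτ) k x z) = (fromZero (Γ τ) ∘ₗ P.toLinearMap).rTensor A
      ((tensor (tpow (Γ τ) k) (tpow (Γ τ') k)).dr (tm _ _ x z)) :=
    ((g.isBicomoduleMap hτ).gtildeL k k 0 (Nat.zero_add k).symm).2 _
  have h₂ := ((isHaarFunctional_iff h).1 hh).2.2 (bracket (g.g hτ) k x z)
  rw [lhit, LinearMap.comp_apply, h₁, lslice_rTensor, dr_tm] at h₂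
  rw [LinearMap.compr₂_apply, ← h₂]
  generalize (tpow (Γ τ) k).dr x = y
  generalize (tpow (Γ τ') k).dr z = w
  induction y with
  | zero => simp
  | add y y' hy hy' => simp only [map_add, LinearMap.add_apply, hy, hy']
  | tmul m a =>
    induction w with
    | zero => simp
    | add y y' hy hy' => simp only [map_add, hy, hy']
    | tmul n b =>
      rw [diagR_tmul, lslice_tmul, TensorProduct.map₂_apply_tmul, TensorProduct.map_tmul,
        TensorProduct.lid_tmul]
      rfl

section Pairing

/-- The antisymmetriser commutes with the action of `φ`, so the adjunction for `h ∘ g̃` passes to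
the exterior powers. -/
theorem haar_pairing_lact (F : ∀ τ, Frame (Γ τ)) (hS : Function.Bijective (𝓢))
    (k : ℕ) (s : Sgn) (hh : IsHaarFunctional h) (φ : A →ₗ[ℂ] ℂ) (x : tpow (Γ τ) k)
    (z : tpow (Γ τ') k) :
    h (pairing (g.g hτ) s k (toExt (Γ τ) k ((tpow (Γ τ) k).lact (φ ∘ₗ 𝓢) x))
      (toExt (Γ τ') k z)) =
    h (pairing (g.g hτ) s k (toExt (Γ τ) k x) (toExt (Γ τ') k ((tpow (Γ τ') k).lact φ z))) := by
  rw [g.pairing_toExt hτ F hS, g.pairing_toExt hτ F hS, ← ((F τ').antisym_mem hS k s).1.lact]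
  exact form_lact_antipode (g.bracket_invariant_left hτ hh k) φ x _

theorem haar_pairing_ract (F : ∀ τ, Frame (Γ τ)) (hS : Function.Bijective (𝓢))
    (k : ℕ) (s : Sgn) (hh : IsHaarFunctional h) (φ : A →ₗ[ℂ] ℂ) (x : tpow (Γ τ) k)
    (z : tpow (Γ τ') k) :
    h (pairing (g.g hτ) s k (toExt (Γ τ) k ((tpow (Γ τ) k).ract φ x)) (toExt (Γ τ') k z)) =
    h (pairing (g.g hτ) s k (toExt (Γ τ) k x)
      (toExt (Γ τ') k ((tpow (Γ τ') k).ract (φ ∘ₗ 𝓢) z))) := by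
  rw [g.pairing_toExt hτ F hS, g.pairing_toExt hτ F hS, ← ((F τ').antisym_mem hS k s).1.ract]
  exact form_ract_antipode (g.bracket_invariant_right hτ hh k) φ x _

/-- Replacing `ζ` by `ζ a` multiplies the pairing by `a` from the right. Faithfulness of `h` then
makes the `A`-valued pairing vanish, and non-degeneracy of `g̃` gives `A_k x = 0`. -/
theorem eq_zero_of_haar_pairing_left (F : ∀ τ, Frame (Γ τ)) (hS : Function.Bijective (𝓢))
    (k : ℕ) (s : Sgn) [FiniteDimensional ℂ (Γ τ).leftCoinv]
    (hh : IsHaarFunctional h) {ρ : ExtPow (Γ τ) k}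
    (hρ : ∀ ζ, h (pairing (g.g hτ) s k ρ ζ) = 0) : ρ = 0 := by
  obtain ⟨x, rfl⟩ := toExt_surjective (Γ τ) k ρ
  rw [toExt_eq_zero]
  refine ((F τ).antisym_eq_zero_iff hS s).1 ((g.bracket_nondegenerate hτ (F τ) hS k).1 _ fun z => ?_)
  refine hh.eq_zero_of_forall_mul_right fun a => ?_
  rw [g.bracket_antisym hτ F hS, ← bracket_apply_rsmul, ← ((F τ').antisym_mem hS k s).2.2,
    ← g.pairing_toExt hτ F hS]
  exact hρ _

theorem eq_zero_of_haar_pairing_right (F : ∀ τ, Frame (Γ τ)) (hS : Function.Bijective (𝓢))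
    (k : ℕ) (s : Sgn) [FiniteDimensional ℂ (Γ τ).leftCoinv]
    (hh : IsHaarFunctional h) {ζ : ExtPow (Γ τ') k}
    (hζ : ∀ ρ, h (pairing (g.g hτ) s k ρ ζ) = 0) : ζ = 0 := by
  obtain ⟨z, rfl⟩ := toExt_surjective (Γ τ') k ζ
  rw [toExt_eq_zero]
  refine ((F τ').antisym_eq_zero_iff hS s).1 ((g.bracket_nondegenerate hτ (F τ) hS k).2 _ fun x => ?_)
  refine hh.eq_zero_of_forall_mul_left fun a => ?_
  rw [← bracket_lsmul, ← g.pairing_toExt hτ F hS]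
  exact hζ _

/-- A form in one isotypic component pairs with an arbitrary form as with the projection of the
latter to the contragredient component, because the adjoint of the projection acts as the identity
on the first form. So non-degeneracy on the full exterior powers restricts. -/
theorem nondegenerate_haar_pairing (F : ∀ τ, Frame (Γ τ)) (hS : Function.Bijective (𝓢))
    (k : ℕ) (s : Sgn) (hA : IsCosemisimple A) [FiniteDimensional ℂ (Γ τ).leftCoinv]
    (hh : IsHaarFunctional h) {m n : ℕ} {u : Matrix (Fin m) (Fin m) A}
    {v : Matrix (Fin n) (Fin n) A} (hu : IsCorep u) (hv : IsCorep v) :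
    (((pairing (g.g hτ) s k).compr₂ h).domRestrict₁₂ (isotypic (Γ τ) k u v)
      (isotypic (Γ τ') k (contragredient u) (contragredient v))).Nondegenerate := by
  have hmem : ∀ {l : ℕ} (w : Matrix (Fin l) (Fin l) A), ∀ c ∈ matrixElements w,
      𝓢 c ∈ matrixElements (contragredient w) := fun w c hc => by
    rw [IsCorep.matrixElements_contragredient]
    exact Submodule.mem_map_of_mem hc
  have hcounit : ∀ c : A, ε (𝓢 c) = ε c := fun c => by simp
  obtain ⟨T, hT⟩ : ∃ T : A →ₗ[ℂ] A, ∀ a, T (𝓢 a) = a :=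
    ⟨(LinearEquiv.ofBijective _ hS).symm.toLinearMap,
      (LinearEquiv.ofBijective _ hS).symm_apply_apply⟩
  have hcomp : ∀ φ : A →ₗ[ℂ] ℂ, (φ ∘ₗ T) ∘ₗ 𝓢 = φ := fun φ => LinearMap.ext fun a => by simp [hT]
  -- Moving functionals across the pairing uses `S` for the left coaction and in the opposite
  -- direction for the right one. So only the right coaction needs `C(v) = S²(C(v))`.
  have hsq := hh.map_antipode_antipode hA hv.stable_matrixElements
  constructor
  · rintro ⟨ρ, hρ⟩ h₀
    apply Subtype.ext
    refine g.eq_zero_of_haar_pairing_left hτ F hS k s hh fun ζ => ?_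
    obtain ⟨x, rfl⟩ := toExt_surjective (Γ τ) k ρ
    obtain ⟨z, rfl⟩ := toExt_surjective (Γ τ') k ζ
    obtain ⟨φ, hφ, hφ'⟩ := exists_support_functional hA hu.contragredient.stable_matrixElements
    obtain ⟨ψ, hψ, hψ'⟩ := exists_support_functional hA hv.contragredient.stable_matrixElements
    have h₁ := h₀ ⟨_, (F τ').toExt_ract_lact_mem hS (fun a => (hφ' a).1) (fun a => (hψ' a).2) z⟩
    change h (pairing (g.g hτ) s k (toExt (Γ τ) k x) (toExt (Γ τ') k _)) = 0 at h₁
    rw [← hcomp ψ, ← g.haar_pairing_ract hτ F hS k s hh, (F τ).toExt_ract_of_mem hS hρ,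
      ← g.haar_pairing_lact hτ F hS k s hh, (F τ).toExt_lact_of_mem hS hρ] at h₁
    · exact h₁
    · intro c hc
      rw [LinearMap.comp_apply, hφ _ (hmem u c hc), hcounit]
    · intro c hc
      -- An element of `C(v)` is written as `S(S c)`, and its preimage `S c` under `S` belongs to
      -- `C(vᶜ)`, where `ψ` is the counit.
      rw [← hsq] at hc
      obtain ⟨_, ⟨c, hc, rfl⟩, rfl⟩ := hc
      rw [LinearMap.comp_apply, hT, hψ _ (hmem v c hc), hcounit, hcounit, hcounit]
  · rintro ⟨ζ, hζ⟩ h₀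
    apply Subtype.ext
    refine g.eq_zero_of_haar_pairing_right hτ F hS k s hh fun ρ => ?_
    obtain ⟨z, rfl⟩ := toExt_surjective (Γ τ') k ζ
    obtain ⟨x, rfl⟩ := toExt_surjective (Γ τ) k ρ
    obtain ⟨φ, hφ, hφ'⟩ := exists_support_functional hA hu.stable_matrixElements
    obtain ⟨ψ, hψ, hψ'⟩ := exists_support_functional hA hv.stable_matrixElements
    have h₁ := h₀ ⟨_, (F τ).toExt_ract_lact_mem hS (fun a => (hφ' a).1) (fun a => (hψ' a).2) x⟩
    change h (pairing (g.g hτ) s k (toExt (Γ τ) k _) (toExt (Γ τ') k z)) = 0 at h₁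
    rw [g.haar_pairing_ract hτ F hS k s hh, (F τ').toExt_ract_of_mem hS hζ, ← hcomp φ,
      g.haar_pairing_lact hτ F hS k s hh, (F τ').toExt_lact_of_mem hS hζ] at h₁
    · exact h₁
    · intro c hc
      rw [IsCorep.matrixElements_contragredient] at hc
      obtain ⟨c, hc, rfl⟩ := hc
      rw [LinearMap.comp_apply, hT, hφ c hc, hcounit]
    · intro c hc
      rw [IsCorep.matrixElements_contragredient] at hc
      rw [LinearMap.comp_apply, hψ, hcounit]
      rw [← hsq]
      exact Submodule.mem_map_of_mem hc

end Pairing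

end SigmaMetric

/-! ## The differential and the codifferential -/

section Biinvariant

variable {Γ Λ : HopfBimodule A} {ω : Γ}

/-- The map on `Γ^{⊗ k}` which induces `ρ ↦ ω ∧ ρ - (-1)^k ρ ∧ ω`. -/
def preD (ω : Γ) (k : ℕ) : tpow Γ k →ₗ[ℂ] (tpow Γ (k + 1)).carrier :=
  lapp Γ k ω + (-(-1 : ℂ) ^ k) • (tapp Γ k).flip ω

theorem Frame.innerD_toExt (F : Frame Γ) (hS : Function.Bijective (𝓢)) (ω : Γ) (k : ℕ)
    (x : tpow Γ k) : innerD Γ ω k (toExt Γ k x) = toExt Γ (k + 1) (preD ω k x) := by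
  rw [innerD, LinearMap.sub_apply, LinearMap.smul_apply, LinearMap.flip_apply,
    F.wedge_oneForm hS, F.oneForm_wedge hS, preD, LinearMap.add_apply, map_add,
    LinearMap.smul_apply, map_smul, neg_smul, sub_eq_add_neg]
  rfl

/-- The map on `Γ^{⊗ k+1}` which induces the codifferential. -/
def preCodiff (g : Hom (tensor Γ Λ) (unit A)) (g' : Hom (tensor Λ Γ) (unit A)) (s : Sgn) (ω : Λ)
    (k : ℕ) : tpow Γ (k + 1) →ₗ[ℂ] (tpow Γ k).carrier :=
  (endContract g k).flip ω ∘ₗ shuffleSum Γ k (k + 1) s +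
    (-1 : ℂ) ^ (k + 1) • peelMap g' k ω ∘ₗ shuffleSum Γ 1 (k + 1) s

theorem Frame.codiff_toExt (F : Frame Γ) (hS : Function.Bijective (𝓢))
    (g : Hom (tensor Γ Λ) (unit A)) (g' : Hom (tensor Λ Γ) (unit A)) (s : Sgn) (ω : Λ)
    (k : ℕ) (x : tpow Γ (k + 1)) :
    codiff g g' s ω k (toExt Γ (k + 1) x) = toExt Γ k (preCodiff g g' s ω k x) := by
  rw [codiff, LinearMap.add_apply, LinearMap.smul_apply, LinearMap.flip_apply,
    contractL_oneForm g F hS, contractR_oneForm g' F hS, preCodiff, LinearMap.add_apply, map_add,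
    LinearMap.smul_apply, map_smul]
  rfl

theorem tapp_one_mem_leftCoinv (hl : ω ∈ Γ.leftCoinv) :
    tapp Γ 0 (tzero Γ 1) ω ∈ (tpow Γ 1).leftCoinv := by
  have h : (tpow Γ 0).dl (tzero Γ 1) = 1 ⊗ₜ tzero Γ 1 :=
    Bialgebra.comul_one (R := ℂ) (A := A)
  refine ((tpow Γ 1).mem_leftCoinv _).2 ((dl_tm (M := tpow Γ 0) _ _).trans ?_)
  rw [h, (Γ.mem_leftCoinv ω).1 hl, diagL_tmul, one_mul]
  rfl

theorem HopfBimodule.mem_rightCoinv (M : HopfBimodule A) (m : M) :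
    m ∈ M.rightCoinv ↔ M.dr m = m ⊗ₜ 1 := by
  simp [HopfBimodule.rightCoinv, sub_eq_zero]

theorem tapp_one_mem_rightCoinv (hr : ω ∈ Γ.rightCoinv) :
    tapp Γ 0 (tzero Γ 1) ω ∈ (tpow Γ 1).rightCoinv := by
  have h : (tpow Γ 0).dr (tzero Γ 1) = tzero Γ 1 ⊗ₜ 1 :=
    Bialgebra.comul_one (R := ℂ) (A := A)
  refine ((tpow Γ 1).mem_rightCoinv _).2 ((dr_tm (M := tpow Γ 0) _ _).trans ?_)
  rw [h, (Γ.mem_rightCoinv ω).1 hr, diagR_tmul, one_mul]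
  rfl

/-- Tensoring with a biinvariant form on either side commutes with both coactions. -/
theorem isBicomoduleMap_preD (hl : ω ∈ Γ.leftCoinv) (hr : ω ∈ Γ.rightCoinv) (k : ℕ) :
    IsBicomoduleMap (tpow Γ k) (tpow Γ (k + 1)) (preD ω k) := by
  refine IsBicomoduleMap.add ?_ (IsBicomoduleMap.smul _ (isBicomoduleMap_tm_right hl hr _))
  exact (IsBicomoduleMap.tmulHom Γ k 1 (k + 1) _).comp
    (isBicomoduleMap_tm_left (tapp_one_mem_leftCoinv hl) (tapp_one_mem_rightCoinv hr) (tpow Γ k))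

theorem isBicomoduleMap_preCodiff (F : Frame Λ) (hS : Function.Bijective (𝓢))
    {g : Hom (tensor Λ Γ) (unit A)} {g' : Hom (tensor Γ Λ) (unit A)}
    (hg : IsBicomoduleMap (tensor Λ Γ) (unit A) g.toLinearMap)
    (hg' : IsBicomoduleMap (tensor Γ Λ) (unit A) g'.toLinearMap)
    (hl : ω ∈ Γ.leftCoinv) (hr : ω ∈ Γ.rightCoinv) (s : Sgn) (k : ℕ) :
    IsBicomoduleMap (tpow Λ (k + 1)) (tpow Λ k) (preCodiff g g' s ω k) := by
  refine IsBicomoduleMap.add ?_ (IsBicomoduleMap.smul _ ?_)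
  · exact ((hg.gtildeL 1 (k + 1) k rfl).comp (isBicomoduleMap_tm_right (tapp_one_mem_leftCoinv hl)
      (tapp_one_mem_rightCoinv hr) (tpow Λ (k + 1)))).comp (F.shuffleSum_mem hS k (k + 1) s).1
  · exact ((hg'.peel k).comp (isBicomoduleMap_tm_left hl hr (tpow Λ (k + 1)))).comp
      (F.shuffleSum_mem hS 1 (k + 1) s).1

end Biinvariant

namespace SigmaMetric

variable {Γ : Sgn → HopfBimodule A} (g : SigmaMetric Γ) {τ τ' : Sgn} (hτ : τ ≠ τ')
  {h : A →ₗ[ℂ] ℂ} {ω : Γ τ}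

/-- By `bracket_lapp` the form `ω` meets the last factor `η` only at the end, as `g(ω b, η) = g(ω, b
η)` with `b` the inner contraction. Under `h` this equals `g(b η, ω) = b g(η, ω)`, the contraction
of `η` with `ω` performed beforehand. -/
theorem haar_bracket_lapp (hh : IsHaarFunctional h) (hl : ω ∈ (Γ τ).leftCoinv)
    (hr : ω ∈ (Γ τ).rightCoinv) (k : ℕ) (x : tpow (Γ τ) k) (w : tpow (Γ τ') (k + 1)) :
    h (bracket (g.g hτ) (k + 1) (lapp (Γ τ) k ω x) w) =
      h (bracket (g.g hτ) k x (endContract (g.g hτ.symm) k w ω)) := by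
  induction w using tapp_induction with
  | h0 => simp
  | ha w w' hw hw' => simp only [map_add, LinearMap.add_apply, hw, hw']
  | ht z η =>
    rw [bracket_lapp, endContract_tapp, bracket_apply_rsmul, tm_rsmul, hh.metric_symm g hτ hl hr,
      ← lsmul_tm, toA_lsmul]

/-- The antisymmetriser in the pairing turns both terms of the codifferential into contractions of
the same element `A_{k+1} z`, at its last and at its first factor. These are the adjoints of
tensoring with `ω` from the left and from the right. -/
theorem haar_pairing_innerD (F : ∀ τ, Frame (Γ τ)) (hS : Function.Bijective (𝓢))
    (hh : IsHaarFunctional h) (hl : ω ∈ (Γ τ).leftCoinv) (hr : ω ∈ (Γ τ).rightCoinv) (s : Sgn)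
    (k : ℕ) (ρ : ExtPow (Γ τ) k) (ζ : ExtPow (Γ τ') (k + 1)) :
    h (pairing (g.g hτ) s (k + 1) (innerD (Γ τ) ω k ρ) ζ) =
      h (pairing (g.g hτ) s k ρ (codiff (g.g hτ.symm) (g.g hτ) s ω k ζ)) := by
  obtain ⟨x, rfl⟩ := toExt_surjective (Γ τ) k ρ
  obtain ⟨z, rfl⟩ := toExt_surjective (Γ τ') (k + 1) ζ
  rw [(F τ).innerD_toExt hS, (F τ').codiff_toExt hS, g.pairing_toExt hτ F hS,
    g.pairing_toExt hτ F hS]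
  -- The two factorisations of `A_{k+1}`, over the first and over the last `k` places, absorb the
  -- two shuffle sums.
  have h₁ : antisym (Γ τ') k s (preCodiff (g.g hτ.symm) (g.g hτ) s ω k z) =
      endContract (g.g hτ.symm) k (antisym (Γ τ') (k + 1) s z) ω +
        (-1 : ℂ) ^ (k + 1) • peelMap (g.g hτ) k ω (antisym (Γ τ') (k + 1) s z) := by
    have h₂ := congrArg (fun w => endContract (g.g hτ.symm) k w ω)
      (LinearMap.congr_fun ((F τ').antisym_succ_first hS k s) z)
    have h₃ := congrArg (fun w => peelMap (g.g hτ) k ω w)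
      (LinearMap.congr_fun ((F τ').antisym_succ_last hS k s) z)
    simp only [Module.End.mul_apply] at h₂ h₃
    rw [h₂, h₃, endContract_antisymFirst _ (F τ') hS, peelMap_antisymLast _ (F τ') hS, preCodiff, LinearMap.add_apply, map_add, LinearMap.smul_apply, map_smul]
    rfl
  rw [h₁, preD]
  generalize antisym (Γ τ') (k + 1) s z = w
  simp only [LinearMap.add_apply, map_add, LinearMap.smul_apply, map_smul, LinearMap.flip_apply,
    bracket_succ]
  rw [g.haar_bracket_lapp hτ hh hl hr, pow_succ, mul_neg_one]

end SigmaMetric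

theorem exists_frames {Γ : Sgn → HopfBimodule A}
    (hfin : ∀ τ, FiniteDimensional ℂ (Γ τ).leftCoinv) : Nonempty (∀ τ, Frame (Γ τ)) :=
  ⟨fun τ => have := hfin τ; (exists_frame (Γ τ)).some⟩

end QuantumForms

end

/-! ### The proposition -/

open QuantumForms
theorem proposition6p1 {A : Type u} [Ring A] [HopfAlgebra ℂ A] (hA : IsCosemisimple A)
    (Γ : Sgn → BicovariantFODC A)
    (hfin : ∀ τ, FiniteDimensional ℂ (Γ τ).toHopfBimodule.leftCoinv)
    (g : SigmaMetric (fun τ => (Γ τ).toHopfBimodule)) :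
    (∃! h : A →ₗ[ℂ] ℂ, IsHaarFunctional h) ∧
    ∀ h : A →ₗ[ℂ] ℂ, IsHaarFunctional h →
    ∀ (m n : ℕ) (u : Matrix (Fin m) (Fin m) A) (v : Matrix (Fin n) (Fin n) A),
    IsIrreducibleCorep u → IsIrreducibleCorep v →
    ∀ (τ τ' : Sgn) (hτ : τ ≠ τ') (ε : Sgn) (k : ℕ),
      (((pairing (g.g hτ) ε k).compr₂ h).domRestrict₁₂
        (isotypic (Γ τ).toHopfBimodule k u v)
        (isotypic (Γ τ').toHopfBimodule k (contragredient u) (contragredient v))).Nondegenerate ∧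
      ∀ ω : (Γ τ).carrier, (Γ τ).IsInner ω →
        (∀ ρ ∈ isotypic (Γ τ).toHopfBimodule k u v,
          innerD (Γ τ).toHopfBimodule ω k ρ ∈ isotypic (Γ τ).toHopfBimodule (k + 1) u v) ∧
        (∀ ζ ∈ isotypic (Γ τ').toHopfBimodule (k + 1) (contragredient u) (contragredient v),
          codiff (g.g hτ.symm) (g.g hτ) ε ω k ζ ∈
            isotypic (Γ τ').toHopfBimodule k (contragredient u) (contragredient v)) ∧
        ∀ ρ ∈ isotypic (Γ τ).toHopfBimodule k u v,
        ∀ ζ ∈ isotypic (Γ τ').toHopfBimodule (k + 1) (contragredient u) (contragredient v),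
          h (pairing (g.g hτ) ε (k + 1) (innerD (Γ τ).toHopfBimodule ω k ρ) ζ) =
            h (pairing (g.g hτ) ε k ρ (codiff (g.g hτ.symm) (g.g hτ) ε ω k ζ)) := by
  obtain ⟨F⟩ := exists_frames hfin
  refine ⟨?_, ?_⟩
  · obtain ⟨h, hh⟩ := exists_isHaarFunctional hA
    exact ⟨h, hh, fun k hk => hk.ext hh⟩
  intro h hh m n u v hu hv τ τ' hτ ε k
  -- Bijectivity of the antipode is a consequence of cosemisimplicity; everything about braidings
  -- and exterior powers rests on it.
  have hS : Function.Bijective (HopfAlgebra.antipode ℂ (A := A)) :=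
    ⟨hh.antipode_injective, hh.antipode_surjective⟩
  have := hfin τ
  refine ⟨g.nondegenerate_haar_pairing hτ F hS k ε hA hh hu.1 hv.1, fun ω hω => ⟨?_, ?_, ?_⟩⟩
  · intro ρ hρ
    exact (F τ).toExt_map_mem_isotypic hS (F τ) hA hu.1 hv.1
      (isBicomoduleMap_preD hω.1 hω.2.1 k) (fun x => (F τ).innerD_toExt hS ω k x) hρ
  · intro ζ hζ
    -- The contragredient matrices are again corepresentations, so the argument for the differential
    -- applies with the codifferential in its place.
    exact (F τ').toExt_map_mem_isotypic hS (F τ') hA hu.1.contragredient hv.1.contragredient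
      (isBicomoduleMap_preCodiff (F τ') hS (g.isBicomoduleMap hτ.symm) (g.isBicomoduleMap hτ)
        hω.1 hω.2.1 ε k)
      (fun x => (F τ').codiff_toExt hS (g.g hτ.symm) (g.g hτ) ε ω k x) hζ
  · intro ρ _ ζ _
    exact g.haar_pairing_innerD hτ F hS hh hω.1 hω.2.1 ε k ρ ζ
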